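/- Consider the nonlinear heat equation $u_t=u_{xx}+|u|^\alpha u$ on $(0,\infty)\times\mathbb R$, with $\alpha>0$, and let $\mu\in\mathbb R$, $\mu\neq0$. A regular self-similar solution is a classical solution on $(0,\infty)\times\mathbb R$ of the form $u(t,x)=t^{-1/\alpha}f(x/\sqrt t)$ with a profile $f\in C^2(\mathbb R)$. It is called even (odd) if $u(t,\cdot)$ is even (odd) for all $t>0$. We say that $u$ has initial value $u_0$ if (a) $u(t)\to u_0$ in $L^q(\{|x|>\varepsilon\})$ as $t\downarrow0$, for all $\varepsilon>0$ and all $q\in[1,\infty]$ with $q>\alpha/2$; and (b) if $\alpha>2$, also $u(t)\to u_0$ in $L^p(\mathbb R)+L^q(\mathbb R)$ as $t\downarrow0$, for all $1\le p<\alpha/2<q\le\infty$. **Theorem.** (i) There exists $m_0\ge0$ such that for every integer $m\ge m_0$ there exist at least two different even regular self-similar solutions with initial value $u_0(x)=\mu|x|^{-2/\alpha}$ whose profiles have exactly $2m$ zeros on $\mathbb R$. (ii) There exists $m_0\ge0$ such that for every integer $m\ge m_0$ there exist at least two different odd regular self-similar solutions with initial value $u_0(x)=\mu|x|^{-2/\alpha-1}x$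 whose profiles have exactly $2m+1$ zeros on $\mathbb R$. Moreover, these solutions satisfy $u\in C^1((0,\infty),L^r(\mathbb R))$ and $u_{xx},\,|u|^\alpha u\in C((0,\infty),L^r(\mathbb R))$ for all $r\in[1,\infty]$ with $r>\alpha/2$. If $\alpha>2$, they also satisfy, for all $t>0$, the integral equation $$u(t)=e^{t\Delta}u_0+\int_0^te^{(t-s)\Delta}|u(s)|^\alpha u(s)\,ds$$ (where $e^{t\Delta}$ is convolution with the Gauss kernel $(4\pi t)^{-1/2}e^{-x^2/(4t)}$ and all integrals converge absolutely), each of the three terms is in $C((0,\infty),L^r(\mathbb R))$ for all $r\in(\alpha/2,\infty]$, and the map $t\mapsto u(t)-e^{t\Delta}u_0$, with value $0$ at $t=0$, is in $C([0,\infty),L^r(\mathbb R))$ for all $r\ge1$ with $\frac{\alpha}{2(\alpha+1)}<r<\frac\alpha2$. -/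

import Mathlib

open MeasureTheory Filter Topology Set
open scoped ENNReal

namespace NLHE

noncomputable section

/-- The nonlinearity `|v|^α v`. -/
def nonlin (α v : ℝ) : ℝ := |v| ^ α * v

/-- `u` is a classical solution of `u_t = u_xx + |u|^α u` on `(0,∞) × ℝ`
(the values of `u` at times `t ≤ 0` play no role). -/
def IsClassicalSolution (α : ℝ) (u : ℝ → ℝ → ℝ) : Prop :=
  ContDiffOn ℝ 2 (fun z : ℝ × ℝ => u z.1 z.2) (Ioi 0 ×ˢ univ) ∧
  ∀ t : ℝ, 0 < t → ∀ x : ℝ,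
    deriv (fun s => u s x) t = iteratedDeriv 2 (u t) x + nonlin α (u t x)

/-- `u` is a regular self-similar solution of `u_t = u_xx + |u|^α u` with profile `f`:
`u(t,x) = t^{-1/α} f(x/√t)` with `f` of class `C²` on the whole line. -/
structure IsRegularSelfSimilar (α : ℝ) (u : ℝ → ℝ → ℝ) (f : ℝ → ℝ) : Prop where
  profile_regular : ContDiff ℝ 2 f
  self_similar : ∀ t : ℝ, 0 < t → ∀ x : ℝ, u t x = t ^ (-(1 / α)) * f (x / √t)
  solution : IsClassicalSolution α u

/-- The norm of `L^p(ℝ) + L^q(ℝ)`: the infimum of `‖g‖_p + ‖h‖_q` over all decompositions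
`φ = g + h` almost everywhere with `g ∈ L^p`, `h ∈ L^q`. It is `∞` exactly when `φ` is not in the
space. -/
def sumNorm (p q : ℝ≥0∞) (φ : ℝ → ℝ) : ℝ≥0∞ :=
  ⨅ (g : ℝ → ℝ) (h : ℝ → ℝ) (_ : MemLp g p volume) (_ : MemLp h q volume)
    (_ : φ =ᵐ[volume] fun x => g x + h x), eLpNorm g p volume + eLpNorm h q volume

/-- `u(t) → u₀` as `t ↓ 0` in `L^q({|x| > ε})` for all `ε > 0` and all `q ∈ [1,∞]`, `q > α/2`. -/
def InitialValueAwayFromZero (α : ℝ) (u : ℝ → ℝ → ℝ) (u₀ : ℝ → ℝ) : Prop :=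
  ∀ ε : ℝ, 0 < ε → ∀ q : ℝ≥0∞, 1 ≤ q → ENNReal.ofReal (α / 2) < q →
    MemLp u₀ q (volume.restrict {x : ℝ | ε < |x|}) ∧
    (∀ t : ℝ, 0 < t → MemLp (u t) q (volume.restrict {x : ℝ | ε < |x|})) ∧
    Tendsto (fun t => eLpNorm (fun x => u t x - u₀ x) q (volume.restrict {x : ℝ | ε < |x|}))
      (𝓝[>] 0) (𝓝 0)

/-- `u(t) → u₀` as `t ↓ 0` in `L^p(ℝ) + L^q(ℝ)` for all `1 ≤ p < α/2 < q ≤ ∞`. -/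
def InitialValueInSum (α : ℝ) (u : ℝ → ℝ → ℝ) (u₀ : ℝ → ℝ) : Prop :=
  ∀ p q : ℝ≥0∞, 1 ≤ p → p < ENNReal.ofReal (α / 2) → ENNReal.ofReal (α / 2) < q →
    sumNorm p q u₀ < ∞ ∧
    (∀ t : ℝ, 0 < t → sumNorm p q (u t) < ∞) ∧
    Tendsto (fun t => sumNorm p q (fun x => u t x - u₀ x)) (𝓝[>] 0) (𝓝 0)

/-- `t ↦ v(t)` belongs to `C((0,∞), L^r(ℝ))`. -/
def ContinuousInLp (r : ℝ≥0∞) [Fact (1 ≤ r)] (v : ℝ → ℝ → ℝ) : Prop :=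
  ∃ V : ℝ → Lp ℝ r (volume : Measure ℝ),
    ContinuousOn V (Ioi 0) ∧ ∀ t : ℝ, 0 < t → V t =ᵐ[volume] v t

/-- `t ↦ v(t)` belongs to `C¹((0,∞), L^r(ℝ))`. -/
def ContDiffInLp (r : ℝ≥0∞) [Fact (1 ≤ r)] (v : ℝ → ℝ → ℝ) : Prop :=
  ∃ V : ℝ → Lp ℝ r (volume : Measure ℝ),
    ContDiffOn ℝ 1 V (Ioi 0) ∧ ∀ t : ℝ, 0 < t → V t =ᵐ[volume] v t

/-- `t ↦ v(t)`, given for `t > 0` and with value `0` at `t = 0`,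
belongs to `C([0,∞), L^r(ℝ))`. -/
def ContinuousInLpFromZero (r : ℝ≥0∞) [Fact (1 ≤ r)] (v : ℝ → ℝ → ℝ) : Prop :=
  ∃ V : ℝ → Lp ℝ r (volume : Measure ℝ),
    ContinuousOn V (Ici 0) ∧ V 0 = 0 ∧ ∀ t : ℝ, 0 < t → V t =ᵐ[volume] v t

/-- The Gauss kernel `(4πt)^{-1/2} exp(-x²/(4t))` on the line. -/
def heatKernel (t x : ℝ) : ℝ := (√(4 * Real.pi * t))⁻¹ * Real.exp (-(x ^ 2) / (4 * t))

/-- The heat semigroup `(e^{tΔ} φ)(x)` on the line, `t > 0`. -/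
def heat (t : ℝ) (φ : ℝ → ℝ) (x : ℝ) : ℝ := ∫ y : ℝ, heatKernel t (x - y) * φ y

/-- The Duhamel term `∫₀ᵗ e^{(t-s)Δ} |u(s)|^α u(s) ds`. -/
def duhamel (α : ℝ) (u : ℝ → ℝ → ℝ) (t x : ℝ) : ℝ :=
  ∫ s in (0 : ℝ)..t, heat (t - s) (fun y => nonlin α (u s y)) x

/-- `u(t) = e^{tΔ} u₀ + ∫₀ᵗ e^{(t-s)Δ} |u(s)|^α u(s) ds` for all `t > 0`, everywhere on `ℝ`,
all the integrals being absolutely convergent. -/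
def SolvesIntegralEquation (α : ℝ) (u : ℝ → ℝ → ℝ) (u₀ : ℝ → ℝ) : Prop :=
  ∀ t : ℝ, 0 < t → ∀ x : ℝ,
    Integrable (fun y => heatKernel t (x - y) * u₀ y) volume ∧
    IntegrableOn (fun z : ℝ × ℝ => heatKernel (t - z.1) (x - z.2) * nonlin α (u z.1 z.2))
      (Ioo 0 t ×ˢ univ) volume ∧
    u t x = heat t u₀ x + duhamel α u t x

/-- `u` takes the initial value `u₀`: always in `L^q` away from the origin,
and in `L^p + L^q` on the whole line if `α > 2`. -/
def HasInitialValue (α : ℝ) (u : ℝ → ℝ → ℝ) (u₀ : ℝ → ℝ) : Prop :=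
  InitialValueAwayFromZero α u u₀ ∧ (2 < α → InitialValueInSum α u u₀)

/-- For all `r ∈ [1,∞]` with `r > α/2`: `u ∈ C¹((0,∞), L^r)` and
`u_xx, |u|^α u ∈ C((0,∞), L^r)`. -/
def HasLpRegularity (α : ℝ) (u : ℝ → ℝ → ℝ) : Prop :=
  ∀ (r : ℝ≥0∞) [Fact (1 ≤ r)], ENNReal.ofReal (α / 2) < r →
    ContDiffInLp r u ∧
    ContinuousInLp r (fun t x => iteratedDeriv 2 (u t) x) ∧
    ContinuousInLp r (fun t x => nonlin α (u t x))

/-- `u` solves the integral equation, each term of which is in `C((0,∞), L^r)` for all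
`r ∈ (α/2, ∞]`, and `t ↦ u(t) - e^{tΔ} u₀` is in `C([0,∞), L^r)` for all `r ≥ 1` with
`α/(2(α+1)) < r < α/2`. Meant for `α > 2`. -/
def HasIntegralProperties (α : ℝ) (u : ℝ → ℝ → ℝ) (u₀ : ℝ → ℝ) : Prop :=
  SolvesIntegralEquation α u u₀ ∧
  (∀ (r : ℝ≥0∞) [Fact (1 ≤ r)], ENNReal.ofReal (α / 2) < r →
    ContinuousInLp r u ∧
    ContinuousInLp r (fun t => heat t u₀) ∧
    ContinuousInLp r (duhamel α u)) ∧
  (∀ (r : ℝ≥0∞) [Fact (1 ≤ r)],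
    ENNReal.ofReal (α / (2 * (α + 1))) < r → r < ENNReal.ofReal (α / 2) →
    ContinuousInLpFromZero r (fun t x => u t x - heat t u₀ x))

/-- `u` is a regular self-similar solution whose profile has exactly `n` zeros on `ℝ`, with initial
value `u₀`, and with the regularity and integral equation properties above. -/
structure IsSolutionWithZeros (α : ℝ) (u₀ : ℝ → ℝ) (n : ℕ) (u : ℝ → ℝ → ℝ) : Prop where
  profile : ∃ f : ℝ → ℝ, IsRegularSelfSimilar α u f ∧ {x : ℝ | f x = 0}.encard = n
  initial_value : HasInitialValue α u u₀
  regularity : HasLpRegularity α u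
  integral_equation : 2 < α → HasIntegralProperties α u u₀

end

end NLHE

/-! Inserting `u(t,x) = t^(-1/α) f(x/√t)` into the equation gives f'' + (x/2) f' + f/α + |f|^α f =
0. With β = 2/α, taking the initial value μ|x|^(-β) (or its odd analogue) means that x^β f(x) tends
to μ as x → ∞. The theorem is therefore a shooting problem: start at 0 with data (a, 0) or (0, a), a
= exp s, count the positive zeros, and find two values of s at which the limit L(s) of x^β f has
modulus |μ|. Replacing f by -f then adjusts the sign.

Four facts carry the shooting. The energy decreases away from 0, so profiles are global and depend
continuously on s. In the variables z = x^β f, q = x z' the damping acts on q alone, so q =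
O(x^(-2)), L exists and is continuous in s (`exists_tail_bound`). A phase-plane angle crosses the
multiples of π/2 only upwards, so zeros are counted by levels passed; large amplitudes pass many
levels, and a zero can enter from infinity only where L = 0 (`eventually_not_passing`). Finally, if
f has a critical point η far out with |f(η)|^α ≤ c η², the motion is overdamped: f has no later zero
and L ≠ 0 (`overdamped`); and if equality holds with η large, then |L| is large
(`exists_creep_large`).

In `exists_two`, let b be the last parameter that does not pass level n and c the first one beyond
which level n+1 is passed. Then L(b) = L(c) = 0, and on (b, c] there are exactly n positive zeros.
Let η(s) be the critical point after the last zero. As s decreases to b, η(s) → ∞ while f stays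
bounded, so |f(η)|^α < c₀ η², where c₀ is `creepRatio`; at s = c the opposite strict inequality
holds because L(c) = 0. At some e in between there is equality. There η(e) is large, since at large
amplitude the energy is still large at bounded x (`exists_critical_ge`); hence |L(e)| > |μ|. So |L|
goes from 0 above |μ| and back to 0, and takes the value |μ| twice.

The function space statements reduce to pointwise bounds: f, x f' and x² f'' are O((1+|x|)^(-β)), a
weight that lies in L^r for r > α/2. When α > 2, e^{tΔ}u₀ is self-similar as well; its profile
solves the same equation without the nonlinearity (κ = 0 in `IsProfile`), so the same tail analysis
applies, and the two profiles differ by O(|x|^(-β-2)). The integral equation follows by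
differentiating s ↦ e^{(t-s)Δ}u(s). -/

namespace NLHE
noncomputable section

/-! ### The nonlinearity and its primitive. -/

section Nonlinearity

theorem nonlin_neg (α v : ℝ) : nonlin α (-v) = -nonlin α v := by simp [nonlin]

theorem abs_nonlin (α v : ℝ) (hα : 0 < α) : |nonlin α v| = |v| ^ (α + 1) := by
  rw [nonlin, abs_mul, abs_of_nonneg (Real.rpow_nonneg (abs_nonneg v) α)]
  rcases eq_or_ne v 0 with rfl | hv
  · simp [Real.zero_rpow (by linarith : α + 1 ≠ 0)]
  · rw [Real.rpow_add_one (abs_pos.2 hv).ne']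

theorem nonlin_of_nonneg {α v : ℝ} (hα : 0 < α) (hv : 0 ≤ v) : nonlin α v = v ^ (α + 1) := by
  rw [nonlin, abs_of_nonneg hv]
  rcases hv.eq_or_lt with rfl | hv
  · simp [Real.zero_rpow (by linarith : α + 1 ≠ 0)]
  · rw [Real.rpow_add_one hv.ne']

theorem hasDerivAt_nonlin {α : ℝ} (hα : 0 < α) (v : ℝ) :
    HasDerivAt (nonlin α) ((α + 1) * |v| ^ α) v := by
  rcases eq_or_ne v 0 with rfl | hv
  · rw [abs_zero, Real.zero_rpow hα.ne', mul_zero, hasDerivAt_iff_tendsto_slope]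
    have h : Tendsto (fun x : ℝ => |x| ^ α) (𝓝[≠] 0) (𝓝 0) := by
      have : ContinuousAt (fun x : ℝ => |x| ^ α) 0 :=
        (continuous_abs.continuousAt).rpow_const (Or.inr hα.le)
      simpa [ContinuousAt, Real.zero_rpow hα.ne'] using this.mono_left nhdsWithin_le_nhds
    refine h.congr' ?_
    filter_upwards [self_mem_nhdsWithin] with x hx
    have hx' : x ≠ 0 := hx
    simp [slope, nonlin]
    field_simp
  · have h1 : HasDerivAt (fun x : ℝ => |x| ^ α) (SignType.sign v * α * |v| ^ (α - 1)) v := by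
      simpa using (hasDerivAt_abs hv).rpow_const (p := α) (Or.inl (abs_ne_zero.2 hv))
    have h2 := h1.mul (hasDerivAt_id v)
    have e : (SignType.sign v * α * |v| ^ (α - 1)) * v + |v| ^ α * 1 = (α + 1) * |v| ^ α := by
      have : |v| ^ α = |v| ^ (α - 1) * |v| := by
        rw [← Real.rpow_add_one (abs_ne_zero.2 hv)]; congr 1; ring
      rw [this]
      have h3 : (SignType.sign v : ℝ) * v = |v| := sign_mul_self v
      linear_combination α * |v| ^ (α - 1) * h3
    rw [← e]
    exact h2

theorem continuous_nonlin {α : ℝ} (hα : 0 < α) : Continuous (nonlin α) :=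
  continuous_iff_continuousAt.2 fun v => (hasDerivAt_nonlin hα v).continuousAt

/-- The primitive `|v|^(α+2)/(α+2)` of the nonlinearity. -/
def potential (α v : ℝ) : ℝ := |v| ^ (α + 2) / (α + 2)

theorem potential_nonneg {α : ℝ} (hα : 0 < α) (v : ℝ) : 0 ≤ potential α v := by
  unfold potential; positivity

theorem hasDerivAt_potential {α : ℝ} (hα : 0 < α) (v : ℝ) :
    HasDerivAt (potential α) (nonlin α v) v := by
  have h := (hasDerivAt_abs_rpow v (p := α + 2) (by linarith)).div_const (α + 2)
  refine HasDerivAt.congr_deriv h ?_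
  rw [show nonlin α v = |v| ^ α * v from rfl, show α + 2 - 2 = α by ring]
  field_simp

theorem nonlin_mul_self (α v : ℝ) : nonlin α v * v = |v| ^ α * v ^ 2 := by
  unfold nonlin; ring

theorem potential_eq {α : ℝ} (hα : 0 < α) (v : ℝ) : potential α v = |v| ^ α * v ^ 2 / (α + 2) := by
  unfold potential
  congr 1
  rcases eq_or_ne v 0 with rfl | hv
  · simp [Real.zero_rpow (by linarith : α + 2 ≠ 0)]
  · rw [Real.rpow_add (abs_pos.2 hv), ← sq_abs v]; norm_num

theorem lipschitzOnWith_nonlin {α : ℝ} (hα : 0 < α) (M : ℝ) :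
    LipschitzOnWith (Real.toNNReal ((α + 1) * M ^ α)) (nonlin α) (Icc (-M) M) := by
  refine (convex_Icc (-M) M).lipschitzOnWith_of_nnnorm_hasDerivWithin_le
    (fun v _ => (hasDerivAt_nonlin hα v).hasDerivWithinAt) fun v hv => ?_
  rw [← NNReal.coe_le_coe, coe_nnnorm, Real.norm_eq_abs, abs_of_nonneg (by positivity)]
  refine le_trans ?_ (Real.le_coe_toNNReal _)
  gcongr
  exact abs_le.2 hv

end Nonlinearity

/-! ### Truncation of real numbers. -/

section Clamp

/-- Truncation of a real number to `[-M, M]`. -/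
def clamp (M v : ℝ) : ℝ := max (-M) (min M v)

theorem clamp_of_abs_le {M v : ℝ} (h : |v| ≤ M) : clamp M v = v := by
  rw [abs_le] at h
  rw [clamp, min_eq_right h.2, max_eq_right h.1]

theorem abs_clamp_le {M : ℝ} (hM : 0 ≤ M) (v : ℝ) : |clamp M v| ≤ M := by
  rw [abs_le, clamp]
  exact ⟨le_max_left _ _, max_le (by linarith) (min_le_left _ _)⟩

theorem lipschitzWith_clamp (M : ℝ) : LipschitzWith 1 (clamp M) := by
  have := (LipschitzWith.id (α := ℝ)).const_min M
  exact this.const_max (-M)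

theorem continuous_clamp (M : ℝ) : Continuous (clamp M) := (lipschitzWith_clamp M).continuous

end Clamp

/-! ### The profile equation as a truncated, globally solvable system. -/

/-- Right-hand side of the profile equation, written as a first order system. -/
def profileField (α x : ℝ) (p : ℝ × ℝ) : ℝ × ℝ :=
  (p.2, -(x / 2) * p.2 - p.1 / α - nonlin α p.1)

/-- The profile field with its argument truncated. -/
def clampField (α M x : ℝ) (p : ℝ × ℝ) : ℝ × ℝ :=
  profileField α x (clamp M p.1, clamp M p.2)

theorem lipschitzOnWith_profileField {α : ℝ} (hα : 0 < α) (M : ℝ) {T x : ℝ} (hx : |x| ≤ T) :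
    LipschitzOnWith (Real.toNNReal (1 + T + 1 / α + (α + 1) * M ^ α)) (profileField α x)
      (Icc (-M) M ×ˢ Icc (-M) M) := by
  rw [lipschitzOnWith_iff_dist_le_mul]
  intro p hp p' hp'
  have hM : 0 ≤ M := by have := hp.1.1; have := hp.1.2; linarith
  have hT : 0 ≤ T := (abs_nonneg x).trans hx
  have hMα : 0 ≤ M ^ α := Real.rpow_nonneg hM α
  rw [Real.coe_toNNReal _ (by positivity)]
  have h1 : |p.1 - p'.1| ≤ dist p p' := by rw [← Real.dist_eq]; exact le_max_left _ _
  have h2 : |p.2 - p'.2| ≤ dist p p' := by rw [← Real.dist_eq]; exact le_max_right _ _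
  have hd : 0 ≤ dist p p' := dist_nonneg
  have h3 : |nonlin α p.1 - nonlin α p'.1| ≤ (α + 1) * M ^ α * |p.1 - p'.1| := by
    have := (lipschitzOnWith_nonlin hα M).dist_le_mul p.1 hp.1 p'.1 hp'.1
    rwa [Real.coe_toNNReal _ (by positivity)] at this
  have hN : (α + 1) * M ^ α * |p.1 - p'.1| ≤ (α + 1) * M ^ α * dist p p' := by gcongr
  rw [Prod.dist_eq]
  refine max_le ?_ ?_
  · rw [Real.dist_eq]
    refine h2.trans ?_
    have : 0 ≤ T + 1 / α + (α + 1) * M ^ α := by positivity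
    nlinarith
  · rw [Real.dist_eq]
    simp only [profileField]
    have e : -(x / 2) * p.2 - p.1 / α - nonlin α p.1 - (-(x / 2) * p'.2 - p'.1 / α - nonlin α p'.1)
      = -(x / 2) * (p.2 - p'.2) - (1 / α) * (p.1 - p'.1) - (nonlin α p.1 - nonlin α p'.1) := by ring
    rw [e]
    have a1 : |-(x / 2) * (p.2 - p'.2)| ≤ T * dist p p' := by
      rw [abs_mul, abs_neg, abs_div, abs_two]
      gcongr
      linarith [abs_nonneg x]
    have a2 : |(1 / α) * (p.1 - p'.1)| ≤ 1 / α * dist p p' := by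
      rw [abs_mul, abs_of_pos (by positivity : 0 < 1 / α)]
      gcongr
    have := abs_sub (-(x / 2) * (p.2 - p'.2) - (1 / α) * (p.1 - p'.1)) (nonlin α p.1 - nonlin α p'.1)
    have := abs_sub (-(x / 2) * (p.2 - p'.2)) ((1 / α) * (p.1 - p'.1))
    nlinarith

theorem lipschitzWith_clampField {α : ℝ} (hα : 0 < α) {M : ℝ} (hM : 0 ≤ M) {T x : ℝ}
    (hx : |x| ≤ T) :
    LipschitzWith (Real.toNNReal (1 + T + 1 / α + (α + 1) * M ^ α)) (clampField α M x) := by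
  have h1 : LipschitzWith 1 (fun p : ℝ × ℝ => (clamp M p.1, clamp M p.2)) := by
    have a := (lipschitzWith_clamp M).comp (LipschitzWith.prod_fst (α := ℝ) (β := ℝ))
    have b := (lipschitzWith_clamp M).comp (LipschitzWith.prod_snd (α := ℝ) (β := ℝ))
    simpa using a.prodMk b
  have h2 := (lipschitzOnWith_profileField hα M hx).comp (h1.lipschitzOnWith (s := univ))
    (fun p _ => ⟨abs_le.1 (abs_clamp_le hM _), abs_le.1 (abs_clamp_le hM _)⟩)
  rw [lipschitzOnWith_univ, mul_one] at h2
  exact h2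

theorem exists_norm_clampField_le {α : ℝ} (hα : 0 < α) {M : ℝ} (hM : 0 ≤ M) (T : ℝ) :
    ∃ C : NNReal, ∀ x ∈ Icc (-T) T, ∀ p, ‖clampField α M x p‖ ≤ C := by
  refine ⟨Real.toNNReal (M + |T| * M + M / α + M ^ (α + 1)), fun x hx p => ?_⟩
  refine le_trans ?_ (Real.le_coe_toNNReal _)
  have hMα : 0 ≤ M ^ (α + 1) := Real.rpow_nonneg hM _
  have h1 := abs_clamp_le hM p.1
  have h2 := abs_clamp_le hM p.2
  have hx' : |x| ≤ |T| := (abs_le.2 hx).trans (le_abs_self T)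
  have p1 : 0 ≤ |T| * M := by positivity
  have p2 : 0 ≤ M / α := by positivity
  rw [Prod.norm_def]
  refine max_le ?_ ?_
  · rw [Real.norm_eq_abs]
    simp only [clampField, profileField]
    linarith
  · rw [Real.norm_eq_abs]
    simp only [clampField, profileField]
    have a1 : |-(x / 2) * clamp M p.2| ≤ |T| * M := by
      rw [abs_mul, abs_neg, abs_div, abs_two]
      gcongr
      linarith [abs_nonneg x]
    have a2 : |clamp M p.1 / α| ≤ M / α := by
      rw [abs_div, abs_of_pos hα]; gcongr
    have a3 : |nonlin α (clamp M p.1)| ≤ M ^ (α + 1) := by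
      rw [abs_nonlin _ _ hα]; gcongr
    have := abs_sub (-(x / 2) * clamp M p.2 - clamp M p.1 / α) (nonlin α (clamp M p.1))
    have := abs_sub (-(x / 2) * clamp M p.2) (clamp M p.1 / α)
    linarith

theorem continuous_clampField {α : ℝ} (p : ℝ × ℝ) (M : ℝ) :
    Continuous fun x => clampField α M x p := by
  unfold clampField profileField; fun_prop

/-- The truncated field is bounded by some `C`, so on an interval of half-length `T` a trajectory
moves by at most `C * T`; a ball of that radius makes Picard–Lindelöf apply on the whole interval.
-/
theorem exists_clamp_solution_Icc {α : ℝ} (hα : 0 < α) {M : ℝ} (hM : 0 ≤ M) (p₀ : ℝ × ℝ) {T : ℝ}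
    (hT : 0 < T) : ∃ p : ℝ → ℝ × ℝ, p 0 = p₀ ∧
      ∀ x ∈ Icc (-T) T, HasDerivWithinAt p (clampField α M x (p x)) (Icc (-T) T) x := by
  obtain ⟨C, hC⟩ := exists_norm_clampField_le hα hM T
  have h : IsPicardLindelof (clampField α M) (tmin := -T) (tmax := T) ⟨0, by constructor <;> linarith⟩
      p₀ (C * Real.toNNReal T) 0 C (Real.toNNReal (1 + T + 1 / α + (α + 1) * M ^ α)) :=
    { lipschitzOnWith := fun x hx =>
        (lipschitzWith_clampField hα hM (abs_le.2 hx)).lipschitzOnWith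
      continuousOn := fun p _ => (continuous_clampField p M).continuousOn
      norm_le := fun x hx p _ => hC x hx p
      mul_max_le := by simp [hT.le] }
  exact h.exists_eq_forall_mem_Icc_hasDerivWithinAt₀

theorem exists_clamp_solution {α : ℝ} (hα : 0 < α) {M : ℝ} (hM : 0 ≤ M) (p₀ : ℝ × ℝ) :
    ∃ p : ℝ → ℝ × ℝ, p 0 = p₀ ∧ ∀ x, HasDerivAt p (clampField α M x (p x)) x := by
  have hex : ∀ n : ℕ, ∃ p : ℝ → ℝ × ℝ, p 0 = p₀ ∧
      ∀ x ∈ Ioo (-(n + 1 : ℝ)) (n + 1), HasDerivAt p (clampField α M x (p x)) x := by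
    intro n
    obtain ⟨p, h0, hp⟩ := exists_clamp_solution_Icc hα hM p₀ (T := n + 1) (by positivity)
    exact ⟨p, h0, fun x hx => (hp x (Ioo_subset_Icc_self hx)).hasDerivAt (Icc_mem_nhds hx.1 hx.2)⟩
  choose p h0 hp using hex
  have huniq : ∀ m n : ℕ, m ≤ n → EqOn (p m) (p n) (Ioo (-(m + 1 : ℝ)) (m + 1)) := by
    intro m n hmn
    have hmn' : (m : ℝ) ≤ n := by exact_mod_cast hmn
    refine ODE_solution_unique_of_mem_Ioo (v := clampField α M) (s := fun _ => univ) (t₀ := 0)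
      (K := Real.toNNReal (1 + (m + 1) + 1 / α + (α + 1) * M ^ α))
      (fun x hx => (lipschitzWith_clampField hα hM (abs_le.2 ⟨hx.1.le, hx.2.le⟩)).lipschitzOnWith)
      ⟨by linarith [(Nat.cast_nonneg m : (0:ℝ) ≤ m)], by positivity⟩
      (fun x hx => ⟨hp m x hx, mem_univ _⟩)
      (fun x hx => ⟨hp n x ⟨by linarith [hx.1], by linarith [hx.2]⟩, mem_univ _⟩)
      (by rw [h0, h0])
  -- Solution number `n` is valid for |x| < n + 1, so index `⌈|x|⌉₊` covers x, and index `⌈|x|⌉₊ +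
  -- 1` covers the neighbourhood |y| < |x| + 1 on which the glued function is compared with a single
  -- solution.
  refine ⟨fun x => p ⌈|x|⌉₊ x, by simp [h0], fun x => ?_⟩
  have key : ∀ y ∈ Ioo (-(|x| + 1)) (|x| + 1), p ⌈|y|⌉₊ y = p (⌈|x|⌉₊ + 1) y := by
    intro y hy
    have hy' : |y| < |x| + 1 := abs_lt.2 hy
    refine huniq _ _ ?_ (abs_lt.1 ?_)
    · refine Nat.ceil_le.2 ?_
      push_cast
      linarith [Nat.le_ceil |x|]
    · linarith [Nat.le_ceil |y|]
  have hx : x ∈ Ioo (-(|x| + 1)) (|x| + 1) := abs_lt.1 (by linarith)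
  have hev : (fun y => p ⌈|y|⌉₊ y) =ᶠ[𝓝 x] p (⌈|x|⌉₊ + 1) := by
    filter_upwards [Ioo_mem_nhds hx.1 hx.2] with y hy using key y hy
  refine HasDerivAt.congr_of_eventuallyEq ?_ hev
  simp only [key x hx]
  refine hp _ x (abs_lt.1 ?_)
  push_cast
  linarith [Nat.le_ceil |x|]
end
end NLHE
-- Profiles: energy, global existence, continuous dependence, parity.
namespace NLHE
noncomputable section

/-- `f` solves `f'' + (x/2) f' + f/α + κ |f|^α f = 0` on the line, with derivative `g`. -/
structure IsProfile (α κ : ℝ) (f g : ℝ → ℝ) : Prop where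
  hasDerivAt_fst : ∀ x, HasDerivAt f (g x) x
  hasDerivAt_snd : ∀ x, HasDerivAt g (-(x / 2) * g x - f x / α - κ * nonlin α (f x)) x

/-- The energy of a point of the phase plane. -/
def energy (α a b : ℝ) : ℝ := b ^ 2 / 2 + a ^ 2 / (2 * α) + potential α a

theorem energy_nonneg {α : ℝ} (hα : 0 < α) (a b : ℝ) : 0 ≤ energy α a b := by
  have := potential_nonneg hα a
  unfold energy; positivity

/-- The integrand has the sign of its argument, so continuing the integral from the truncated
endpoint to the true one only adds a nonnegative amount. -/
theorem integral_clamp_le {h : ℝ → ℝ} (hc : Continuous h) (hs : ∀ v, 0 ≤ v * h v) {M : ℝ}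
    (hM : 0 < M) (v : ℝ) : ∫ t in (0 : ℝ)..(clamp M v), h t ≤ ∫ t in (0 : ℝ)..v, h t := by
  rw [← sub_nonneg, intervalIntegral.integral_interval_sub_left (hc.intervalIntegrable _ _)
    (hc.intervalIntegrable _ _)]
  rcases le_total |v| M with hv | hv
  · simp [clamp_of_abs_le hv]
  rcases le_total 0 v with h0 | h0
  · rw [abs_of_nonneg h0] at hv
    have : clamp M v = M := by rw [clamp, min_eq_left hv, max_eq_right]; linarith
    rw [this]
    refine intervalIntegral.integral_nonneg hv fun u hu => ?_
    exact nonneg_of_mul_nonneg_right (hs u) (by linarith [hu.1])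
  · rw [abs_of_nonpos h0] at hv
    have : clamp M v = -M := by rw [clamp, min_eq_right (by linarith), max_eq_left]; linarith
    rw [this, intervalIntegral.integral_symm, ← intervalIntegral.integral_neg]
    refine intervalIntegral.integral_nonneg (by linarith) fun u hu => ?_
    have := hs u
    have h3 : u < 0 := by linarith [hu.2]
    have := nonpos_of_mul_nonneg_right this h3
    linarith

theorem mul_clamp_nonneg {M : ℝ} (hM : 0 < M) (v : ℝ) : 0 ≤ v * clamp M v := by
  unfold clamp
  rcases le_total 0 v with h | h
  · exact mul_nonneg h (le_max_of_le_right (le_min hM.le h))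
  · exact mul_nonneg_of_nonpos_of_nonpos h (max_le (by linarith) ((min_le_right _ _).trans h))

theorem clamp_mul_nonlin_clamp_nonneg (α : ℝ) {M : ℝ} (hM : 0 < M) (v : ℝ) :
    0 ≤ v * nonlin α (clamp M v) := by
  unfold nonlin
  rw [mul_left_comm]
  exact mul_nonneg (Real.rpow_nonneg (abs_nonneg _) _) (mul_clamp_nonneg hM v)

/-- The energy of the truncated field. -/
def clampEnergy (α M : ℝ) (p : ℝ × ℝ) : ℝ :=
  (∫ t in (0 : ℝ)..p.2, clamp M t) +
    ∫ t in (0 : ℝ)..p.1, (clamp M t / α + nonlin α (clamp M t))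

theorem continuous_clamp_force {α : ℝ} (hα : 0 < α) (M : ℝ) :
    Continuous fun t => clamp M t / α + nonlin α (clamp M t) :=
  ((continuous_clamp M).div_const α).add ((continuous_nonlin hα).comp (continuous_clamp M))

theorem integral_clamp_of_abs_le {M a : ℝ} (ha : |a| ≤ M) :
    ∫ t in (0 : ℝ)..a, clamp M t = a ^ 2 / 2 := by
  rw [show a ^ 2 / 2 = ∫ t in (0 : ℝ)..a, t by simp]
  refine intervalIntegral.integral_congr fun t ht => clamp_of_abs_le ?_
  have := abs_sub_left_of_mem_uIcc ht
  simpa using this.trans (by simpa using ha)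

theorem integral_clamp_force_of_abs_le {α : ℝ} (hα : 0 < α) {M a : ℝ} (ha : |a| ≤ M) :
    ∫ t in (0 : ℝ)..a, (clamp M t / α + nonlin α (clamp M t)) = a ^ 2 / (2 * α) + potential α a := by
  have h1 : ∫ t in (0 : ℝ)..a, (clamp M t / α + nonlin α (clamp M t))
      = ∫ t in (0 : ℝ)..a, (t / α + nonlin α t) := by
    refine intervalIntegral.integral_congr fun t ht => ?_
    have : clamp M t = t := by
      refine clamp_of_abs_le ?_
      have := abs_sub_left_of_mem_uIcc ht
      simpa using this.trans (by simpa using ha)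
    simp only [this]
  rw [h1, intervalIntegral.integral_eq_sub_of_hasDerivAt
    (f := fun t => t ^ 2 / (2 * α) + potential α t)]
  · simp [potential, Real.zero_rpow (by linarith : α + 2 ≠ 0)]
  · intro t _
    refine HasDerivAt.add ?_ (hasDerivAt_potential hα t)
    refine ((hasDerivAt_pow 2 t).div_const (2 * α)).congr_deriv ?_
    norm_num
    field_simp
  · exact ((continuous_id.div_const α).add (continuous_nonlin hα)).intervalIntegrable _ _

theorem clampEnergy_of_le {α : ℝ} (hα : 0 < α) {M : ℝ} {p : ℝ × ℝ} (h1 : |p.1| ≤ M)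
    (h2 : |p.2| ≤ M) : clampEnergy α M p = energy α p.1 p.2 := by
  rw [clampEnergy, integral_clamp_of_abs_le h2, integral_clamp_force_of_abs_le hα h1, energy]
  ring

/-- This converts monotonicity of the truncated energy into a bound on the truncated point, without
knowing yet that the truncation is inactive. -/
theorem energy_clamp_le {α : ℝ} (hα : 0 < α) {M : ℝ} (hM : 0 < M) (p : ℝ × ℝ) :
    energy α (clamp M p.1) (clamp M p.2) ≤ clampEnergy α M p := by
  rw [← clampEnergy_of_le (p := (clamp M p.1, clamp M p.2)) hα (abs_clamp_le hM.le _)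
    (abs_clamp_le hM.le _)]
  refine add_le_add (integral_clamp_le (continuous_clamp M) (mul_clamp_nonneg hM) hM _)
    (integral_clamp_le (continuous_clamp_force hα M) (fun v => ?_) hM _)
  rw [mul_add, mul_div_assoc']
  have := mul_clamp_nonneg hM v
  have := clamp_mul_nonlin_clamp_nonneg α hM v
  positivity

theorem hasDerivAt_clampEnergy {α : ℝ} (hα : 0 < α) {M : ℝ} {p : ℝ → ℝ × ℝ} {x : ℝ}
    (hp : HasDerivAt p (clampField α M x (p x)) x) :
    HasDerivAt (fun y => clampEnergy α M (p y)) (-(x / 2) * (clamp M (p x).2) ^ 2) x := by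
  have d1 : HasDerivAt (fun a => ∫ t in (0 : ℝ)..a, clamp M t) (clamp M (p x).2) (p x).2 :=
    intervalIntegral.integral_hasDerivAt_right ((continuous_clamp M).intervalIntegrable _ _)
      ((continuous_clamp M).stronglyMeasurableAtFilter _ _) (continuous_clamp M).continuousAt
  have d2 : HasDerivAt (fun a => ∫ t in (0 : ℝ)..a, (clamp M t / α + nonlin α (clamp M t)))
      (clamp M (p x).1 / α + nonlin α (clamp M (p x).1)) (p x).1 :=
    intervalIntegral.integral_hasDerivAt_right ((continuous_clamp_force hα M).intervalIntegrable _ _)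
      ((continuous_clamp_force hα M).stronglyMeasurableAtFilter _ _)
      (continuous_clamp_force hα M).continuousAt
  have e1 := hasFDerivAt_snd.comp_hasDerivAt x hp
  have e2 := hasFDerivAt_fst.comp_hasDerivAt x hp
  refine ((d1.comp x e1).add (d2.comp x e2)).congr_deriv ?_
  simp only [clampField, profileField, ContinuousLinearMap.coe_fst', ContinuousLinearMap.coe_snd']
  ring

theorem le_of_deriv_sign {F F' : ℝ → ℝ} (hF : ∀ x, HasDerivAt F (F' x) x)
    (h : ∀ x, x * F' x ≤ 0) (x : ℝ) : F x ≤ F 0 := by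
  have hc : Continuous F := continuous_iff_continuousAt.2 fun x => (hF x).continuousAt
  rcases le_total 0 x with hx | hx
  · refine antitoneOn_of_deriv_nonpos (convex_Ici 0) hc.continuousOn
      (fun y _ => (hF y).differentiableAt.differentiableWithinAt) (fun y hy => ?_)
      self_mem_Ici hx hx
    rw [interior_Ici, mem_Ioi] at hy
    rw [(hF y).deriv]
    have := h y
    by_contra hcon
    push Not at hcon
    nlinarith
  · refine monotoneOn_of_deriv_nonneg (convex_Iic 0) hc.continuousOn
      (fun y _ => (hF y).differentiableAt.differentiableWithinAt) (fun y hy => ?_)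
      hx self_mem_Iic hx
    rw [interior_Iic, mem_Iio] at hy
    rw [(hF y).deriv]
    have := h y
    by_contra hcon
    push Not at hcon
    nlinarith

theorem sq_le_of_energy_le {α : ℝ} (hα : 0 < α) {a b E : ℝ} (h : energy α a b ≤ E) :
    a ^ 2 ≤ 2 * α * E ∧ b ^ 2 ≤ 2 * E := by
  have h1 := potential_nonneg hα a
  unfold energy at h
  have h2 : 0 ≤ a ^ 2 / (2 * α) := by positivity
  constructor
  · have : a ^ 2 / (2 * α) ≤ E := by nlinarith
    rw [div_le_iff₀ (by positivity)] at this
    linarith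
  · nlinarith

/-- The truncated flow has its own energy, which decreases away from 0. It keeps the truncated point
strictly inside the truncation box, so the truncation never acts. -/
theorem exists_profile {α : ℝ} (hα : 0 < α) (a b : ℝ) :
    ∃ f g : ℝ → ℝ, IsProfile α 1 f g ∧ f 0 = a ∧ g 0 = b := by
  set E := energy α a b with hE
  have hE0 : 0 ≤ E := energy_nonneg hα a b
  -- The terms |a|, |b| make the truncation invisible at 0; the rest exceeds 1 + (2α+2)E, so its
  -- square is strictly above every bound on f² and f'² coming from energy at most E.
  set M := 1 + (2 * α + 2) * E + |a| + |b| with hMdef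
  have hM : 0 < M := by positivity
  have hM2 : (2 * α + 2) * E < M ^ 2 := by
    have h1 : 0 ≤ (2 * α + 2) * E := by positivity
    have : 1 + (2 * α + 2) * E ≤ M := by rw [hMdef]; linarith [abs_nonneg a, abs_nonneg b]
    nlinarith
  obtain ⟨p, h0, hp⟩ := exists_clamp_solution hα hM.le (a, b)
  have hle : ∀ x, energy α (clamp M (p x).1) (clamp M (p x).2) ≤ E := by
    intro x
    refine (energy_clamp_le hα hM (p x)).trans ?_
    refine (le_of_deriv_sign (F := fun y => clampEnergy α M (p y))
      (fun y => hasDerivAt_clampEnergy hα (hp y)) (fun y => ?_) x).trans ?_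
    · nlinarith [mul_nonneg (sq_nonneg y) (sq_nonneg (clamp M (p y).2))]
    · have h1 : 0 ≤ (2 * α + 2) * E := by positivity
      simp only [h0]
      rw [clampEnergy_of_le hα]
      · rw [hMdef]; linarith [abs_nonneg a, abs_nonneg b]
      · rw [hMdef]; linarith [abs_nonneg a, abs_nonneg b]
  have hcl : ∀ v : ℝ, |clamp M v| < M → clamp M v = v := by
    intro v hv
    refine clamp_of_abs_le ?_
    by_contra hcon
    push Not at hcon
    refine absurd hv (not_lt.2 ?_)
    unfold clamp
    rcases le_total 0 v with h | h
    · rw [abs_of_nonneg h] at hcon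
      rw [min_eq_left hcon.le, max_eq_right (by linarith), abs_of_pos hM]
    · rw [abs_of_nonpos h] at hcon
      rw [min_eq_right (by linarith), max_eq_left (by linarith), abs_neg, abs_of_pos hM]
  have h1 : ∀ x, clamp M (p x).1 = (p x).1 := fun x => hcl _ <| abs_lt_of_sq_lt_sq
    (by have := (sq_le_of_energy_le hα (hle x)).1; nlinarith) hM.le
  have h2 : ∀ x, clamp M (p x).2 = (p x).2 := fun x => hcl _ <| abs_lt_of_sq_lt_sq
    (by have := (sq_le_of_energy_le hα (hle x)).2; nlinarith) hM.le
  refine ⟨fun x => (p x).1, fun x => (p x).2, ⟨fun x => ?_, fun x => ?_⟩, by simp [h0], by simp [h0]⟩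
  · refine (hasFDerivAt_fst.comp_hasDerivAt x (hp x)).congr_deriv ?_
    simp [clampField, profileField, h2]
  · refine (hasFDerivAt_snd.comp_hasDerivAt x (hp x)).congr_deriv ?_
    simp [clampField, profileField, h1, h2]

namespace IsProfile

variable {α κ : ℝ} {f g : ℝ → ℝ}

theorem continuous_fst (h : IsProfile α κ f g) : Continuous f :=
  continuous_iff_continuousAt.2 fun x => (h.hasDerivAt_fst x).continuousAt

theorem continuous_snd (h : IsProfile α κ f g) : Continuous g :=
  continuous_iff_continuousAt.2 fun x => (h.hasDerivAt_snd x).continuousAt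

theorem neg (h : IsProfile α κ f g) : IsProfile α κ (fun x => -f x) (fun x => -g x) where
  hasDerivAt_fst x := (h.hasDerivAt_fst x).neg
  hasDerivAt_snd x := by
    refine (h.hasDerivAt_snd x).neg.congr_deriv ?_
    rw [nonlin_neg]; ring

theorem reflect (h : IsProfile α κ f g) :
    IsProfile α κ (fun x => f (-x)) (fun x => -g (-x)) where
  hasDerivAt_fst x := by
    refine ((h.hasDerivAt_fst (-x)).comp x (hasDerivAt_neg x)).congr_deriv ?_
    ring
  hasDerivAt_snd x := by
    refine ((h.hasDerivAt_snd (-x)).comp x (hasDerivAt_neg x)).neg.congr_deriv ?_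
    ring

theorem hasDerivAt_energy (hα : 0 < α) (h : IsProfile α 1 f g) (x : ℝ) :
    HasDerivAt (fun y => energy α (f y) (g y)) (-(x / 2) * g x ^ 2) x := by
  have d1 := ((h.hasDerivAt_snd x).pow 2).div_const 2
  have d2 := ((h.hasDerivAt_fst x).pow 2).div_const (2 * α)
  have d3 := (hasDerivAt_potential hα (f x)).comp x (h.hasDerivAt_fst x)
  refine ((d1.add d2).add d3).congr_deriv ?_
  field_simp
  ring

theorem energy_le (hα : 0 < α) (h : IsProfile α 1 f g) (x : ℝ) :
    energy α (f x) (g x) ≤ energy α (f 0) (g 0) :=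
  le_of_deriv_sign (h.hasDerivAt_energy hα)
    (fun y => by nlinarith [mul_nonneg (sq_nonneg y) (sq_nonneg (g y))]) x

/-- From E' = -(x/2) f'² and f'² ≤ 2E follows E' ≥ -x E. -/
theorem energy_ge (hα : 0 < α) (h : IsProfile α 1 f g) {x : ℝ} (hx : 0 ≤ x) :
    energy α (f 0) (g 0) * Real.exp (-(x ^ 2 / 2)) ≤ energy α (f x) (g x) := by
  have hd : ∀ y, HasDerivAt (fun y => energy α (f y) (g y) * Real.exp (y ^ 2 / 2))
      ((-(y / 2) * g y ^ 2 + y * energy α (f y) (g y)) * Real.exp (y ^ 2 / 2)) y := by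
    intro y
    have d : HasDerivAt (fun y : ℝ => Real.exp (y ^ 2 / 2)) (Real.exp (y ^ 2 / 2) * y) y := by
      refine ((hasDerivAt_pow 2 y).div_const 2).exp.congr_deriv ?_
      norm_num
    refine ((h.hasDerivAt_energy hα y).mul d).congr_deriv ?_
    ring
  have hm : MonotoneOn (fun y => energy α (f y) (g y) * Real.exp (y ^ 2 / 2)) (Ici 0) := by
    refine monotoneOn_of_deriv_nonneg (convex_Ici 0)
      (fun y _ => (hd y).continuousAt.continuousWithinAt)
      (fun y _ => (hd y).differentiableAt.differentiableWithinAt) (fun y hy => ?_)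
    rw [interior_Ici, mem_Ioi] at hy
    rw [(hd y).deriv]
    refine mul_nonneg ?_ (Real.exp_pos _).le
    have h1 := potential_nonneg hα (f y)
    have h2 : 0 ≤ f y ^ 2 / (2 * α) := by positivity
    have : g y ^ 2 / 2 ≤ energy α (f y) (g y) := by unfold energy; linarith
    nlinarith
  have := hm self_mem_Ici hx hx
  simp only [ne_eq, OfNat.ofNat_ne_zero, not_false_eq_true, zero_pow, zero_div, Real.exp_zero,
    mul_one] at this
  rw [Real.exp_neg, ← div_eq_mul_inv, div_le_iff₀ (Real.exp_pos _)]
  exact this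

theorem abs_le_of_energy_le (hα : 0 < α) (h : IsProfile α 1 f g) {M : ℝ} (hM : 0 ≤ M)
    (hE : (2 * α + 2) * energy α (f 0) (g 0) ≤ M ^ 2) (x : ℝ) : |f x| ≤ M ∧ |g x| ≤ M := by
  have h1 := sq_le_of_energy_le hα (h.energy_le hα x)
  have h2 := energy_nonneg hα (f 0) (g 0)
  exact ⟨abs_le_of_sq_le_sq (by nlinarith) hM, abs_le_of_sq_le_sq (by nlinarith) hM⟩

theorem hasDerivAt_prod (h : IsProfile α 1 f g) (x : ℝ) :
    HasDerivAt (fun y => (f y, g y)) (profileField α x (f x, g x)) x := by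
  have := (h.hasDerivAt_fst x).prodMk (h.hasDerivAt_snd x)
  rwa [one_mul] at this

/-- The energy keeps both trajectories in the box of half-width `M`, on which the field is
Lipschitz; this is Grönwall's inequality. -/
theorem dist_le (hα : 0 < α) {f' g' : ℝ → ℝ} (h : IsProfile α 1 f g) (h' : IsProfile α 1 f' g')
    {M : ℝ} (hM : 0 ≤ M) (hE : (2 * α + 2) * energy α (f 0) (g 0) ≤ M ^ 2)
    (hE' : (2 * α + 2) * energy α (f' 0) (g' 0) ≤ M ^ 2) {T : ℝ} :
    ∀ x ∈ Icc 0 T, dist (f x, g x) (f' x, g' x) ≤ dist (f 0, g 0) (f' 0, g' 0) *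
      Real.exp ((1 + T + 1 / α + (α + 1) * M ^ α) * x) := by
  intro x hx
  have hT : 0 ≤ T := hx.1.trans hx.2
  have hMα := Real.rpow_nonneg hM α
  have := dist_le_of_trajectories_ODE_of_mem (v := profileField α)
    (s := fun _ => Icc (-M) M ×ˢ Icc (-M) M) (a := 0) (b := T)
    (K := Real.toNNReal (1 + T + 1 / α + (α + 1) * M ^ α))
    (f := fun y => (f y, g y)) (g := fun y => (f' y, g' y)) (δ := dist (f 0, g 0) (f' 0, g' 0))
    (fun t ht => lipschitzOnWith_profileField hα M (abs_le.2 ⟨by linarith [ht.1], ht.2.le⟩))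
    (h.continuous_fst.prodMk h.continuous_snd).continuousOn
    (fun t _ => (h.hasDerivAt_prod t).hasDerivWithinAt)
    (fun t _ => ⟨abs_le.1 (h.abs_le_of_energy_le hα hM hE t).1,
      abs_le.1 (h.abs_le_of_energy_le hα hM hE t).2⟩)
    (h'.continuous_fst.prodMk h'.continuous_snd).continuousOn
    (fun t _ => (h'.hasDerivAt_prod t).hasDerivWithinAt)
    (fun t _ => ⟨abs_le.1 (h'.abs_le_of_energy_le hα hM hE' t).1,
      abs_le.1 (h'.abs_le_of_energy_le hα hM hE' t).2⟩) le_rfl x hx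
  rwa [Real.coe_toNNReal _ (by positivity), sub_zero] at this

theorem eq_of_eq_nonneg (hα : 0 < α) {f' g' : ℝ → ℝ} (h : IsProfile α 1 f g)
    (h' : IsProfile α 1 f' g') (hf : f 0 = f' 0) (hg : g 0 = g' 0) {x : ℝ} (hx : 0 ≤ x) :
    f x = f' x ∧ g x = g' x := by
  have hE := energy_nonneg hα (f 0) (g 0)
  have hM : (2 * α + 2) * energy α (f 0) (g 0) ≤ (1 + (2 * α + 2) * energy α (f 0) (g 0)) ^ 2 := by
    have : 0 ≤ (2 * α + 2) * energy α (f 0) (g 0) := by positivity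
    nlinarith
  have := h.dist_le hα h' (by positivity) hM (by rw [← hf, ← hg]; exact hM) (T := x) x ⟨hx, le_rfl⟩
  rw [hf, hg, dist_self, zero_mul] at this
  have := dist_le_zero.1 this
  exact Prod.mk.inj this

theorem ext (hα : 0 < α) {f' g' : ℝ → ℝ} (h : IsProfile α 1 f g)
    (h' : IsProfile α 1 f' g') (hf : f 0 = f' 0) (hg : g 0 = g' 0) : f = f' ∧ g = g' := by
  have key : ∀ x, f x = f' x ∧ g x = g' x := by
    intro x
    rcases le_total 0 x with hx | hx
    · exact h.eq_of_eq_nonneg hα h' hf hg hx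
    · have := h.reflect.eq_of_eq_nonneg hα h'.reflect (by simpa using hf) (by simpa using hg)
        (x := -x) (by linarith)
      simpa using this
  exact ⟨funext fun x => (key x).1, funext fun x => (key x).2⟩

theorem even (hα : 0 < α) (h : IsProfile α 1 f g) (h0 : g 0 = 0) : Function.Even f := by
  intro x
  have := (h.reflect.ext hα h (by simp) (by simp [h0])).1
  exact congrFun this x

theorem odd (hα : 0 < α) (h : IsProfile α 1 f g) (h0 : f 0 = 0) : Function.Odd f := by
  intro x
  have := (h.reflect.ext hα h.neg (by simp [h0]) (by simp)).1
  exact congrFun this x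

/-- A profile which is not identically zero has only simple zeros. -/
theorem ne_zero (hα : 0 < α) (h : IsProfile α 1 f g) (h0 : f 0 ≠ 0 ∨ g 0 ≠ 0) {x : ℝ}
    (hx : 0 ≤ x) : f x ≠ 0 ∨ g x ≠ 0 := by
  have h1 := h.energy_ge hα hx
  by_contra hcon
  push Not at hcon
  rw [hcon.1, hcon.2] at h1
  have h2 : energy α 0 0 = 0 := by
    simp [energy, potential, Real.zero_rpow (by linarith : α + 2 ≠ 0)]
  rw [h2] at h1
  have h3 : energy α (f 0) (g 0) ≤ 0 := by
    by_contra h4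
    push Not at h4
    exact absurd h1 (not_le.2 (mul_pos h4 (Real.exp_pos _)))
  have h4 := sq_le_of_energy_le hα h3
  rcases h0 with h0 | h0
  · have := pow_pos (abs_pos.2 h0) 2; rw [sq_abs] at this; linarith [h4.1]
  · have := pow_pos (abs_pos.2 h0) 2; rw [sq_abs] at this; linarith [h4.2]

end IsProfile

end
end NLHE
namespace NLHE
noncomputable section

/-! ### Asymptotics at infinity in the variables z = x^β f, q = x z'. -/

section Tail

/-- The rescaled profile `x^β f(x)`. -/
def tailVal (β : ℝ) (f : ℝ → ℝ) (x : ℝ) : ℝ := x ^ β * f x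

/-- `x` times the derivative of the rescaled profile. -/
def tailSlope (β : ℝ) (f g : ℝ → ℝ) (x : ℝ) : ℝ := x ^ (β + 1) * g x + β * (x ^ β * f x)

theorem sq_mul_rpow_mul_nonlin {α : ℝ} (hα : 0 < α) {x : ℝ} (hx : 0 < x) (v : ℝ) :
    x ^ 2 * (x ^ (2 / α) * nonlin α v) = nonlin α (x ^ (2 / α) * v) := by
  have hp : 0 < x ^ (2 / α) := Real.rpow_pos_of_pos hx _
  have h2 : (x ^ (2 / α)) ^ α = x ^ 2 := by
    rw [← Real.rpow_mul hx.le, div_mul_cancel₀ _ hα.ne']; norm_num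
  unfold nonlin
  rw [abs_mul, abs_of_pos hp, Real.mul_rpow hp.le (abs_nonneg v), h2]
  ring

namespace IsProfile

variable {α κ : ℝ} {f g : ℝ → ℝ}

theorem hasDerivAt_tailVal (h : IsProfile α κ f g) (β : ℝ) {x : ℝ} (hx : 0 < x) :
    HasDerivAt (tailVal β f) (tailSlope β f g x / x) x := by
  have d := (Real.hasDerivAt_rpow_const (p := β) (Or.inl hx.ne')).mul (h.hasDerivAt_fst x)
  refine d.congr_deriv ?_
  rw [tailSlope, Real.rpow_add_one hx.ne', Real.rpow_sub_one hx.ne']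
  field_simp
  ring

/-- For β = 2/α the sum (x/2) f' + f/α equals x^(-β) q / 2, so the strong damping acts on q alone,
and everything else carries a factor 1/x because x² x^β |f|^α f = |z|^α z. -/
theorem hasDerivAt_tailSlope (hα : 0 < α) (h : IsProfile α κ f g) {x : ℝ} (hx : 0 < x) :
    HasDerivAt (tailSlope (2 / α) f g)
      (-(x / 2) * tailSlope (2 / α) f g x + (-(κ * nonlin α (tailVal (2 / α) f x))
        + (2 * (2 / α) + 1) * tailSlope (2 / α) f g x
        - 2 / α * (2 / α + 1) * tailVal (2 / α) f x) / x) x := by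
  have d1 := (Real.hasDerivAt_rpow_const (p := 2 / α + 1) (Or.inl hx.ne')).mul (h.hasDerivAt_snd x)
  have d2 := (h.hasDerivAt_tailVal (2 / α) hx).const_mul (2 / α)
  refine (d1.add d2).congr_deriv ?_
  have e := sq_mul_rpow_mul_nonlin hα hx (f x)
  rw [tailVal, ← e, tailSlope, add_sub_cancel_right, Real.rpow_add_one hx.ne']
  field_simp
  ring

/-- The Lyapunov function of the rescaled system. -/
def tailEnergy (α κ : ℝ) (f g : ℝ → ℝ) (x : ℝ) : ℝ :=
  tailSlope (2 / α) f g x ^ 2 / 2 + κ * potential α (tailVal (2 / α) f x)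
    + 2 / α * (2 / α + 1) * tailVal (2 / α) f x ^ 2 / 2

theorem hasDerivAt_tailEnergy (hα : 0 < α) (h : IsProfile α κ f g) {x : ℝ} (hx : 0 < x) :
    HasDerivAt (tailEnergy α κ f g)
      (-(x / 2 - (2 * (2 / α) + 1) / x) * tailSlope (2 / α) f g x ^ 2) x := by
  have d1 := ((h.hasDerivAt_tailSlope hα hx).pow 2).div_const 2
  have dz := h.hasDerivAt_tailVal (2 / α) hx
  have d2 := ((hasDerivAt_potential hα _).comp x dz).const_mul κ
  have d3 := ((dz.pow 2).const_mul (2 / α * (2 / α + 1))).div_const 2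
  refine ((d1.add d2).add d3).congr_deriv ?_
  norm_num
  field_simp
  ring

end IsProfile

/-- The abscissa from which on the asymptotic estimates hold. -/
def tailStart (α : ℝ) : ℝ := 2 * (2 / α + 2)

theorem tailStart_pos {α : ℝ} (hα : 0 < α) : 0 < tailStart α := by unfold tailStart; positivity

/-- This bound is what the barrier `K / x ^ 2` of `le_div_sq_of_damped` needs; the next one makes
`tailEnergy` nonincreasing. -/
theorem sixteen_le_tailStart_sq {α : ℝ} (hα : 0 < α) : 16 ≤ tailStart α ^ 2 := by
  have : 0 < 2 / α := by positivity
  unfold tailStart; nlinarith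

theorem mul_le_tailStart_sq {α : ℝ} (hα : 0 < α) : 2 * (2 * (2 / α) + 1) ≤ tailStart α ^ 2 := by
  have : 0 < 2 / α := by positivity
  unfold tailStart; nlinarith

namespace IsProfile

variable {α κ : ℝ} {f g : ℝ → ℝ}

theorem tailEnergy_le (hα : 0 < α) (h : IsProfile α κ f g) {x : ℝ} (hx : tailStart α ≤ x) :
    tailEnergy α κ f g x ≤ tailEnergy α κ f g (tailStart α) := by
  have h0 := tailStart_pos hα
  refine antitoneOn_of_deriv_nonpos (convex_Ici (tailStart α))
    (fun y hy => (h.hasDerivAt_tailEnergy hα (h0.trans_le hy)).continuousAt.continuousWithinAt)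
    (fun y hy => ?_) (fun y hy => ?_) self_mem_Ici hx hx
  · rw [interior_Ici, mem_Ioi] at hy
    exact (h.hasDerivAt_tailEnergy hα (h0.trans hy)).differentiableAt.differentiableWithinAt
  · rw [interior_Ici, mem_Ioi] at hy
    have hy0 := h0.trans hy
    rw [(h.hasDerivAt_tailEnergy hα hy0).deriv]
    have h1 := mul_le_tailStart_sq hα
    have h2 : (2 * (2 / α) + 1) / y ≤ y / 2 := by
      rw [div_le_div_iff₀ hy0 two_pos]
      nlinarith
    nlinarith [sq_nonneg (tailSlope (2 / α) f g y)]

end IsProfile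

/-- `K / x ^ 2` is an upper barrier. At a contact point the barrier slope minus q' is (y²(K/2 - e) -
2K)/y³, and e ≤ M < K/4 together with y² ≥ 16 makes it positive. -/
theorem le_div_sq_of_damped {q e : ℝ → ℝ} {a M K : ℝ} (ha : 0 < a) (ha2 : 16 ≤ a ^ 2) (hM : 0 ≤ M)
    (hK : 4 * M < K) (hq : ∀ x, a ≤ x → HasDerivAt q (-(x / 2) * q x + e x / x) x)
    (he : ∀ x, a ≤ x → e x ≤ M) (h0 : q a ≤ K / a ^ 2) {x : ℝ} (hx : a ≤ x) : q x ≤ K / x ^ 2 := by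
  have hB : ∀ y, a ≤ y → HasDerivAt (fun y => K / y ^ 2) (-(2 * K / y ^ 3)) y := by
    intro y hy
    have hy0 : y ≠ 0 := (ha.trans_le hy).ne'
    refine ((hasDerivAt_const y K).div (hasDerivAt_pow 2 y) (pow_ne_zero 2 hy0)).congr_deriv ?_
    norm_num
    field_simp
  refine image_le_of_deriv_right_lt_deriv_boundary' (a := a) (b := x)
    (fun y hy => (hq y hy.1).continuousAt.continuousWithinAt)
    (fun y hy => (hq y hy.1).hasDerivWithinAt) h0
    (fun y hy => (hB y hy.1).continuousAt.continuousWithinAt)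
    (fun y hy => (hB y hy.1).hasDerivWithinAt) (fun y hy hqy => ?_) ⟨hx, le_rfl⟩
  have hy0 : 0 < y := ha.trans_le hy.1
  have hy2 : 16 ≤ y ^ 2 := ha2.trans (by gcongr; exact hy.1)
  have h1 := he y hy.1
  rw [hqy, ← sub_pos]
  have e1 : -(2 * K / y ^ 3) - (-(y / 2) * (K / y ^ 2) + e y / y)
      = (y ^ 2 * (K / 2 - e y) - 2 * K) / y ^ 3 := by
    field_simp
    ring
  rw [e1]
  apply div_pos _ (by positivity)
  nlinarith

/-- Since |z'| ≤ K/x³, the function z - K/(2x²) increases and z + K/(2x²) decreases; the limit is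
squeezed between them. The explicit rate is what later gives uniformity in the shooting parameter.
-/
theorem exists_limit_of_deriv_le {z w : ℝ → ℝ} {a K : ℝ} (ha : 0 < a)
    (hz : ∀ x, a ≤ x → HasDerivAt z (w x / x) x) (hw : ∀ x, a ≤ x → |w x| ≤ K / x ^ 2) :
    ∃ L, ∀ x, a ≤ x → |z x - L| ≤ K / x ^ 2 := by
  have hB : ∀ y, a ≤ y → HasDerivAt (fun y => K / (2 * y ^ 2)) (-(K / y ^ 3)) y := by
    intro y hy
    have hy0 : y ≠ 0 := (ha.trans_le hy).ne'
    refine ((hasDerivAt_const y K).div ((hasDerivAt_pow 2 y).const_mul 2)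
      (by positivity)).congr_deriv ?_
    norm_num
    field_simp
  have hw' : ∀ y, a ≤ y → -(K / y ^ 3) ≤ w y / y ∧ w y / y ≤ K / y ^ 3 := by
    intro y hy
    have hy0 : 0 < y := ha.trans_le hy
    have h1 := abs_le.1 (hw y hy)
    have e : K / y ^ 3 = K / y ^ 2 / y := by field_simp
    rw [e, ← neg_div]
    exact ⟨by gcongr; exact h1.1, by gcongr; exact h1.2⟩
  have hK : 0 ≤ K := by
    have := (abs_nonneg _).trans (hw a le_rfl)
    have h2 : 0 < a ^ 2 := by positivity
    by_contra hcon
    push Not at hcon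
    exact absurd this (not_le.2 (div_neg_of_neg_of_pos hcon h2))
  have hmono : MonotoneOn (fun y => z y - K / (2 * y ^ 2)) (Ici a) := by
    refine monotoneOn_of_deriv_nonneg (convex_Ici a)
      (fun y hy => ((hz y hy).sub (hB y hy)).continuousAt.continuousWithinAt)
      (fun y hy => ?_) (fun y hy => ?_)
    · rw [interior_Ici, mem_Ioi] at hy
      exact ((hz y hy.le).sub (hB y hy.le)).differentiableAt.differentiableWithinAt
    · rw [interior_Ici, mem_Ioi] at hy
      rw [HasDerivAt.deriv (f := fun y => z y - K / (2 * y ^ 2)) ((hz y hy.le).sub (hB y hy.le))]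
      linarith [(hw' y hy.le).1]
  have hanti : AntitoneOn (fun y => z y + K / (2 * y ^ 2)) (Ici a) := by
    refine antitoneOn_of_deriv_nonpos (convex_Ici a)
      (fun y hy => ((hz y hy).add (hB y hy)).continuousAt.continuousWithinAt)
      (fun y hy => ?_) (fun y hy => ?_)
    · rw [interior_Ici, mem_Ioi] at hy
      exact ((hz y hy.le).add (hB y hy.le)).differentiableAt.differentiableWithinAt
    · rw [interior_Ici, mem_Ioi] at hy
      rw [HasDerivAt.deriv (f := fun y => z y + K / (2 * y ^ 2)) ((hz y hy.le).add (hB y hy.le))]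
      linarith [(hw' y hy.le).2]
  have hle : ∀ x ∈ Ici a, ∀ y ∈ Ici a, z x - K / (2 * x ^ 2) ≤ z y + K / (2 * y ^ 2) := by
    intro x hx y hy
    have hm : max x y ∈ Ici a := le_trans hx (le_max_left x y)
    have h1 := hmono hx hm (le_max_left x y)
    have h2 := hanti hy hm (le_max_right x y)
    have h3 : 0 ≤ K / (2 * (max x y) ^ 2) := by positivity
    simp only at h1 h2
    linarith
  refine ⟨sSup ((fun y => z y - K / (2 * y ^ 2)) '' Ici a), fun x hx => ?_⟩
  have hbdd : BddAbove ((fun y => z y - K / (2 * y ^ 2)) '' Ici a) :=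
    ⟨_, by rintro _ ⟨y, hy, rfl⟩; exact hle y hy a self_mem_Ici⟩
  have h1 : z x - K / (2 * x ^ 2) ≤ sSup ((fun y => z y - K / (2 * y ^ 2)) '' Ici a) :=
    le_csSup hbdd ⟨x, hx, rfl⟩
  have h2 : sSup ((fun y => z y - K / (2 * y ^ 2)) '' Ici a) ≤ z x + K / (2 * x ^ 2) :=
    csSup_le ⟨_, a, self_mem_Ici, rfl⟩ (by rintro _ ⟨y, hy, rfl⟩; exact hle y hy x hx)
  have hx0 : 0 < x := ha.trans_le hx
  have h3 : K / (2 * x ^ 2) ≤ K / x ^ 2 := by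
    apply div_le_div_of_nonneg_left hK (by positivity)
    nlinarith [pow_pos hx0 2]
  rw [abs_le]
  constructor <;> linarith

/-- Asymptotics of profiles, with constants that are uniform on bounded sets of data. -/
theorem exists_tail_bound {α κ : ℝ} (hα : 0 < α) (hκ : 0 ≤ κ) (hκ1 : κ ≤ 1) (B : ℝ) (hB : 0 ≤ B) :
    ∃ K, 0 < K ∧ ∀ f g, IsProfile α κ f g → |f (tailStart α)| ≤ B → |g (tailStart α)| ≤ B →
      ∃ L, ∀ x, tailStart α ≤ x → |tailVal (2 / α) f x - L| ≤ K / x ^ 2 ∧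
        |tailSlope (2 / α) f g x| ≤ K / x ^ 2 := by
  obtain ⟨a, ha⟩ : ∃ y, y = tailStart α := ⟨_, rfl⟩
  have ha0 : 0 < a := ha ▸ tailStart_pos hα
  have ha16 : 16 ≤ a ^ 2 := ha ▸ sixteen_le_tailStart_sq hα
  obtain ⟨β, hβ⟩ : ∃ y, y = 2 / α := ⟨_, rfl⟩
  have hβ0 : 0 < β := by rw [hβ]; positivity
  obtain ⟨P, hP⟩ : ∃ y, y = a ^ β * B := ⟨_, rfl⟩
  have haβ : 0 < a ^ β := Real.rpow_pos_of_pos ha0 _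
  have haβ1 : 0 < a ^ (β + 1) := Real.rpow_pos_of_pos ha0 _
  have hP0 : 0 ≤ P := by rw [hP]; positivity
  obtain ⟨Q, hQ⟩ : ∃ y, y = a ^ (β + 1) * B + β * P := ⟨_, rfl⟩
  have hQ0 : 0 ≤ Q := by rw [hQ]; positivity
  obtain ⟨C, hC⟩ : ∃ y, y = β * (β + 1) := ⟨_, rfl⟩
  have hC0 : 0 < C := by rw [hC]; positivity
  obtain ⟨W, hW⟩ : ∃ y, y = Q ^ 2 / 2 + potential α P + C * P ^ 2 / 2 := ⟨_, rfl⟩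
  have hW0 : 0 ≤ W := by have := potential_nonneg hα P; rw [hW]; positivity
  -- `tailEnergy ≤ W` gives q² ≤ 2W and z² ≤ 2W/C; the summand 1 ensures M ≤ M², so M bounds both
  -- |q| and |z|.
  obtain ⟨M, hM⟩ : ∃ y, y = 1 + 2 * W + 2 * W / C := ⟨_, rfl⟩
  have hd : 0 ≤ 2 * W / C := by positivity
  have hM0 : 0 ≤ M := by rw [hM]; positivity
  have hMM : M ≤ M ^ 2 := by nlinarith [show 1 ≤ M by rw [hM]; linarith]
  obtain ⟨M₁, hM1⟩ : ∃ y, y = M ^ (α + 1) + (2 * β + 1) * M + C * M := ⟨_, rfl⟩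
  have hMα : 0 ≤ M ^ (α + 1) := Real.rpow_nonneg hM0 _
  have hM10 : 0 ≤ M₁ := by rw [hM1]; positivity
  rw [← ha, ← hβ]
  -- `4 * M₁ + 1` satisfies the strict inequality required by the barrier, and `M * a ^ 2` puts the
  -- barrier above |q| at the starting point a.
  refine ⟨4 * M₁ + 1 + M * a ^ 2, by positivity, fun f g h hf hg => ?_⟩
  have hz : |tailVal β f a| ≤ P := by
    rw [tailVal, abs_mul, abs_of_pos haβ, hP]
    gcongr
  have hq : |tailSlope β f g a| ≤ Q := by
    rw [tailSlope]
    refine (abs_add_le _ _).trans ?_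
    rw [abs_mul, abs_mul, abs_of_pos haβ1, abs_of_pos hβ0, hQ]
    gcongr
    exact hz
  have hWa : IsProfile.tailEnergy α κ f g a ≤ W := by
    have h1 : tailSlope β f g a ^ 2 ≤ Q ^ 2 := sq_le_sq' (by linarith [(abs_le.1 hq).1]) (abs_le.1 hq).2
    have h2 : tailVal β f a ^ 2 ≤ P ^ 2 := sq_le_sq' (by linarith [(abs_le.1 hz).1]) (abs_le.1 hz).2
    have h3 : potential α (tailVal β f a) ≤ potential α P := by
      unfold potential
      rw [abs_of_nonneg hP0]
      gcongr
    have h4 : κ * potential α (tailVal β f a) ≤ potential α (tailVal β f a) :=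
      mul_le_of_le_one_left (potential_nonneg hα _) hκ1
    rw [IsProfile.tailEnergy, hW, ← hβ, ← hC]
    have h5 : C * tailVal β f a ^ 2 ≤ C * P ^ 2 := by gcongr
    linarith
  have hbd : ∀ x, a ≤ x → |tailVal β f x| ≤ M ∧ |tailSlope β f g x| ≤ M := by
    intro x hx
    have h1 := (h.tailEnergy_le hα (ha ▸ hx)).trans (ha ▸ hWa)
    rw [IsProfile.tailEnergy, ← hβ, ← hC] at h1
    have h2 : 0 ≤ κ * potential α (tailVal β f x) := mul_nonneg hκ (potential_nonneg hα _)
    have h3 : 0 ≤ C * tailVal β f x ^ 2 := by positivity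
    have h4 : 0 ≤ tailSlope β f g x ^ 2 := by positivity
    constructor
    · refine abs_le_of_sq_le_sq ?_ hM0
      have h5 : C * tailVal β f x ^ 2 ≤ 2 * W := by linarith
      have h6 : tailVal β f x ^ 2 ≤ 2 * W / C := by
        rw [le_div_iff₀ hC0]; linarith
      linarith
    · refine abs_le_of_sq_le_sq ?_ hM0
      linarith
  set e : ℝ → ℝ := fun x => -(κ * nonlin α (tailVal β f x)) + (2 * β + 1) * tailSlope β f g x
    - C * tailVal β f x with he
  have heb : ∀ x, a ≤ x → |e x| ≤ M₁ := by
    intro x hx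
    obtain ⟨h1, h2⟩ := hbd x hx
    have h3 : |κ * nonlin α (tailVal β f x)| ≤ M ^ (α + 1) := by
      rw [abs_mul, abs_of_nonneg hκ, abs_nonlin _ _ hα]
      calc κ * |tailVal β f x| ^ (α + 1) ≤ 1 * M ^ (α + 1) := by gcongr
        _ = _ := one_mul _
    have h4 : |(2 * β + 1) * tailSlope β f g x| ≤ (2 * β + 1) * M := by
      rw [abs_mul, abs_of_pos (by positivity)]; gcongr
    have h5 : |C * tailVal β f x| ≤ C * M := by
      rw [abs_mul, abs_of_pos hC0]; gcongr
    rw [abs_le] at h3 h4 h5 ⊢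
    simp only [he]
    constructor <;> linarith [h3.1, h3.2, h4.1, h4.2, h5.1, h5.2]
  have hqd : ∀ x, a ≤ x → HasDerivAt (tailSlope β f g)
      (-(x / 2) * tailSlope β f g x + e x / x) x :=
    fun x hx => by
      have := h.hasDerivAt_tailSlope hα (ha0.trans_le hx)
      rwa [← hβ, ← hC] at this
  have hinit : M ≤ (4 * M₁ + 1 + M * a ^ 2) / a ^ 2 := by
    rw [le_div_iff₀ (by positivity)]; linarith
  have hK : 4 * M₁ < 4 * M₁ + 1 + M * a ^ 2 := by
    have : 0 ≤ M * a ^ 2 := by positivity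
    linarith
  have hqb : ∀ x, a ≤ x → |tailSlope β f g x| ≤ (4 * M₁ + 1 + M * a ^ 2) / x ^ 2 := by
    intro x hx
    rw [abs_le]
    constructor
    · have := le_div_sq_of_damped (q := fun y => -tailSlope β f g y) (e := fun y => -e y) ha0
        ha16 hM10 hK
        (fun y hy => (hqd y hy).neg.congr_deriv (by ring))
        (fun y hy => (neg_le_abs _).trans (heb y hy))
        (((neg_le_abs _).trans (hbd a le_rfl).2).trans hinit) hx
      linarith
    · exact le_div_sq_of_damped ha0 ha16 hM10 hK hqd
        (fun y hy => (le_abs_self _).trans (heb y hy))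
        (((le_abs_self _).trans (hbd a le_rfl).2).trans hinit) hx
  obtain ⟨L, hL⟩ := exists_limit_of_deriv_le ha0
    (fun x hx => h.hasDerivAt_tailVal β (ha0.trans_le hx)) hqb
  exact ⟨L, fun x hx => ⟨hL x hx, hqb x hx⟩⟩

end Tail
end
end NLHE
namespace NLHE
noncomputable section

/-! ### The overdamped regime after a small critical value. -/

section Creep

/-- The coefficient `β(β+1)`, `β = 2/α`, of the rescaled system. -/
def tailCoeff (α : ℝ) : ℝ := 2 / α * (2 / α + 1)

theorem tailCoeff_pos {α : ℝ} (hα : 0 < α) : 0 < tailCoeff α := by unfold tailCoeff; positivity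

/-- Beyond this abscissa a small critical value is followed by a monotone, overdamped tail. -/
def creepStart (α : ℝ) : ℝ := 1 + 8 * (2 * (2 / α) + 3 + 4 * tailCoeff α)

theorem one_le_creepStart {α : ℝ} (hα : 0 < α) : 1 ≤ creepStart α := by
  have := tailCoeff_pos hα
  have : 0 < 2 / α := by positivity
  unfold creepStart; linarith

/-- The size of `|f|^α / x²` below which the profile is overdamped. -/
def creepRatio (α : ℝ) : ℝ := 1 / (32 * (α + 1))

theorem creepRatio_pos {α : ℝ} (hα : 0 < α) : 0 < creepRatio α := by unfold creepRatio; positivity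

/-- The bound on `(x^β f)^(-α)` after a critical point `η` with `f(η)^α = v`. -/
def creepBound (α η v : ℝ) : ℝ :=
  ((η ^ 2 * v)⁻¹ + 1 / tailCoeff α) * Real.exp (2 * α * tailCoeff α / η ^ 2) - 1 / tailCoeff α

theorem tailVal_rpow {α : ℝ} (hα : 0 < α) {f : ℝ → ℝ} {x : ℝ} (hx : 0 < x) (hf : 0 ≤ f x) :
    tailVal (2 / α) f x ^ α = x ^ 2 * f x ^ α := by
  rw [tailVal, Real.mul_rpow (Real.rpow_nonneg hx.le _) hf, ← Real.rpow_mul hx.le,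
    div_mul_cancel₀ _ hα.ne']
  norm_num

namespace IsProfile

variable {α : ℝ} {f g : ℝ → ℝ} {η T : ℝ}

/-- The integrating factor exp(x²/4) removes the damping term, so the sign of the derivative is
opposite to that of f. -/
theorem hasDerivAt_exp_mul_snd (h : IsProfile α 1 f g) (x : ℝ) :
    HasDerivAt (fun y => Real.exp (y ^ 2 / 4) * g y)
      (-(Real.exp (x ^ 2 / 4) * (f x / α + nonlin α (f x)))) x := by
  have d : HasDerivAt (fun y : ℝ => Real.exp (y ^ 2 / 4)) (Real.exp (x ^ 2 / 4) * (x / 2)) x := by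
    refine ((hasDerivAt_pow 2 x).div_const 4).exp.congr_deriv ?_
    norm_num
    ring
  refine (d.mul (h.hasDerivAt_snd x)).congr_deriv ?_
  ring

theorem exp_mul_snd_strictAntiOn (hα : 0 < α) (h : IsProfile α 1 f g) {a b : ℝ}
    (hf : ∀ x ∈ Ioo a b, 0 < f x) :
    StrictAntiOn (fun y => Real.exp (y ^ 2 / 4) * g y) (Icc a b) := by
  refine strictAntiOn_of_deriv_neg (convex_Icc a b)
    (fun y _ => (h.hasDerivAt_exp_mul_snd y).continuousAt.continuousWithinAt) (fun y hy => ?_)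
  rw [interior_Icc] at hy
  rw [(h.hasDerivAt_exp_mul_snd y).deriv, nonlin_of_nonneg hα (hf y hy).le]
  have := hf y hy
  have := Real.rpow_pos_of_pos this (α + 1)
  have : 0 < f y / α := by positivity
  have := Real.exp_pos (y ^ 2 / 4)
  rw [neg_lt_zero]
  positivity

theorem snd_nonpos_of_pos (hα : 0 < α) (h : IsProfile α 1 f g) (hg : g η = 0)
    (hf : ∀ x ∈ Ico η T, 0 < f x) {x : ℝ} (hx : x ∈ Ico η T) : g x ≤ 0 := by
  have := (h.exp_mul_snd_strictAntiOn hα (a := η) (b := x)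
    (fun y hy => hf y ⟨hy.1.le, hy.2.trans hx.2⟩)).antitoneOn
    ⟨le_rfl, hx.1⟩ ⟨hx.1, le_rfl⟩ hx.1
  simp only [hg, mul_zero] at this
  exact nonpos_of_mul_nonpos_right this (Real.exp_pos _)

theorem fst_le_of_pos (hα : 0 < α) (h : IsProfile α 1 f g) (hg : g η = 0)
    (hf : ∀ x ∈ Ico η T, 0 < f x) {x : ℝ} (hx : x ∈ Ico η T) : f x ≤ f η := by
  refine antitoneOn_of_deriv_nonpos (convex_Icc η x) h.continuous_fst.continuousOn
    (fun y _ => (h.hasDerivAt_fst y).differentiableAt.differentiableWithinAt) (fun y hy => ?_)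
    ⟨le_rfl, hx.1⟩ ⟨hx.1, le_rfl⟩ hx.1
  rw [interior_Icc] at hy
  rw [(h.hasDerivAt_fst y).deriv]
  exact h.snd_nonpos_of_pos hα hg hf ⟨hy.1.le, hy.2.trans hx.2⟩

/-- Balancing damping against force in the equation for q gives the quasi-stationary value
-2(z^(α+1) + C z)/x². Twice this value is a lower barrier in the overdamped region: it starts below
q(η) = β z(η) ≥ 0, and at a contact q' exceeds its slope. -/
theorem neg_barrier_le_tailSlope (hα : 0 < α) (h : IsProfile α 1 f g) (hη : creepStart α ≤ η)
    (hg : g η = 0) (hf : ∀ x ∈ Ico η T, 0 < f x) (hR : f η ^ α ≤ creepRatio α * η ^ 2)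
    {x : ℝ} (hx : x ∈ Ico η T) :
    -(4 * (nonlin α (tailVal (2 / α) f x) + tailCoeff α * tailVal (2 / α) f x) / x ^ 2)
      ≤ tailSlope (2 / α) f g x := by
  have hη1 : 1 ≤ η := (one_le_creepStart hα).trans hη
  have hC := tailCoeff_pos hα
  obtain ⟨C, hCe⟩ : ∃ y, y = tailCoeff α := ⟨_, rfl⟩
  obtain ⟨β, hβe⟩ : ∃ y, y = 2 / α := ⟨_, rfl⟩
  have hβ : 0 < β := by rw [hβe]; positivity
  rw [← hCe] at hC
  have hC' : C = β * (β + 1) := by rw [hCe, hβe, tailCoeff]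
  rw [← hCe, ← hβe]
  have hzpos : ∀ y ∈ Ico η T, 0 < tailVal β f y := fun y hy =>
    mul_pos (Real.rpow_pos_of_pos (by linarith [hy.1]) _) (hf y hy)
  have dz : ∀ y, η ≤ y → HasDerivAt (tailVal β f) (tailSlope β f g y / y) y :=
    fun y hy => h.hasDerivAt_tailVal β (by linarith)
  have dq : ∀ y, η ≤ y → HasDerivAt (tailSlope β f g)
      (-(y / 2) * tailSlope β f g y + (-(nonlin α (tailVal β f y))
        + (2 * β + 1) * tailSlope β f g y - C * tailVal β f y) / y) y := by
    intro y hy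
    have := h.hasDerivAt_tailSlope hα (show 0 < y by linarith)
    rwa [← hβe, ← hC', one_mul] at this
  have dB : ∀ y, η ≤ y → HasDerivAt
      (fun y => -(4 * (nonlin α (tailVal β f y) + C * tailVal β f y) / y ^ 2))
      (-(4 * (((α + 1) * |tailVal β f y| ^ α + C) * (tailSlope β f g y / y)) / y ^ 2
        - 2 * (4 * (nonlin α (tailVal β f y) + C * tailVal β f y) / y ^ 2) / y)) y := by
    intro y hy
    have hy0 : y ≠ 0 := by linarith
    have d1 := ((hasDerivAt_nonlin hα _).comp y (dz y hy)).add ((dz y hy).const_mul C)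
    refine ((d1.const_mul 4).div (hasDerivAt_pow 2 y) (pow_ne_zero 2 hy0)).neg.congr_deriv ?_
    simp
    field_simp
    ring
  refine image_le_of_deriv_right_lt_deriv_boundary' (a := η) (b := x)
    (fun y hy => (dB y hy.1).continuousAt.continuousWithinAt)
    (fun y hy => (dB y hy.1).hasDerivWithinAt) ?_
    (fun y hy => (dq y hy.1).continuousAt.continuousWithinAt)
    (fun y hy => (dq y hy.1).hasDerivWithinAt) (fun y hy hqy => ?_) ⟨hx.1, le_rfl⟩
  · have hz := hzpos η ⟨le_rfl, hx.1.trans_lt hx.2⟩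
    have hn : 0 ≤ nonlin α (tailVal β f η) := by
      rw [nonlin_of_nonneg hα hz.le]; exact Real.rpow_nonneg hz.le _
    have h1 : 0 ≤ tailSlope β f g η := by
      rw [tailSlope, hg, mul_zero, zero_add]
      exact mul_nonneg hβ.le hz.le
    refine le_trans ?_ h1
    rw [neg_nonpos]
    positivity
  · have hyT : y ∈ Ico η T := ⟨hy.1, hy.2.trans hx.2⟩
    have hy1 : 1 ≤ y := hη1.trans hy.1
    have hy0 : 0 < y := by linarith
    have hz := hzpos y hyT
    have hn : 0 ≤ nonlin α (tailVal β f y) := by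
      rw [nonlin_of_nonneg hα hz.le]; exact Real.rpow_nonneg hz.le _
    obtain ⟨B, hB⟩ : ∃ B, B = 4 * (nonlin α (tailVal β f y) + C * tailVal β f y) / y ^ 2 :=
      ⟨_, rfl⟩
    have hB0 : 0 < B := by rw [hB]; positivity
    have hBn : nonlin α (tailVal β f y) = B * y ^ 2 / 4 - C * tailVal β f y := by
      rw [hB]; field_simp; ring
    rw [← hB] at hqy ⊢
    rw [← hqy, hBn]
    have hzα : |tailVal β f y| ^ α ≤ creepRatio α * y ^ 4 := by
      rw [abs_of_pos hz, hβe, tailVal_rpow hα hy0 (hf y hyT).le]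
      have h1 : f y ^ α ≤ creepRatio α * η ^ 2 :=
        (Real.rpow_le_rpow (hf y hyT).le (h.fst_le_of_pos hα hg hf hyT) hα.le).trans hR
      have hr := creepRatio_pos hα
      have h2 : η ^ 2 ≤ y ^ 2 := by gcongr; exact hy.1
      calc y ^ 2 * f y ^ α ≤ y ^ 2 * (creepRatio α * y ^ 2) := by
            gcongr; exact h1.trans (by gcongr)
        _ = _ := by ring
    -- The constant 32 in `creepRatio` enters here: four times this quantity uses only half of the
    -- leading term y⁴/4 below. The other half absorbs the terms in y² and C, by the choice of
    -- `creepStart`.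
    have hzα' : (α + 1) * |tailVal β f y| ^ α ≤ y ^ 4 / 32 := by
      calc (α + 1) * |tailVal β f y| ^ α ≤ (α + 1) * (creepRatio α * y ^ 4) := by gcongr
        _ = y ^ 4 / 32 := by unfold creepRatio; field_simp
    rw [← sub_pos]
    have e : -(y / 2) * -B + (-(B * y ^ 2 / 4 - C * tailVal β f y) + (2 * β + 1) * -B
          - C * tailVal β f y) / y
        - -(4 * (((α + 1) * |tailVal β f y| ^ α + C) * (-B / y)) / y ^ 2 - 2 * B / y)
        = B / y ^ 3 * (y ^ 4 / 4 - (2 * β + 1) * y ^ 2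
          - 4 * ((α + 1) * |tailVal β f y| ^ α + C) - 2 * y ^ 2) := by
      field_simp
      ring
    rw [e]
    refine mul_pos (by positivity) ?_
    have hyc : 1 + 8 * (2 * β + 3 + 4 * C) ≤ y := by
      have : creepStart α ≤ y := hη.trans hy.1
      rwa [creepStart, ← hβe, ← hCe] at this
    have hy2 : 1 + 8 * (2 * β + 3 + 4 * C) ≤ y ^ 2 := hyc.trans (by nlinarith)
    have hy21 : 1 ≤ y ^ 2 := by nlinarith
    nlinarith [mul_le_mul_of_nonneg_left hy2 (sq_nonneg y)]

/-- For Z = z^(-α) the barrier on q becomes Z' ≤ 4αC(Z + 1/C)/x³, so (Z + 1/C) exp(2αC/x²) is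
nonincreasing. Working with a negative power turns a lower bound for z into an upper bound that
survives up to a possible zero. -/
theorem tailVal_rpow_neg_le (hα : 0 < α) (h : IsProfile α 1 f g) (hη : creepStart α ≤ η)
    (hg : g η = 0) (hf : ∀ x ∈ Ico η T, 0 < f x) (hR : f η ^ α ≤ creepRatio α * η ^ 2)
    {x : ℝ} (hx : x ∈ Ico η T) :
    tailVal (2 / α) f x ^ (-α) ≤ creepBound α η (f η ^ α) := by
  have hη1 : 1 ≤ η := (one_le_creepStart hα).trans hη
  have hC := tailCoeff_pos hα
  have hzpos : ∀ y ∈ Ico η T, 0 < tailVal (2 / α) f y := fun y hy =>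
    mul_pos (Real.rpow_pos_of_pos (by linarith [hy.1]) _) (hf y hy)
  have hd : ∀ y ∈ Ico η T, HasDerivAt (fun y => (tailVal (2 / α) f y ^ (-α) + 1 / tailCoeff α) *
      Real.exp (2 * α * tailCoeff α / y ^ 2))
      ((tailSlope (2 / α) f g y / y * (-α) * tailVal (2 / α) f y ^ (-α - 1)
        - (tailVal (2 / α) f y ^ (-α) + 1 / tailCoeff α) * (4 * α * tailCoeff α / y ^ 3))
        * Real.exp (2 * α * tailCoeff α / y ^ 2)) y := by
    intro y hy
    have hy0 : 0 < y := by linarith [hy.1]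
    have d1 := ((h.hasDerivAt_tailVal (2 / α) hy0).rpow_const (p := -α)
      (Or.inl (hzpos y hy).ne')).add_const (1 / tailCoeff α)
    have d2 := ((hasDerivAt_const y (2 * α * tailCoeff α)).div (hasDerivAt_pow 2 y)
      (pow_ne_zero 2 hy0.ne')).exp
    refine (d1.mul d2).congr_deriv ?_
    simp
    field_simp
    ring
  have hanti : AntitoneOn (fun y => (tailVal (2 / α) f y ^ (-α) + 1 / tailCoeff α) *
      Real.exp (2 * α * tailCoeff α / y ^ 2)) (Icc η x) := by
    refine antitoneOn_of_deriv_nonpos (convex_Icc η x)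
      (fun y hy => (hd y ⟨hy.1, hy.2.trans_lt hx.2⟩).continuousAt.continuousWithinAt)
      (fun y hy => ?_) (fun y hy => ?_)
    · rw [interior_Icc] at hy
      exact (hd y ⟨hy.1.le, hy.2.trans hx.2⟩).differentiableAt.differentiableWithinAt
    · rw [interior_Icc] at hy
      have hyT : y ∈ Ico η T := ⟨hy.1.le, hy.2.trans hx.2⟩
      have hy0 : 0 < y := by linarith [hy.1]
      rw [(hd y hyT).deriv]
      refine mul_nonpos_of_nonpos_of_nonneg ?_ (Real.exp_pos _).le
      have hz := hzpos y hyT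
      have hb := h.neg_barrier_le_tailSlope hα hη hg hf hR hyT
      rw [nonlin_of_nonneg hα hz.le] at hb
      obtain ⟨z, hze⟩ : ∃ z, z = tailVal (2 / α) f y := ⟨_, rfl⟩
      rw [← hze] at hb hz ⊢
      have hzp := Real.rpow_pos_of_pos hz (-α - 1)
      have e1 : z ^ (-α - 1) * z ^ (α + 1) = 1 := by
        rw [← Real.rpow_add hz]; simp
      have e2 : z ^ (-α - 1) * z = z ^ (-α) := by
        rw [← Real.rpow_add_one hz.ne']; simp
      have h2 : -(tailSlope (2 / α) f g y) ≤ 4 * (z ^ (α + 1) + tailCoeff α * z) / y ^ 2 := by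
        linarith
      have h3 : tailSlope (2 / α) f g y / y * (-α) * z ^ (-α - 1) ≤
          4 * (z ^ (α + 1) + tailCoeff α * z) / y ^ 2 * (α / y * z ^ (-α - 1)) := by
        have : tailSlope (2 / α) f g y / y * (-α) * z ^ (-α - 1)
          = -(tailSlope (2 / α) f g y) * (α / y * z ^ (-α - 1)) := by ring
        rw [this]
        gcongr
      have h4 : 4 * (z ^ (α + 1) + tailCoeff α * z) / y ^ 2 * (α / y * z ^ (-α - 1))
          = (z ^ (-α) + 1 / tailCoeff α) * (4 * α * tailCoeff α / y ^ 3) := by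
        rw [← e2]
        field_simp
        linear_combination e1
      linarith
  have h1 := hanti ⟨le_rfl, hx.1⟩ ⟨hx.1, le_rfl⟩ hx.1
  simp only at h1
  have hηT : η ∈ Ico η T := ⟨le_rfl, hx.1.trans_lt hx.2⟩
  have e : tailVal (2 / α) f η ^ (-α) = (η ^ 2 * f η ^ α)⁻¹ := by
    rw [Real.rpow_neg (hzpos η hηT).le, tailVal_rpow hα (by linarith) (hf η hηT).le]
  rw [e] at h1
  have h2 : 1 ≤ Real.exp (2 * α * tailCoeff α / x ^ 2) := Real.one_le_exp (by positivity)
  have h3 : 0 ≤ tailVal (2 / α) f x ^ (-α) := Real.rpow_nonneg (hzpos x hx).le _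
  have h4 : 0 < 1 / tailCoeff α := by positivity
  unfold creepBound
  nlinarith

/-- After a critical point in the overdamped region the profile keeps its sign, and its rescaled
tail is bounded from below. -/
theorem overdamped (hα : 0 < α) (h : IsProfile α 1 f g) (hη : creepStart α ≤ η)
    (hg : g η = 0) (hf : 0 < f η) (hR : f η ^ α ≤ creepRatio α * η ^ 2) {x : ℝ} (hx : η ≤ x) :
    0 < f x ∧ tailVal (2 / α) f x ^ (-α) ≤ creepBound α η (f η ^ α) := by
  have hη1 : 1 ≤ η := (one_le_creepStart hα).trans hη
  have hpos : ∀ y, η ≤ y → 0 < f y := by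
    by_contra hcon
    push Not at hcon
    obtain ⟨y, hy, hfy⟩ := hcon
    -- At the first point of `S` positivity is lost. Before it the bound on z^(-α) keeps z above a
    -- fixed positive number, and by continuity the same holds at that point, a contradiction.
    set S := Ici η ∩ f ⁻¹' (Iic 0) with hS
    have hclosed : IsClosed S := isClosed_Ici.inter (isClosed_Iic.preimage h.continuous_fst)
    have hbdd : BddBelow S := ⟨η, fun t ht => ht.1⟩
    have hT : sInf S ∈ S := hclosed.csInf_mem ⟨y, hy, hfy⟩ hbdd
    have hpos : ∀ t ∈ Ico η (sInf S), 0 < f t := by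
      intro t ht
      by_contra hc
      push Not at hc
      exact absurd (csInf_le hbdd ⟨ht.1, hc⟩) (not_le.2 ht.2)
    have hηT : η < sInf S := by
      refine lt_of_le_of_ne hT.1 fun he => ?_
      have : f (sInf S) ≤ 0 := hT.2
      rw [← he] at this
      linarith
    obtain ⟨D, hD⟩ : ∃ D, D = creepBound α η (f η ^ α) := ⟨_, rfl⟩
    have hlow : ∀ t ∈ Ico η (sInf S), D ^ (-(1 / α)) ≤ tailVal (2 / α) f t := by
      intro t ht
      have hz : 0 < tailVal (2 / α) f t :=
        mul_pos (Real.rpow_pos_of_pos (by linarith [ht.1]) _) (hpos t ht)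
      have h1 := h.tailVal_rpow_neg_le hα hη hg hpos hR ht
      rw [← hD] at h1
      have h2 := Real.rpow_le_rpow_of_nonpos (Real.rpow_pos_of_pos hz (-α)) h1
        (show -(1 / α) ≤ 0 by rw [neg_nonpos]; positivity)
      rw [← Real.rpow_mul hz.le] at h2
      have : -α * -(1 / α) = 1 := by field_simp
      rwa [this, Real.rpow_one] at h2
    have hD0 : 0 < D := by
      have h1 := h.tailVal_rpow_neg_le hα hη hg hpos hR ⟨le_rfl, hηT⟩
      rw [hD]
      refine lt_of_lt_of_le (Real.rpow_pos_of_pos ?_ _) h1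
      exact mul_pos (Real.rpow_pos_of_pos (by linarith) _) hf
    have hT0 : 0 < sInf S := by linarith
    have hcont : Tendsto (tailVal (2 / α) f) (𝓝[<] (sInf S)) (𝓝 (tailVal (2 / α) f (sInf S))) :=
      (h.hasDerivAt_tailVal (2 / α) hT0).continuousAt.continuousWithinAt
    have h5 : D ^ (-(1 / α)) ≤ tailVal (2 / α) f (sInf S) := by
      refine ge_of_tendsto hcont ?_
      filter_upwards [Ioo_mem_nhdsLT hηT] with t ht using hlow t ⟨ht.1.le, ht.2⟩
    have h6 : 0 < tailVal (2 / α) f (sInf S) := (Real.rpow_pos_of_pos hD0 _).trans_le h5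
    have h7 := pos_of_mul_pos_right h6 (Real.rpow_nonneg hT0.le _)
    exact absurd hT.2 (not_le.2 h7)
  refine ⟨hpos x hx, ?_⟩
  exact h.tailVal_rpow_neg_le hα hη hg (T := x + 1) (fun t ht => hpos t ht.1) hR ⟨hx, by linarith⟩

end IsProfile

/-- On the boundary of the overdamped region the first term is the inverse of a multiple of η⁴,
while the exponential tends to 1, so the two terms 1/C cancel in the limit. -/
theorem tendsto_creepBound {α : ℝ} (hα : 0 < α) :
    Tendsto (fun η => creepBound α η (creepRatio α * η ^ 2)) atTop (𝓝 0) := by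
  have hr := creepRatio_pos hα
  have h2 : Tendsto (fun η : ℝ => η ^ 2) atTop atTop := tendsto_pow_atTop two_ne_zero
  have h1 : Tendsto (fun η : ℝ => (η ^ 2 * (creepRatio α * η ^ 2))⁻¹) atTop (𝓝 0) :=
    (h2.atTop_mul_atTop₀ (h2.const_mul_atTop hr)).inv_tendsto_atTop
  have h3 : Tendsto (fun η : ℝ => Real.exp (2 * α * tailCoeff α / η ^ 2)) atTop (𝓝 1) := by
    have := (Real.continuous_exp.tendsto 0).comp (h2.const_div_atTop (2 * α * tailCoeff α))
    simpa [Function.comp_def] using this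
  have := ((h1.add_const (1 / tailCoeff α)).mul h3).sub_const (1 / tailCoeff α)
  simpa [creepBound] using this

/-- Tails which leave the boundary of the overdamped region far out are large. -/
theorem exists_creep_large {α : ℝ} (hα : 0 < α) (m : ℝ) :
    ∃ X, creepStart α ≤ X ∧ ∀ f g η, IsProfile α 1 f g → X ≤ η → g η = 0 → 0 < f η →
      f η ^ α = creepRatio α * η ^ 2 → ∀ x, η ≤ x → m ≤ tailVal (2 / α) f x := by
  have hm : 0 < |m| + 1 := by positivity
  have h := (tendsto_creepBound hα).eventually (gt_mem_nhds (Real.rpow_pos_of_pos hm (-α)))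
  obtain ⟨X, hX⟩ := eventually_atTop.1 h
  refine ⟨max X (creepStart α), le_max_right _ _, fun f g η hfg hη hg hf hR x hx => ?_⟩
  have hηc : creepStart α ≤ η := (le_max_right _ _).trans hη
  have h1 := hX η ((le_max_left _ _).trans hη)
  obtain ⟨hfx, h2⟩ := hfg.overdamped hα hηc hg hf hR.le hx
  rw [hR] at h2
  have hx0 : 0 < x := by linarith [one_le_creepStart hα]
  have hz : 0 < tailVal (2 / α) f x := mul_pos (Real.rpow_pos_of_pos hx0 _) hfx
  by_contra hcon
  push Not at hcon
  have h3 : tailVal (2 / α) f x ≤ |m| + 1 := by linarith [le_abs_self m]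
  have h4 := Real.rpow_le_rpow_of_nonpos hz h3 (neg_nonpos.2 hα.le)
  linarith

end Creep
end
end NLHE
namespace NLHE
noncomputable section

/-! ### Phase-plane angle and the counting of zeros. -/

section Angle

/-- With r² = F² + G², the expression B = F sin θ + G cos θ satisfies B' = (r'/r) B, so B²/r² is
constant and vanishes as it does at 0. This avoids any lifting argument for the polar angle. -/
theorem mul_sin_add_mul_cos_eq_zero {F G F' G' θ : ℝ → ℝ} (hF : ∀ x, HasDerivAt F (F' x) x)
    (hG : ∀ x, HasDerivAt G (G' x) x) (hS : ∀ x, 0 < F x ^ 2 + G x ^ 2)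
    (hθ : ∀ x, HasDerivAt θ ((F' x * G x - F x * G' x) / (F x ^ 2 + G x ^ 2)) x)
    (h0 : F 0 * Real.sin (θ 0) + G 0 * Real.cos (θ 0) = 0) (x : ℝ) :
    F x * Real.sin (θ x) + G x * Real.cos (θ x) = 0 := by
  have hB : ∀ x, HasDerivAt (fun x => F x * Real.sin (θ x) + G x * Real.cos (θ x))
      ((F x * F' x + G x * G' x) / (F x ^ 2 + G x ^ 2) *
        (F x * Real.sin (θ x) + G x * Real.cos (θ x))) x := by
    intro x
    refine (((hF x).mul (hθ x).sin).add ((hG x).mul (hθ x).cos)).congr_deriv ?_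
    have := (hS x).ne'
    field_simp
    ring
  have hQ : ∀ x, HasDerivAt (fun x => (F x * Real.sin (θ x) + G x * Real.cos (θ x)) ^ 2 /
      (F x ^ 2 + G x ^ 2)) 0 x := by
    intro x
    refine (((hB x).pow 2).div (((hF x).pow 2).add ((hG x).pow 2)) (hS x).ne').congr_deriv ?_
    have := (hS x).ne'
    simp
    field_simp
    ring_nf
    tauto
  have hc := is_const_of_deriv_eq_zero (fun x => (hQ x).differentiableAt) (fun x => (hQ x).deriv) x 0
  simp only [h0, ne_eq, OfNat.ofNat_ne_zero, not_false_eq_true, zero_pow, zero_div] at hc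
  rcases div_eq_zero_iff.1 hc with h | h
  · exact pow_eq_zero_iff two_ne_zero |>.1 h
  · exact absurd h (hS x).ne'

theorem le_of_crossing {θ θ' : ℝ → ℝ} (hθ : ∀ x, HasDerivAt θ (θ' x) x) {c : ℝ}
    (hc : ∀ x, θ x = c → 0 < θ' x) {x y : ℝ} (hxy : x ≤ y) (h : c ≤ θ x) : c ≤ θ y :=
  image_le_of_deriv_right_lt_deriv_boundary' (a := x) (b := y) (f := fun _ => c) (f' := fun _ => 0)
    continuousOn_const (fun _ _ => hasDerivWithinAt_const _ _ _) h
    (fun t _ => (hθ t).continuousAt.continuousWithinAt) (fun t _ => (hθ t).hasDerivWithinAt)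
    (fun t _ ht => hc t ht.symm) ⟨hxy, le_rfl⟩

/-- If θ took the value c at y, its positive derivative there would put it below c just before y,
against the weak inequality. -/
theorem lt_of_crossing {θ θ' : ℝ → ℝ} (hθ : ∀ x, HasDerivAt θ (θ' x) x) {c : ℝ}
    (hc : ∀ x, θ x = c → 0 < θ' x) {x y : ℝ} (hxy : x < y) (h : c ≤ θ x) : c < θ y := by
  refine lt_of_le_of_ne (le_of_crossing hθ hc hxy.le h) fun he => ?_
  have h1 := hasDerivAt_iff_tendsto_slope.1 (hθ y)
  have h2 : ∀ᶠ t in 𝓝[<] y, 0 < slope θ y t :=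
    (h1.mono_left (nhdsWithin_mono _ fun t (ht : t < y) => ht.ne)).eventually
      (lt_mem_nhds (hc y he.symm))
  obtain ⟨t, ht, htx⟩ := (h2.and (Ioo_mem_nhdsLT hxy)).exists
  have h3 := le_of_crossing hθ hc htx.1.le h
  rw [slope_def_field] at ht
  have h4 : θ t - θ y < 0 := by
    by_contra hcon
    push Not at hcon
    exact absurd ht (not_lt.2 (div_nonpos_of_nonneg_of_nonpos hcon (by linarith [htx.2])))
  linarith

theorem IsProfile.ne_zero_of_data {α : ℝ} {f g : ℝ → ℝ} (hα : 0 < α) (h : IsProfile α 1 f g)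
    (h0 : f 0 ≠ 0 ∨ g 0 ≠ 0) (x : ℝ) : f x ≠ 0 ∨ g x ≠ 0 := by
  rcases le_total 0 x with hx | hx
  · exact h.ne_zero hα h0 hx
  · have := h.reflect.ne_zero hα (by simpa using h0) (x := -x) (by linarith)
    simpa using this

/-- The rotation speed of `(k f, g)`, `g = f'`, in the phase plane. -/
def angleRate (α k : ℝ) (f g : ℝ → ℝ) (x : ℝ) : ℝ :=
  k * (g x ^ 2 + f x * (x / 2 * g x + f x / α + nonlin α (f x))) / ((k * f x) ^ 2 + g x ^ 2)

/-- A continuous determination, equal to `θ₀` at `0`, of minus the polar angle of `(k f, f')`. -/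
def angle (α k θ₀ : ℝ) (f g : ℝ → ℝ) (x : ℝ) : ℝ := θ₀ + ∫ t in (0 : ℝ)..x, angleRate α k f g t

@[simp] theorem angle_zero (α k θ₀ : ℝ) (f g : ℝ → ℝ) : angle α k θ₀ f g 0 = θ₀ := by simp [angle]

namespace IsProfile

variable {α k θ₀ : ℝ} {f g : ℝ → ℝ}

theorem angle_denom_pos (hα : 0 < α) (h : IsProfile α 1 f g) (h0 : f 0 ≠ 0 ∨ g 0 ≠ 0) (hk : 0 < k)
    (x : ℝ) : 0 < (k * f x) ^ 2 + g x ^ 2 := by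
  rcases h.ne_zero_of_data hα h0 x with h1 | h1
  · have : k * f x ≠ 0 := mul_ne_zero hk.ne' h1
    positivity
  · positivity

theorem continuous_angleRate (hα : 0 < α) (h : IsProfile α 1 f g) (h0 : f 0 ≠ 0 ∨ g 0 ≠ 0)
    (hk : 0 < k) : Continuous (angleRate α k f g) := by
  have hf := h.continuous_fst
  have hg := h.continuous_snd
  have hn := (continuous_nonlin hα).comp hf
  have hn' : Continuous fun x => nonlin α (f x) := hn
  unfold angleRate
  exact Continuous.div (by fun_prop) (by fun_prop) fun x => (h.angle_denom_pos hα h0 hk x).ne'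

theorem hasDerivAt_angle (hα : 0 < α) (h : IsProfile α 1 f g) (h0 : f 0 ≠ 0 ∨ g 0 ≠ 0)
    (hk : 0 < k) (x : ℝ) : HasDerivAt (angle α k θ₀ f g) (angleRate α k f g x) x := by
  have hc := h.continuous_angleRate hα h0 hk
  exact (intervalIntegral.integral_hasDerivAt_right (hc.intervalIntegrable _ _)
    (hc.stronglyMeasurableAtFilter _ _) hc.continuousAt).const_add θ₀

theorem mul_sin_angle_add (hα : 0 < α) (h : IsProfile α 1 f g) (h0 : f 0 ≠ 0 ∨ g 0 ≠ 0)
    (hk : 0 < k) (hθ : k * f 0 * Real.sin θ₀ + g 0 * Real.cos θ₀ = 0) (x : ℝ) :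
    k * f x * Real.sin (angle α k θ₀ f g x) + g x * Real.cos (angle α k θ₀ f g x) = 0 := by
  refine mul_sin_add_mul_cos_eq_zero (F := fun x => k * f x) (G := g)
    (fun x => (h.hasDerivAt_fst x).const_mul k) h.hasDerivAt_snd
    (fun x => h.angle_denom_pos hα h0 hk x) (fun x => ?_) (by simpa using hθ) x
  refine (h.hasDerivAt_angle hα h0 hk x).congr_deriv ?_
  rw [angleRate]
  congr 1
  ring

theorem fst_eq_zero_iff (hα : 0 < α) (h : IsProfile α 1 f g) (h0 : f 0 ≠ 0 ∨ g 0 ≠ 0)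
    (hk : 0 < k) (hθ : k * f 0 * Real.sin θ₀ + g 0 * Real.cos θ₀ = 0) (x : ℝ) :
    f x = 0 ↔ Real.cos (angle α k θ₀ f g x) = 0 := by
  have h1 := h.mul_sin_angle_add hα h0 hk hθ x
  constructor
  · intro hf
    rw [hf, mul_zero, zero_mul, zero_add] at h1
    exact (mul_eq_zero.1 h1).resolve_left ((h.ne_zero_of_data hα h0 x).resolve_left (not_not.2 hf))
  · intro hc
    rw [hc, mul_zero, add_zero] at h1
    have hs : Real.sin (angle α k θ₀ f g x) ≠ 0 := by
      intro hs
      have := Real.sin_sq_add_cos_sq (angle α k θ₀ f g x)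
      rw [hs, hc] at this
      norm_num at this
    exact (mul_eq_zero.1 ((mul_eq_zero.1 h1).resolve_right hs)).resolve_left hk.ne'

theorem snd_eq_zero_iff (hα : 0 < α) (h : IsProfile α 1 f g) (h0 : f 0 ≠ 0 ∨ g 0 ≠ 0)
    (hk : 0 < k) (hθ : k * f 0 * Real.sin θ₀ + g 0 * Real.cos θ₀ = 0) (x : ℝ) :
    g x = 0 ↔ Real.sin (angle α k θ₀ f g x) = 0 := by
  have h1 := h.mul_sin_angle_add hα h0 hk hθ x
  constructor
  · intro hg
    rw [hg, zero_mul, add_zero] at h1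
    exact (mul_eq_zero.1 h1).resolve_left
      (mul_ne_zero hk.ne' ((h.ne_zero_of_data hα h0 x).resolve_right (not_not.2 hg)))
  · intro hs
    rw [hs, mul_zero, zero_add] at h1
    have hc : Real.cos (angle α k θ₀ f g x) ≠ 0 := by
      intro hc
      have := Real.sin_sq_add_cos_sq (angle α k θ₀ f g x)
      rw [hs, hc] at this
      norm_num at this
    exact (mul_eq_zero.1 h1).resolve_right hc

/-- On either axis of the phase plane the cross term f f' disappears, and what remains has a fixed
sign because f(f/α + |f|^α f) > 0 for f ≠ 0. Between the axes the rotation may reverse. -/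
theorem angleRate_pos (hα : 0 < α) (h : IsProfile α 1 f g) (h0 : f 0 ≠ 0 ∨ g 0 ≠ 0)
    (hk : 0 < k) {x : ℝ} (hx : f x = 0 ∨ g x = 0) : 0 < angleRate α k f g x := by
  refine div_pos (mul_pos hk ?_) (h.angle_denom_pos hα h0 hk x)
  have hne := h.ne_zero_of_data hα h0 x
  rcases hx with hx | hx
  · have := hne.resolve_left (not_not.2 hx)
    rw [hx]
    simp only [zero_mul, add_zero]
    positivity
  · have hf := hne.resolve_right (not_not.2 hx)
    have h1 : 0 ≤ nonlin α (f x) * f x := by rw [nonlin_mul_self]; positivity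
    have h2 : 0 < f x ^ 2 / α := by positivity
    rw [hx]
    have : (0 : ℝ) ^ 2 + f x * (x / 2 * 0 + f x / α + nonlin α (f x))
      = f x ^ 2 / α + nonlin α (f x) * f x := by ring
    rw [this]
    positivity

/-- The angle crosses the multiples of `π/2` only upwards. -/
theorem lt_angle (hα : 0 < α) (h : IsProfile α 1 f g) (h0 : f 0 ≠ 0 ∨ g 0 ≠ 0)
    (hk : 0 < k) (hθ : k * f 0 * Real.sin θ₀ + g 0 * Real.cos θ₀ = 0) {c : ℝ}
    (hc : Real.sin c = 0 ∨ Real.cos c = 0) {x y : ℝ} (hxy : x < y)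
    (hx : c ≤ angle α k θ₀ f g x) : c < angle α k θ₀ f g y := by
  refine lt_of_crossing (fun t => h.hasDerivAt_angle hα h0 hk t) (fun t ht => ?_) hxy hx
  refine h.angleRate_pos hα h0 hk ?_
  rw [h.fst_eq_zero_iff hα h0 hk hθ, h.snd_eq_zero_iff hα h0 hk hθ, ht]
  exact hc.symm

theorem continuous_angle (hα : 0 < α) (h : IsProfile α 1 f g) (h0 : f 0 ≠ 0 ∨ g 0 ≠ 0)
    (hk : 0 < k) : Continuous (angle α k θ₀ f g) :=
  continuous_iff_continuousAt.2 fun x => (h.hasDerivAt_angle hα h0 hk x).continuousAt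

end IsProfile

/-- The values `jπ - π/2` of the angle at which the profile vanishes. -/
def level (j : ℕ) : ℝ := j * Real.pi - Real.pi / 2

theorem cos_level (j : ℕ) : Real.cos (level j) = 0 := by
  rw [level, Real.cos_sub_pi_div_two, Real.sin_nat_mul_pi]

theorem level_succ (j : ℕ) : level (j + 1) = level j + Real.pi := by
  unfold level; push_cast; ring

theorem level_strictMono : StrictMono level :=
  strictMono_nat_of_lt_succ fun j => by rw [level_succ]; linarith [Real.pi_pos]

theorem level_one_pos : 0 < level 1 := by unfold level; push_cast; linarith [Real.pi_pos]

theorem exists_level {y : ℝ} (hy : Real.cos y = 0) (h : level 0 < y) : ∃ j : ℕ, 1 ≤ j ∧ y = level j := by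
  obtain ⟨n, hn⟩ := Real.cos_eq_zero_iff.1 hy
  have hpi := Real.pi_pos
  have h1 : (-1 : ℝ) < n := by
    unfold level at h
    rw [hn] at h
    push_cast at h
    by_contra hcon
    push Not at hcon
    nlinarith
  have h2 : 0 ≤ n := by
    have : (-1 : ℤ) < n := by exact_mod_cast h1
    omega
  obtain ⟨m, rfl⟩ := Int.eq_ofNat_of_zero_le h2
  refine ⟨m + 1, by omega, ?_⟩
  rw [hn, level]
  push_cast
  ring

theorem level_succ_le {y : ℝ} {j : ℕ} (hy : Real.cos y = 0) (h : level j < y) : level (j + 1) ≤ y := by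
  obtain ⟨i, _, rfl⟩ := exists_level hy ((level_strictMono.monotone (Nat.zero_le j)).trans_lt h)
  exact level_strictMono.monotone (level_strictMono.lt_iff_lt.1 h)

/-- `θ₀ = 0` gives the even profiles, `θ₀ = -π/2` the odd ones. -/
def IsParityAngle (θ₀ : ℝ) : Prop := θ₀ = 0 ∨ θ₀ = -(Real.pi / 2)

namespace IsParityAngle

variable {θ₀ : ℝ}

theorem nonpos (h : IsParityAngle θ₀) : θ₀ ≤ 0 := by
  rcases h with rfl | rfl
  · exact le_rfl
  · linarith [Real.pi_pos]

theorem level_zero_le (h : IsParityAngle θ₀) : level 0 ≤ θ₀ := by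
  unfold level
  push_cast
  rcases h with rfl | rfl <;> linarith [Real.pi_pos]

theorem sin_mul_cos (h : IsParityAngle θ₀) : Real.sin θ₀ * Real.cos θ₀ = 0 := by
  rcases h with rfl | rfl <;> simp

end IsParityAngle

/-- A profile with data `a (cos θ₀, -sin θ₀)`, `a > 0`, at the origin. -/
structure IsParityProfile (α θ₀ a : ℝ) (f g : ℝ → ℝ) : Prop where
  pos : 0 < α
  parity : IsParityAngle θ₀
  amp_pos : 0 < a
  profile : IsProfile α 1 f g
  fst_zero : f 0 = a * Real.cos θ₀
  snd_zero : g 0 = -(a * Real.sin θ₀)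

namespace IsParityProfile

variable {α θ₀ a k : ℝ} {f g : ℝ → ℝ}

theorem data_ne (h : IsParityProfile α θ₀ a f g) : f 0 ≠ 0 ∨ g 0 ≠ 0 := by
  rw [h.fst_zero, h.snd_zero]
  have := h.amp_pos
  rcases h.parity with h | h <;> simp [h, this.ne']

theorem data_angle (h : IsParityProfile α θ₀ a f g) (k : ℝ) :
    k * f 0 * Real.sin θ₀ + g 0 * Real.cos θ₀ = 0 := by
  rw [h.fst_zero, h.snd_zero]
  linear_combination (k * a - a) * h.parity.sin_mul_cos

theorem fst_eq_zero_iff (h : IsParityProfile α θ₀ a f g) (hk : 0 < k) (x : ℝ) :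
    f x = 0 ↔ Real.cos (angle α k θ₀ f g x) = 0 :=
  h.profile.fst_eq_zero_iff h.pos h.data_ne hk (h.data_angle k) x

theorem snd_eq_zero_iff (h : IsParityProfile α θ₀ a f g) (hk : 0 < k) (x : ℝ) :
    g x = 0 ↔ Real.sin (angle α k θ₀ f g x) = 0 :=
  h.profile.snd_eq_zero_iff h.pos h.data_ne hk (h.data_angle k) x

theorem lt_angle (h : IsParityProfile α θ₀ a f g) (hk : 0 < k) {c : ℝ}
    (hc : Real.sin c = 0 ∨ Real.cos c = 0) {x y : ℝ} (hxy : x < y)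
    (hx : c ≤ angle α k θ₀ f g x) : c < angle α k θ₀ f g y :=
  h.profile.lt_angle h.pos h.data_ne hk (h.data_angle k) hc hxy hx

theorem continuous_angle (h : IsParityProfile α θ₀ a f g) (hk : 0 < k) :
    Continuous (angle α k θ₀ f g) := h.profile.continuous_angle h.pos h.data_ne hk

theorem level_zero_lt_angle (h : IsParityProfile α θ₀ a f g) (hk : 0 < k) {x : ℝ} (hx : 0 < x) :
    level 0 < angle α k θ₀ f g x :=
  h.lt_angle hk (Or.inr (cos_level 0)) hx (by simpa using h.parity.level_zero_le)

/-- A positive value of the angle that is attained later is attained on the way. -/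
theorem exists_angle_eq (h : IsParityProfile α θ₀ a f g) (hk : 0 < k) {c y : ℝ} (hc : 0 < c)
    (hy : 0 ≤ y) (hcy : c ≤ angle α k θ₀ f g y) : ∃ x, 0 < x ∧ x ≤ y ∧ angle α k θ₀ f g x = c := by
  obtain ⟨x, hx, hxc⟩ := intermediate_value_Icc hy (h.continuous_angle hk).continuousOn
    (show c ∈ Icc _ _ from ⟨by rw [angle_zero]; exact h.parity.nonpos.trans hc.le, hcy⟩)
  refine ⟨x, lt_of_le_of_ne hx.1 ?_, hx.2, hxc⟩
  rintro rfl
  rw [angle_zero] at hxc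
  linarith [h.parity.nonpos]

theorem level_pos {j : ℕ} (hj : 1 ≤ j) : 0 < level j :=
  level_one_pos.trans_le (level_strictMono.monotone hj)

/-- Angles with different weights reach the zero levels simultaneously. -/
theorem level_le_angle (h : IsParityProfile α θ₀ a f g) (hk : 0 < k) (j : ℕ) :
    ∀ y, 0 < y → level (j + 1) ≤ angle α k θ₀ f g y → level (j + 1) ≤ angle α 1 θ₀ f g y := by
  -- The zeros of f do not depend on the weight. Where the k-angle reaches a level, f vanishes, so
  -- the 1-angle is at a level too; being above level i, it is at least level i + 1, and it stays
  -- there.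
  have step : ∀ (i : ℕ) (y : ℝ), 0 < y → level i < angle α 1 θ₀ f g y → ∀ y', y ≤ y' →
      angle α k θ₀ f g y = level (i + 1) → level (i + 1) ≤ angle α 1 θ₀ f g y' := by
    intro i y hy hl y' hyy' he
    have hz : f y = 0 := (h.fst_eq_zero_iff hk y).2 (by rw [he, cos_level])
    have h1 := level_succ_le ((h.fst_eq_zero_iff one_pos y).1 hz) hl
    rcases hyy'.eq_or_lt with rfl | hlt
    · exact h1
    · exact (h.lt_angle one_pos (Or.inr (cos_level _)) hlt h1).le
  induction j with
  | zero =>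
    intro y hy hl
    obtain ⟨x, hx0, hxy, hx⟩ := h.exists_angle_eq hk (level_pos le_rfl) hy.le hl
    exact step 0 x hx0 (h.level_zero_lt_angle one_pos hx0) y hxy hx
  | succ j ih =>
    intro y hy hl
    obtain ⟨x, hx0, hxy, hx⟩ := h.exists_angle_eq hk (level_pos (by omega)) hy.le hl
    obtain ⟨w, hw0, hwx, hw⟩ := h.exists_angle_eq hk (c := level (j + 1)) (level_pos (by omega))
      hx0.le (by rw [hx]; exact level_strictMono.monotone (Nat.le_succ _))
    have hwx' : w < x := by
      refine lt_of_le_of_ne hwx ?_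
      rintro rfl
      rw [hw] at hx
      exact absurd (level_strictMono.injective hx) (by omega)
    have h1 := h.lt_angle one_pos (Or.inr (cos_level _)) hwx' (ih w hw0 hw.ge)
    exact step (j + 1) x hx0 h1 y hxy hx

/-- The number of positive zeros is the number of levels that are passed. -/
theorem encard_zeros (h : IsParityProfile α θ₀ a f g) {n : ℕ}
    (h1 : n = 0 ∨ ∃ x, 0 < x ∧ level n ≤ angle α 1 θ₀ f g x)
    (h2 : ∀ x, 0 < x → angle α 1 θ₀ f g x < level (n + 1)) :
    {x : ℝ | 0 < x ∧ f x = 0}.encard = n := by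
  set θ := angle α 1 θ₀ f g with hθ
  -- Since levels are crossed only upwards, the angle is injective on the zeros; its image consists
  -- of the levels 1 to n.
  have hinj : InjOn θ {x : ℝ | 0 < x ∧ f x = 0} := by
    have key : ∀ x y, f x = 0 → x < y → θ x < θ y := fun x y hfx hxy =>
      h.lt_angle one_pos (Or.inr ((h.fst_eq_zero_iff one_pos x).1 hfx)) hxy le_rfl
    intro x hx y hy hxy
    rcases lt_trichotomy x y with hlt | heq | hlt
    · exact absurd hxy (key x y hx.2 hlt).ne
    · exact heq
    · exact absurd hxy (key y x hy.2 hlt).ne'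
  have himg : θ '' {x : ℝ | 0 < x ∧ f x = 0} = level '' (Finset.Icc 1 n : Set ℕ) := by
    ext y
    constructor
    · rintro ⟨x, ⟨hx0, hfx⟩, rfl⟩
      obtain ⟨j, hj, hje⟩ := exists_level ((h.fst_eq_zero_iff one_pos x).1 hfx)
        (h.level_zero_lt_angle one_pos hx0)
      refine ⟨j, ?_, hje.symm⟩
      have := h2 x hx0
      rw [hθ, hje] at this
      have := level_strictMono.lt_iff_lt.1 this
      simp only [Finset.coe_Icc, mem_Icc]
      omega
    · rintro ⟨j, hj, rfl⟩
      simp only [Finset.coe_Icc, mem_Icc] at hj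
      obtain ⟨x, hx0, hx⟩ := h1.resolve_left (by omega)
      obtain ⟨w, hw0, -, hw⟩ := h.exists_angle_eq one_pos (level_pos hj.1) hx0.le
        ((level_strictMono.monotone hj.2).trans hx)
      exact ⟨w, ⟨hw0, (h.fst_eq_zero_iff one_pos w).2 (by rw [hw, cos_level])⟩, hw⟩
  rw [← hinj.encard_image, himg, level_strictMono.injective.encard_image, Set.encard_coe_eq_coe_finsetCard]
  simp

theorem energy_zero_ge (h : IsParityProfile α θ₀ a f g) :
    a ^ 2 / (2 * (α + 1)) ≤ energy α (f 0) (g 0) := by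
  have hα := h.pos
  have h1 := potential_nonneg hα a
  have h2 := potential_nonneg hα 0
  rw [energy, h.fst_zero, h.snd_zero]
  rcases h.parity with h | h
  · simp [h]
    have : a ^ 2 / (2 * (α + 1)) ≤ a ^ 2 / (2 * α) := by gcongr; linarith
    linarith
  · simp [h]
    have : a ^ 2 / (2 * (α + 1)) ≤ a ^ 2 / 2 := by
      apply div_le_div_of_nonneg_left (by positivity) (by positivity); linarith
    linarith

theorem energy_zero_le (h : IsParityProfile α θ₀ a f g) :
    energy α (f 0) (g 0) ≤ a ^ 2 / 2 + a ^ 2 / (2 * α) + potential α a := by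
  have hα := h.pos
  have h1 := potential_nonneg hα a
  have h2 : 0 ≤ a ^ 2 / 2 := by positivity
  have h3 : 0 ≤ a ^ 2 / (2 * α) := by positivity
  rw [energy, h.fst_zero, h.snd_zero]
  rcases h.parity with h | h
  · simp [h]; linarith
  · simp [h, potential, Real.zero_rpow (by linarith : α + 2 ≠ 0)]
    simp only [potential] at h1
    linarith

/-- If k|f| ≤ |f'|, the term f'² alone produces the speed. Otherwise the energy threshold forces
|f|^α ≥ k² + 1, and the nonlinear term produces it. -/
theorem angleRate_ge {α k x : ℝ} {f g : ℝ → ℝ} (hα : 0 < α) (hk : 1 ≤ k) (hx : x ∈ Icc (0 : ℝ) 1)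
    (hne : 0 < (k * f x) ^ 2 + g x ^ 2)
    (hE : (k ^ 2 / 2 + 1 / (2 * α) + (k ^ 2 + 1) / (α + 2)) * (k ^ 2 + 1) ^ (2 / α)
      < energy α (f x) (g x)) : k / 2 - 1 / 4 ≤ angleRate α k f g x := by
  have hk0 : 0 < k := by linarith
  obtain ⟨u, hu⟩ : ∃ u, u = f x := ⟨_, rfl⟩
  obtain ⟨v, hv⟩ : ∃ v, v = g x := ⟨_, rfl⟩
  rw [angleRate]
  rw [← hu, ← hv] at hne hE ⊢
  have hnu : nonlin α u * u = |u| ^ α * u ^ 2 := nonlin_mul_self α u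
  have hpu : 0 ≤ |u| ^ α := Real.rpow_nonneg (abs_nonneg u) α
  have huα : 0 ≤ u ^ 2 / α := by positivity
  have hxuv : -(|u| * |v| / 2) ≤ x / 2 * (u * v) := by
    have h1 : |x / 2 * (u * v)| ≤ |u| * |v| / 2 := by
      rw [abs_mul, abs_mul, abs_of_nonneg (by linarith [hx.1])]
      have : 0 ≤ |u| * |v| := by positivity
      nlinarith [hx.2]
    exact (abs_le.1 h1).1
  have hnum : v ^ 2 + |u| ^ α * u ^ 2 - |u| * |v| / 2 ≤ v ^ 2 + u * (x / 2 * v + u / α + nonlin α u) := by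
    have : u * (x / 2 * v + u / α + nonlin α u) = x / 2 * (u * v) + u ^ 2 / α + nonlin α u * u := by
      ring
    rw [this, hnu]
    linarith
  rw [le_div_iff₀ hne]
  refine le_trans ?_ (mul_le_mul_of_nonneg_left hnum hk0.le)
  rcases le_total (k * |u|) |v| with hc | hc
  · have h1 : (k * u) ^ 2 ≤ v ^ 2 := by
      rw [← sq_abs (k * u), ← sq_abs v, abs_mul, abs_of_pos hk0]; gcongr
    have h2 : k * (|u| * |v| / 2) ≤ v ^ 2 / 2 := by
      rw [← sq_abs v]; nlinarith [abs_nonneg v]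
    have h3 : 0 ≤ |u| ^ α * u ^ 2 := by positivity
    have h4 : (k / 2 - 1 / 4) * ((k * u) ^ 2 + v ^ 2) ≤ (k / 2 - 1 / 4) * (2 * v ^ 2) := by
      gcongr
      · linarith
      · linarith
    nlinarith
  · have hbig : k ^ 2 + 1 ≤ |u| ^ α := by
      by_contra hcon
      push Not at hcon
      refine absurd hE (not_lt.2 ?_)
      have hu1 : |u| ≤ (k ^ 2 + 1) ^ (1 / α) := by
        have := Real.rpow_le_rpow hpu hcon.le (show 0 ≤ 1 / α by positivity)
        rwa [← Real.rpow_mul (abs_nonneg u), mul_one_div_cancel hα.ne', Real.rpow_one] at this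
      have hu2 : u ^ 2 ≤ (k ^ 2 + 1) ^ (2 / α) := by
        have : (k ^ 2 + 1) ^ (2 / α) = ((k ^ 2 + 1) ^ (1 / α)) ^ 2 := by
          rw [← Real.rpow_mul_natCast (by positivity)]; congr 1; push_cast; ring
        rw [this, ← sq_abs u]
        gcongr
      have hv2 : v ^ 2 ≤ k ^ 2 * u ^ 2 := by
        rw [← sq_abs v, ← sq_abs u, ← mul_pow]; gcongr
      rw [energy, potential_eq hα]
      have e : v ^ 2 / 2 + u ^ 2 / (2 * α) + |u| ^ α * u ^ 2 / (α + 2) ≤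
          (k ^ 2 / 2 + 1 / (2 * α) + (k ^ 2 + 1) / (α + 2)) * u ^ 2 := by
        have h1 : |u| ^ α * u ^ 2 / (α + 2) ≤ (k ^ 2 + 1) * u ^ 2 / (α + 2) := by gcongr
        have h2 : (k ^ 2 / 2 + 1 / (2 * α) + (k ^ 2 + 1) / (α + 2)) * u ^ 2
          = k ^ 2 * u ^ 2 / 2 + u ^ 2 / (2 * α) + (k ^ 2 + 1) * u ^ 2 / (α + 2) := by ring
        rw [h2]
        linarith
      exact e.trans (by gcongr)
    have h1 : v ^ 2 ≤ k ^ 2 * u ^ 2 := by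
      rw [← sq_abs v, ← sq_abs u, ← mul_pow]; gcongr
    have h2 : |u| * |v| / 2 ≤ v ^ 2 + u ^ 2 / 16 := by
      rw [← sq_abs u, ← sq_abs v]; nlinarith [sq_nonneg (|v| - |u| / 4)]
    have h3 : (k ^ 2 + 1) * u ^ 2 ≤ |u| ^ α * u ^ 2 := by gcongr
    have h4 : (k / 2 - 1 / 4) * ((k * u) ^ 2 + v ^ 2) ≤ (k / 2 - 1 / 4) * (2 * (k ^ 2 * u ^ 2)) := by
      gcongr
      · linarith
      · linarith
    have h5 : (k / 2 - 1 / 4) * (2 * (k ^ 2 * u ^ 2)) ≤ k * (k ^ 2 * u ^ 2) := by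
      have : 0 ≤ k ^ 2 * u ^ 2 := by positivity
      nlinarith
    refine h4.trans (h5.trans ?_)
    gcongr
    nlinarith [sq_nonneg u]

/-- Profiles of large amplitude have many zeros. -/
theorem exists_level_lt (hα : 0 < α) (n : ℕ) : ∃ A, ∀ θ₀ a f g, IsParityProfile α θ₀ a f g → A ≤ a →
    level (n + 1) < angle α 1 θ₀ f g 2 := by
  -- With this k the total rotation k/2 - 1/4 over [0, 1] exceeds `level (n + 1) + π/2`, and π/2
  -- covers the smallest initial angle.
  set k := 2 * level (n + 1) + Real.pi + 2 with hk
  have hl : 0 < level (n + 1) := level_pos (by omega)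
  have hk1 : 1 ≤ k := by rw [hk]; linarith [Real.pi_pos]
  set E₁ := (k ^ 2 / 2 + 1 / (2 * α) + (k ^ 2 + 1) / (α + 2)) * (k ^ 2 + 1) ^ (2 / α) with hE₁
  have hE₁0 : 0 ≤ E₁ := by positivity
  -- The initial energy is at least a²/(2(α+1)) and loses at most a factor exp(1/2) on [0, 1], so it
  -- stays above `E₁` there.
  refine ⟨1 + 2 * (α + 1) * ((E₁ + 1) * Real.exp (1 / 2)), fun θ₀ a f g h ha => ?_⟩
  have he := Real.exp_pos (1 / 2)
  have hB : 0 ≤ 2 * (α + 1) * ((E₁ + 1) * Real.exp (1 / 2)) := by positivity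
  have hE0 : (E₁ + 1) * Real.exp (1 / 2) ≤ energy α (f 0) (g 0) := by
    refine le_trans ?_ h.energy_zero_ge
    rw [le_div_iff₀ (by positivity)]
    nlinarith
  have hE : ∀ x ∈ Icc (0 : ℝ) 1, E₁ < energy α (f x) (g x) := by
    intro x hx
    refine lt_of_lt_of_le ?_ (h.profile.energy_ge hα hx.1)
    have h1 : Real.exp (-(1 / 2)) ≤ Real.exp (-(x ^ 2 / 2)) := by
      apply Real.exp_le_exp.2
      have : x ^ 2 ≤ 1 := by nlinarith [hx.1, hx.2]
      linarith
    calc E₁ < E₁ + 1 := by linarith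
      _ = (E₁ + 1) * Real.exp (1 / 2) * Real.exp (-(1 / 2)) := by
        rw [mul_assoc, ← Real.exp_add]; simp
      _ ≤ _ := by gcongr; exact energy_nonneg hα _ _
  have hk0 : 0 < k := by linarith
  have hinc : θ₀ + (k / 2 - 1 / 4) ≤ angle α k θ₀ f g 1 := by
    rw [angle]
    have hc := h.profile.continuous_angleRate hα h.data_ne hk0
    have := intervalIntegral.integral_mono_on (μ := volume) (zero_le_one' ℝ)
      (intervalIntegrable_const (c := k / 2 - 1 / 4)) (hc.intervalIntegrable 0 1)
      (fun x hx => angleRate_ge hα hk1 hx (h.profile.angle_denom_pos hα h.data_ne hk0 x) (hE x hx))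
    simp only [intervalIntegral.integral_const, sub_zero, one_smul] at this
    linarith
  have hθ : -(Real.pi / 2) ≤ θ₀ := by
    have := h.parity.level_zero_le
    simpa [level] using this
  have h1 := h.level_le_angle hk0 n 1 one_pos (by linarith)
  exact h.lt_angle one_pos (Or.inr (cos_level _)) (by norm_num) h1

end IsParityProfile

end Angle
end
end NLHE
namespace NLHE
noncomputable section

/-! ### The limit of x^β f as a function of the profile. -/

section TailLimit

/-- The limit of `x^β f(x)` at infinity. -/
def tailLimit (β : ℝ) (f : ℝ → ℝ) : ℝ := limUnder atTop (tailVal β f)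

theorem tendsto_of_abs_sub_le_div_sq {z : ℝ → ℝ} {a K L : ℝ} (h : ∀ x, a ≤ x → |z x - L| ≤ K / x ^ 2) :
    Tendsto z atTop (𝓝 L) := by
  rw [tendsto_iff_dist_tendsto_zero]
  have h2 : Tendsto (fun x : ℝ => K / x ^ 2) atTop (𝓝 0) :=
    (tendsto_pow_atTop two_ne_zero).const_div_atTop K
  refine squeeze_zero' (Eventually.of_forall fun x => dist_nonneg) ?_ h2
  filter_upwards [eventually_ge_atTop a] with x hx using h x hx

theorem exists_tailLimit_bound {α κ : ℝ} (hα : 0 < α) (hκ : 0 ≤ κ) (hκ1 : κ ≤ 1) (B : ℝ)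
    (hB : 0 ≤ B) : ∃ K, 0 < K ∧ ∀ f g, IsProfile α κ f g → |f (tailStart α)| ≤ B →
      |g (tailStart α)| ≤ B → ∀ x, tailStart α ≤ x →
        |tailVal (2 / α) f x - tailLimit (2 / α) f| ≤ K / x ^ 2 ∧
        |tailSlope (2 / α) f g x| ≤ K / x ^ 2 := by
  obtain ⟨K, hK, h⟩ := exists_tail_bound hα hκ hκ1 B hB
  refine ⟨K, hK, fun f g hfg hf hg => ?_⟩
  obtain ⟨L, hL⟩ := h f g hfg hf hg
  have : tailLimit (2 / α) f = L := (tendsto_of_abs_sub_le_div_sq fun x hx => (hL x hx).1).limUnder_eq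
  rwa [this]

theorem IsProfile.exists_tailLimit_bound {α κ : ℝ} {f g : ℝ → ℝ} (hα : 0 < α) (hκ : 0 ≤ κ)
    (hκ1 : κ ≤ 1) (h : IsProfile α κ f g) : ∃ K, 0 < K ∧ ∀ x, tailStart α ≤ x →
        |tailVal (2 / α) f x - tailLimit (2 / α) f| ≤ K / x ^ 2 ∧
        |tailSlope (2 / α) f g x| ≤ K / x ^ 2 := by
  obtain ⟨K, hK, h'⟩ := NLHE.exists_tailLimit_bound hα hκ hκ1
    (max |f (tailStart α)| |g (tailStart α)|) (by positivity)
  exact ⟨K, hK, h' f g h (le_max_left _ _) (le_max_right _ _)⟩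

theorem IsProfile.tendsto_tailVal {α κ : ℝ} {f g : ℝ → ℝ} (hα : 0 < α) (hκ : 0 ≤ κ)
    (hκ1 : κ ≤ 1) (h : IsProfile α κ f g) :
    Tendsto (tailVal (2 / α) f) atTop (𝓝 (tailLimit (2 / α) f)) := by
  obtain ⟨K, -, hK⟩ := h.exists_tailLimit_bound hα hκ hκ1
  exact tendsto_of_abs_sub_le_div_sq fun x hx => (hK x hx).1

theorem IsProfile.tendsto_zero {α κ : ℝ} {f g : ℝ → ℝ} (hα : 0 < α) (hκ : 0 ≤ κ)
    (hκ1 : κ ≤ 1) (h : IsProfile α κ f g) : Tendsto f atTop (𝓝 0) := by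
  have h1 := (h.tendsto_tailVal hα hκ hκ1).mul
    (tendsto_rpow_neg_atTop (show 0 < 2 / α by positivity))
  rw [mul_zero] at h1
  refine h1.congr' ?_
  filter_upwards [eventually_gt_atTop 0] with x hx
  rw [tailVal, mul_right_comm, ← Real.rpow_add hx]
  simp

theorem tailVal_neg (β : ℝ) (f : ℝ → ℝ) (x : ℝ) :
    tailVal β (fun y => -f y) x = -tailVal β f x := by simp [tailVal]

theorem IsProfile.tailLimit_neg {α κ : ℝ} {f g : ℝ → ℝ} (hα : 0 < α) (hκ : 0 ≤ κ)
    (hκ1 : κ ≤ 1) (h : IsProfile α κ f g) :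
    tailLimit (2 / α) (fun x => -f x) = -tailLimit (2 / α) f := by
  refine ((h.tendsto_tailVal hα hκ hκ1).neg.congr fun x => ?_).limUnder_eq
  rw [tailVal_neg]

theorem le_of_rpow_neg_le {α z D : ℝ} (hα : 0 < α) (hz : 0 < z) (h : z ^ (-α) ≤ D) :
    D ^ (-(1 / α)) ≤ z := by
  have h2 := Real.rpow_le_rpow_of_nonpos (Real.rpow_pos_of_pos hz (-α)) h
    (show -(1 / α) ≤ 0 by rw [neg_nonpos]; positivity)
  rw [← Real.rpow_mul hz.le] at h2
  have : -α * -(1 / α) = 1 := by field_simp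
  rwa [this, Real.rpow_one] at h2

theorem IsProfile.ne_zero_of_overdamped {α η : ℝ} {f g : ℝ → ℝ} (hα : 0 < α)
    (h : IsProfile α 1 f g) (hη : creepStart α ≤ η) (hg : g η = 0) (hf : f η ≠ 0)
    (hR : |f η| ^ α ≤ creepRatio α * η ^ 2) :
    (∀ x, η ≤ x → f x ≠ 0) ∧ tailLimit (2 / α) f ≠ 0 := by
  have main : ∀ f g : ℝ → ℝ, IsProfile α 1 f g → g η = 0 → 0 < f η →
      f η ^ α ≤ creepRatio α * η ^ 2 →
      (∀ x, η ≤ x → f x ≠ 0) ∧ tailLimit (2 / α) f ≠ 0 := by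
    intro f g h hg hf hR
    have h1 := fun x hx => h.overdamped hα hη hg hf hR (x := x) hx
    have hη0 : 0 < η := by linarith [one_le_creepStart hα]
    refine ⟨fun x hx => (h1 x hx).1.ne', ?_⟩
    have hz : ∀ x, η ≤ x → 0 < tailVal (2 / α) f x := fun x hx =>
      mul_pos (Real.rpow_pos_of_pos (by linarith) _) (h1 x hx).1
    have hD : 0 < creepBound α η (f η ^ α) :=
      (Real.rpow_pos_of_pos (hz η le_rfl) _).trans_le (h1 η le_rfl).2
    have h2 : creepBound α η (f η ^ α) ^ (-(1 / α)) ≤ tailLimit (2 / α) f := by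
      refine ge_of_tendsto (h.tendsto_tailVal hα zero_le_one le_rfl) ?_
      filter_upwards [eventually_ge_atTop η] with x hx
      exact le_of_rpow_neg_le hα (hz x hx) (h1 x hx).2
    exact ((Real.rpow_pos_of_pos hD _).trans_le h2).ne'
  rcases lt_or_gt_of_ne hf with hneg | hpos
  · rw [abs_of_neg hneg] at hR
    have := main _ _ h.neg (by simp [hg]) (by simpa using hneg) hR
    rw [h.tailLimit_neg hα zero_le_one le_rfl] at this
    simpa using this
  · rw [abs_of_pos hpos] at hR
    exact main f g h hg hpos hR

theorem exists_abs_tailLimit_ge {α : ℝ} (hα : 0 < α) (m : ℝ) :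
    ∃ X, creepStart α ≤ X ∧ ∀ f g η, IsProfile α 1 f g → X ≤ η → g η = 0 → f η ≠ 0 →
      |f η| ^ α = creepRatio α * η ^ 2 → m ≤ |tailLimit (2 / α) f| := by
  obtain ⟨X, hX, h⟩ := exists_creep_large hα m
  have main : ∀ f g η, IsProfile α 1 f g → X ≤ η → g η = 0 → 0 < f η →
      f η ^ α = creepRatio α * η ^ 2 → m ≤ tailLimit (2 / α) f := by
    intro f g η hfg hη hg hf hR
    refine ge_of_tendsto (hfg.tendsto_tailVal hα zero_le_one le_rfl) ?_
    filter_upwards [eventually_ge_atTop η] with x hx using h f g η hfg hη hg hf hR x hx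
  refine ⟨X, hX, fun f g η hfg hη hg hf hR => ?_⟩
  rcases lt_or_gt_of_ne hf with hneg | hpos
  · rw [abs_of_neg hneg] at hR
    have := main _ _ η hfg.neg hη (by simp [hg]) (by simpa using hneg) hR
    rw [hfg.tailLimit_neg hα zero_le_one le_rfl] at this
    exact this.trans (neg_le_abs _)
  · rw [abs_of_pos hpos] at hR
    exact (main f g η hfg hη hg hpos hR).trans (le_abs_self _)

end TailLimit

/-! ### Shooting in the logarithm of the amplitude. -/

section Shooting

/-- A family of parity profiles, indexed by the logarithm of the amplitude. -/
structure IsShootingFamily (α θ₀ : ℝ) (F G : ℝ → ℝ → ℝ) : Prop where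
  member : ∀ s, IsParityProfile α θ₀ (Real.exp s) (F s) (G s)

theorem exists_isShootingFamily {α θ₀ : ℝ} (hα : 0 < α) (hθ : IsParityAngle θ₀) :
    ∃ F G, IsShootingFamily α θ₀ F G := by
  choose F G h using fun s => exists_profile hα (Real.exp s * Real.cos θ₀) (-(Real.exp s * Real.sin θ₀))
  exact ⟨F, G, ⟨fun s => ⟨hα, hθ, Real.exp_pos s, (h s).1, (h s).2.1, (h s).2.2⟩⟩⟩

namespace IsShootingFamily

variable {α θ₀ : ℝ} {F G : ℝ → ℝ → ℝ}

theorem alpha_pos (H : IsShootingFamily α θ₀ F G) : 0 < α := (H.member 0).pos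

theorem exists_energy_bound (H : IsShootingFamily α θ₀ F G) (s₁ : ℝ) :
    ∃ M, 0 < M ∧ ∀ s, s ≤ s₁ → (2 * α + 2) * energy α (F s 0) (G s 0) ≤ M ^ 2 := by
  have hα := H.alpha_pos
  set E := Real.exp s₁ ^ 2 / 2 + Real.exp s₁ ^ 2 / (2 * α) + potential α (Real.exp s₁) with hE
  have hE0 : 0 ≤ E := by have := potential_nonneg hα (Real.exp s₁); positivity
  have h1 : 0 ≤ (2 * α + 2) * E := by positivity
  refine ⟨1 + (2 * α + 2) * E, by positivity, fun s hs => ?_⟩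
  have he := Real.exp_le_exp.2 hs
  have h2 : energy α (F s 0) (G s 0) ≤ E := by
    refine (H.member s).energy_zero_le.trans ?_
    rw [hE]
    have : potential α (Real.exp s) ≤ potential α (Real.exp s₁) := by
      unfold potential
      rw [abs_of_pos (Real.exp_pos _), abs_of_pos (Real.exp_pos _)]
      gcongr
    gcongr
  have h3 : (2 * α + 2) * energy α (F s 0) (G s 0) ≤ (2 * α + 2) * E := by gcongr
  nlinarith

theorem exists_bound (H : IsShootingFamily α θ₀ F G) (s₁ : ℝ) :
    ∃ B, 0 < B ∧ ∀ s, s ≤ s₁ → ∀ x, |F s x| ≤ B ∧ |G s x| ≤ B := by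
  obtain ⟨M, hM, h⟩ := H.exists_energy_bound s₁
  exact ⟨M, hM, fun s hs x => (H.member s).profile.abs_le_of_energy_le H.alpha_pos hM.le (h s hs) x⟩

theorem continuous_data (H : IsShootingFamily α θ₀ F G) : Continuous fun s => (F s 0, G s 0) := by
  simp only [fun s => (H.member s).fst_zero, fun s => (H.member s).snd_zero]
  fun_prop

theorem dist_le_of_abs_le (H : IsShootingFamily α θ₀ F G) {M : ℝ} (hM : 0 ≤ M) {s s' : ℝ}
    (h : (2 * α + 2) * energy α (F s 0) (G s 0) ≤ M ^ 2)
    (h' : (2 * α + 2) * energy α (F s' 0) (G s' 0) ≤ M ^ 2) {T x : ℝ} (hx : |x| ≤ T) :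
    dist (F s x, G s x) (F s' x, G s' x) ≤ dist (F s 0, G s 0) (F s' 0, G s' 0) *
      Real.exp ((1 + T + 1 / α + (α + 1) * M ^ α) * T) := by
  have hα := H.alpha_pos
  have hT : 0 ≤ T := (abs_nonneg x).trans hx
  have hMα := Real.rpow_nonneg hM α
  have hmono : Real.exp ((1 + T + 1 / α + (α + 1) * M ^ α) * |x|) ≤
      Real.exp ((1 + T + 1 / α + (α + 1) * M ^ α) * T) := by
    apply Real.exp_le_exp.2; gcongr
  refine le_trans ?_ (mul_le_mul_of_nonneg_left hmono dist_nonneg)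
  rcases le_total 0 x with h0 | h0
  · rw [abs_of_nonneg h0] at hx ⊢
    exact (H.member s).profile.dist_le hα (H.member s').profile hM h h' x ⟨h0, hx⟩
  · rw [abs_of_nonpos h0] at hx ⊢
    have e : ∀ a b : ℝ, energy α a (-b) = energy α a b := fun a b => by simp [energy]
    have := (H.member s).profile.reflect.dist_le hα (H.member s').profile.reflect hM
      (by simpa [e] using h) (by simpa [e] using h') (-x) ⟨by linarith, hx⟩
    simpa [Prod.dist_eq, dist_neg_neg] using this

theorem continuous_pair (H : IsShootingFamily α θ₀ F G) :
    Continuous fun p : ℝ × ℝ => (F p.1 p.2, G p.1 p.2) := by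
  refine continuous_iff_continuousAt.2 fun ⟨s₀, x₀⟩ => ?_
  obtain ⟨M, hM, hE⟩ := H.exists_energy_bound (s₀ + 1)
  set C := Real.exp ((1 + (|x₀| + 1) + 1 / α + (α + 1) * M ^ α) * (|x₀| + 1)) with hC
  rw [ContinuousAt, tendsto_iff_dist_tendsto_zero]
  have h1 : Tendsto (fun p : ℝ × ℝ => dist (F p.1 0, G p.1 0) (F s₀ 0, G s₀ 0) * C
      + dist (F s₀ p.2, G s₀ p.2) (F s₀ x₀, G s₀ x₀)) (𝓝 (s₀, x₀)) (𝓝 0) := by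
    have c1 : Continuous fun p : ℝ × ℝ => (F p.1 0, G p.1 0) := H.continuous_data.comp continuous_fst
    have c2 : Continuous fun p : ℝ × ℝ => (F s₀ p.2, G s₀ p.2) :=
      ((H.member s₀).profile.continuous_fst.prodMk (H.member s₀).profile.continuous_snd).comp
        continuous_snd
    have c3 : Continuous fun p : ℝ × ℝ => dist (F p.1 0, G p.1 0) (F s₀ 0, G s₀ 0) * C
      + dist (F s₀ p.2, G s₀ p.2) (F s₀ x₀, G s₀ x₀) := by fun_prop
    have := c3.tendsto (s₀, x₀)
    simpa using this
  refine squeeze_zero' (Eventually.of_forall fun _ => dist_nonneg) ?_ h1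
  have hs : ∀ᶠ p : ℝ × ℝ in 𝓝 (s₀, x₀), p.1 < s₀ + 1 :=
    continuous_fst.continuousAt.eventually (gt_mem_nhds (by simp))
  have hx : ∀ᶠ p : ℝ × ℝ in 𝓝 (s₀, x₀), |p.2| < |x₀| + 1 :=
    (continuous_abs.comp continuous_snd).continuousAt.eventually (gt_mem_nhds (by simp))
  filter_upwards [hs, hx] with p hp1 hp2
  refine (dist_triangle _ (F s₀ p.2, G s₀ p.2) _).trans ?_
  gcongr
  exact H.dist_le_of_abs_le hM.le (hE _ hp1.le) (hE _ (by linarith)) hp2.le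

theorem continuous_angle (H : IsShootingFamily α θ₀ F G) :
    Continuous fun p : ℝ × ℝ => angle α 1 θ₀ (F p.1) (G p.1) p.2 := by
  have hF : Continuous fun p : ℝ × ℝ => F p.1 p.2 := H.continuous_pair.fst
  have hG : Continuous fun p : ℝ × ℝ => G p.1 p.2 := H.continuous_pair.snd
  have hn : Continuous fun p : ℝ × ℝ => nonlin α (F p.1 p.2) :=
    (continuous_nonlin H.alpha_pos).comp hF
  have hr : Continuous (Function.uncurry fun s x => angleRate α 1 (F s) (G s) x) := by
    simp only [Function.uncurry_def]
    unfold angleRate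
    refine Continuous.div (by fun_prop) (by fun_prop) fun p => ?_
    exact ((H.member p.1).profile.angle_denom_pos H.alpha_pos (H.member p.1).data_ne one_pos p.2).ne'
  unfold angle
  exact continuous_const.add (intervalIntegral.continuous_parametric_primitive_of_continuous hr)

theorem exists_tail_bound (H : IsShootingFamily α θ₀ F G) (s₁ : ℝ) :
    ∃ K, 0 < K ∧ ∀ s, s ≤ s₁ → ∀ x, tailStart α ≤ x →
      |tailVal (2 / α) (F s) x - tailLimit (2 / α) (F s)| ≤ K / x ^ 2 := by
  obtain ⟨B, hB, h⟩ := H.exists_bound s₁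
  obtain ⟨K, hK, h'⟩ := NLHE.exists_tailLimit_bound H.alpha_pos zero_le_one le_rfl B hB.le
  exact ⟨K, hK, fun s hs x hx => (h' _ _ (H.member s).profile (h s hs _).1 (h s hs _).2 x hx).1⟩

/-- The rate K/x² is the same for all parameters up to s₀ + 1, so the limit is locally a uniform
limit of continuous functions. -/
theorem continuous_tailLimit (H : IsShootingFamily α θ₀ F G) :
    Continuous fun s => tailLimit (2 / α) (F s) := by
  refine continuous_iff_continuousAt.2 fun s₀ => ?_
  obtain ⟨K, hK, h⟩ := H.exists_tail_bound (s₀ + 1)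
  have hlim : TendstoUniformlyOn (fun (x : ℝ) s => tailVal (2 / α) (F s) x)
      (fun s => tailLimit (2 / α) (F s)) atTop (Iio (s₀ + 1)) := by
    rw [Metric.tendstoUniformlyOn_iff]
    intro ε hε
    have h2 : Tendsto (fun x : ℝ => K / x ^ 2) atTop (𝓝 0) :=
      (tendsto_pow_atTop two_ne_zero).const_div_atTop K
    filter_upwards [eventually_ge_atTop (tailStart α), h2.eventually (gt_mem_nhds hε)] with x hx hxε
    intro s hs
    rw [dist_comm]
    exact (h s (mem_Iio.1 hs).le x hx).trans_lt hxε
  have hc : ∃ᶠ x : ℝ in atTop, ContinuousOn (fun s => tailVal (2 / α) (F s) x) (Iio (s₀ + 1)) := by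
    refine Eventually.frequently (Eventually.of_forall fun x => Continuous.continuousOn ?_)
    have : Continuous fun s => F s x := H.continuous_pair.fst.comp (by fun_prop : Continuous fun s => (s, x))
    unfold tailVal
    fun_prop
  exact (hlim.continuousOn hc).continuousAt (Iio_mem_nhds (by linarith))

/-- Parameters whose profile passes the zero level `j`. -/
def passing (α θ₀ : ℝ) (F G : ℝ → ℝ → ℝ) (j : ℕ) : Set ℝ :=
  {s | ∃ x, 0 < x ∧ level j < angle α 1 θ₀ (F s) (G s) x}

theorem isOpen_passing (H : IsShootingFamily α θ₀ F G) (j : ℕ) : IsOpen (passing α θ₀ F G j) := by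
  rw [isOpen_iff_mem_nhds]
  rintro s ⟨x, hx, h⟩
  have hc : Continuous fun s => angle α 1 θ₀ (F s) (G s) x :=
    H.continuous_angle.comp (by fun_prop : Continuous fun s : ℝ => (s, x))
  filter_upwards [hc.continuousAt.eventually (lt_mem_nhds h)] with s' hs' using ⟨x, hx, hs'⟩

theorem angle_lt_level (H : IsShootingFamily α θ₀ F G) {s : ℝ} {j : ℕ}
    (hs : s ∉ passing α θ₀ F G j) {x : ℝ} (hx : 0 < x) :
    angle α 1 θ₀ (F s) (G s) x < level j := by
  by_contra hcon
  push Not at hcon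
  exact hs ⟨x + 1, by linarith, (H.member s).lt_angle one_pos (Or.inr (cos_level j))
    (by linarith) hcon⟩

theorem passing_subset (j : ℕ) : passing α θ₀ F G (j + 1) ⊆ passing α θ₀ F G j := by
  rintro s ⟨x, hx, h⟩
  exact ⟨x, hx, (level_strictMono (Nat.lt_succ_self j)).trans h⟩

theorem exists_angle_eq_of_passing (H : IsShootingFamily α θ₀ F G) {s X c : ℝ} (hX : 0 < X)
    (hc : Real.sin c = 0 ∨ Real.cos c = 0)
    (h1 : angle α 1 θ₀ (F s) (G s) X < c) {x : ℝ} (h2 : c < angle α 1 θ₀ (F s) (G s) x) :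
    X < x ∧ ∃ y, X < y ∧ y < x ∧ angle α 1 θ₀ (F s) (G s) y = c := by
  have hXx : X < x := by
    by_contra hcon
    push Not at hcon
    rcases hcon.eq_or_lt with rfl | hlt
    · linarith
    · linarith [(H.member s).lt_angle one_pos hc hlt h2.le]
  refine ⟨hXx, ?_⟩
  obtain ⟨y, hy, hyc⟩ := intermediate_value_Ioo hXx.le
    ((H.member s).continuous_angle one_pos).continuousOn (show c ∈ Ioo _ _ from ⟨h1, h2⟩)
  exact ⟨y, hy.1, hy.2, hyc⟩

/-- The critical level between the zero levels `j` and `j + 1`. -/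
theorem sin_level_add (j : ℕ) : Real.sin (level j + Real.pi / 2) = 0 := by
  rw [level, sub_add_cancel, Real.sin_nat_mul_pi]

/-- To go from below level j at X past level j + 1, the angle must first meet level j + π/2 at some
η > X. That critical point lies in the overdamped region, because |f(η)| ≤ B, so no zero can follow
it. -/
theorem not_passing_succ (H : IsShootingFamily α θ₀ F G) {s X B : ℝ} {j : ℕ}
    (hX : creepStart α ≤ X) (hB : ∀ x, |F s x| ≤ B) (hBX : B ^ α ≤ creepRatio α * X ^ 2)
    (h : angle α 1 θ₀ (F s) (G s) X < level j) : s ∉ passing α θ₀ F G (j + 1) := by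
  have hα := H.alpha_pos
  have hX0 : 0 < X := by linarith [one_le_creepStart hα]
  have hpi := Real.pi_pos
  rintro ⟨x, hx0, hx⟩
  rw [level_succ] at hx
  obtain ⟨hXx, η, hη, hηx, hηe⟩ := H.exists_angle_eq_of_passing (s := s) hX0
    (c := level j + Real.pi / 2)
    (Or.inl (sin_level_add j)) (by linarith) (x := x) (by linarith)
  obtain ⟨-, y, hy, -, hye⟩ := H.exists_angle_eq_of_passing (s := s) (X := η) (by linarith)
    (c := level (j + 1)) (Or.inr (cos_level _)) (by rw [hηe, level_succ]; linarith) (x := x)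
    (by rw [level_succ]; exact hx)
  have hg : G s η = 0 := ((H.member s).snd_eq_zero_iff one_pos η).2 (by rw [hηe, sin_level_add])
  have hf : F s η ≠ 0 := ((H.member s).profile.ne_zero_of_data hα (H.member s).data_ne η).resolve_right
    (not_not.2 hg)
  have hr := creepRatio_pos hα
  have hR : |F s η| ^ α ≤ creepRatio α * η ^ 2 :=
    (Real.rpow_le_rpow (abs_nonneg _) (hB η) hα.le).trans (hBX.trans (by gcongr))
  have h1 := ((H.member s).profile.ne_zero_of_overdamped hα (hX.trans hη.le) hg hf hR).1 y hy.le
  exact h1 (((H.member s).fst_eq_zero_iff one_pos y).2 (by rw [hye, cos_level]))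

theorem exists_abscissa (hα : 0 < α) (B : ℝ) : ∃ X, creepStart α ≤ X ∧ B ^ α < creepRatio α * X ^ 2 := by
  have h := ((tendsto_pow_atTop (α := ℝ) two_ne_zero).const_mul_atTop (creepRatio_pos hα)).eventually_gt_atTop
    (B ^ α)
  exact ((eventually_ge_atTop (creepStart α)).and h).exists

/-- A single profile has finitely many zeros: beyond a suitable X at most one more level is reached.
-/
theorem exists_not_passing (H : IsShootingFamily α θ₀ F G) (s : ℝ) :
    ∃ n₀, ∀ n, n₀ ≤ n → s ∉ passing α θ₀ F G n := by
  obtain ⟨B, hB0, hB⟩ := H.exists_bound s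
  obtain ⟨X, hX, hBX⟩ := exists_abscissa H.alpha_pos B
  obtain ⟨j, hj⟩ := exists_nat_gt ((angle α 1 θ₀ (F s) (G s) X + Real.pi / 2) / Real.pi)
  rw [div_lt_iff₀ Real.pi_pos] at hj
  refine ⟨j + 1, fun n hn => ?_⟩
  obtain ⟨i, rfl⟩ : ∃ i, n = i + 1 := ⟨n - 1, by omega⟩
  refine H.not_passing_succ hX (fun x => (hB s le_rfl x).1) hBX.le ?_
  have : level j ≤ level i := level_strictMono.monotone (by omega)
  refine lt_of_lt_of_le ?_ this
  unfold level
  linarith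

/-- Under a small change of the parameter at most one zero can enter from infinity. -/
theorem eventually_not_passing_succ (H : IsShootingFamily α θ₀ F G) {s : ℝ} {j : ℕ}
    (hs : s ∉ passing α θ₀ F G j) : ∀ᶠ s' in 𝓝 s, s' ∉ passing α θ₀ F G (j + 1) := by
  obtain ⟨B, hB0, hB⟩ := H.exists_bound (s + 1)
  obtain ⟨X, hX, hBX⟩ := exists_abscissa H.alpha_pos B
  have hX0 : 0 < X := by linarith [one_le_creepStart H.alpha_pos]
  have hc : Continuous fun s => angle α 1 θ₀ (F s) (G s) X :=
    H.continuous_angle.comp (by fun_prop : Continuous fun s : ℝ => (s, X))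
  filter_upwards [hc.continuousAt.eventually (gt_mem_nhds (H.angle_lt_level hs hX0)),
    gt_mem_nhds (show s < s + 1 by linarith)] with s' h1 h2
  exact H.not_passing_succ hX (fun x => (hB s' h2.le x).1) hBX.le h1

/-- If L ≠ 0, no zero enters from infinity: at a far zero y of a nearby profile the tail estimate
would give |L| ≤ K/y², whereas |L| stays above half its value at s. -/
theorem eventually_not_passing (H : IsShootingFamily α θ₀ F G) {s : ℝ} {j : ℕ}
    (hs : s ∉ passing α θ₀ F G j) (hL : tailLimit (2 / α) (F s) ≠ 0) :
    ∀ᶠ s' in 𝓝 s, s' ∉ passing α θ₀ F G j := by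
  obtain ⟨K, hK, hb⟩ := H.exists_tail_bound (s + 1)
  have hL0 : 0 < |tailLimit (2 / α) (F s)| := abs_pos.2 hL
  have h2 : Tendsto (fun x : ℝ => K / x ^ 2) atTop (𝓝 0) :=
    (tendsto_pow_atTop two_ne_zero).const_div_atTop K
  obtain ⟨X, hX⟩ := eventually_atTop.1
    (h2.eventually (gt_mem_nhds (show 0 < |tailLimit (2 / α) (F s)| / 2 by positivity)))
  set Y := max X (tailStart α) with hY
  have hY0 : 0 < Y := (tailStart_pos H.alpha_pos).trans_le (le_max_right _ _)
  have hc : Continuous fun s => angle α 1 θ₀ (F s) (G s) Y :=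
    H.continuous_angle.comp (by fun_prop : Continuous fun s : ℝ => (s, Y))
  filter_upwards [hc.continuousAt.eventually (gt_mem_nhds (H.angle_lt_level hs hY0)),
    gt_mem_nhds (show s < s + 1 by linarith),
    H.continuous_tailLimit.abs.continuousAt.eventually
      (lt_mem_nhds (show |tailLimit (2 / α) (F s)| / 2 < |tailLimit (2 / α) (F s)| by linarith))]
    with s' h1 h2 h3
  rintro ⟨x, hx0, hx⟩
  obtain ⟨-, y, hy, -, hye⟩ := H.exists_angle_eq_of_passing hY0 (Or.inr (cos_level j)) h1 hx
  have hf : F s' y = 0 := ((H.member s').fst_eq_zero_iff one_pos y).2 (by rw [hye, cos_level])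
  have h4 := hb s' h2.le y ((le_max_right _ _).trans hy.le)
  rw [tailVal, hf, mul_zero, zero_sub, abs_neg] at h4
  linarith [hX y ((le_max_left _ _).trans hy.le)]

theorem exists_passing (H : IsShootingFamily α θ₀ F G) (n : ℕ) :
    ∃ S, ∀ s, S ≤ s → s ∈ passing α θ₀ F G n := by
  obtain ⟨A, hA⟩ := IsParityProfile.exists_level_lt H.alpha_pos n
  refine ⟨Real.log (max A 1), fun s hs => ?_⟩
  refine passing_subset n ⟨2, two_pos, hA _ _ _ _ (H.member s) ?_⟩
  have h1 : 0 < max A 1 := by positivity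
  calc A ≤ max A 1 := le_max_left _ _
    _ = Real.exp (Real.log (max A 1)) := (Real.exp_log h1).symm
    _ ≤ _ := Real.exp_le_exp.2 hs

/-- For large amplitudes, a critical point in the overdamped region is far out. -/
theorem exists_critical_ge (H : IsShootingFamily α θ₀ F G) (X : ℝ) :
    ∃ S, ∀ s, S ≤ s → ∀ η, 0 ≤ η → G s η = 0 → |F s η| ^ α ≤ creepRatio α * η ^ 2 → X ≤ η := by
  have hα := H.alpha_pos
  have hr := creepRatio_pos hα
  set Q := creepRatio α * X ^ 2 with hQ
  have hQ0 : 0 ≤ Q := by positivity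
  -- `E` bounds the energy at a critical point where |f|^α ≤ Q; the amplitude `A` keeps the energy
  -- on [0, X] above it.
  set E := (1 / (2 * α) + Q / (α + 2)) * Q ^ (2 / α) with hE
  have hE0 : 0 ≤ E := by positivity
  set A := 1 + 2 * (α + 1) * ((E + 1) * Real.exp (X ^ 2 / 2)) with hA
  have hA0 : 1 ≤ A := by
    have : 0 ≤ 2 * (α + 1) * ((E + 1) * Real.exp (X ^ 2 / 2)) := by positivity
    linarith
  refine ⟨Real.log A, fun s hs η hη hg hR => ?_⟩
  by_contra hcon
  push Not at hcon
  have h1 : A ≤ Real.exp s := by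
    rw [← Real.exp_log (show 0 < A by linarith)]; exact Real.exp_le_exp.2 hs
  have h2 := (H.member s).profile.energy_ge hα hη
  have h3 := (H.member s).energy_zero_ge
  have h4 : (E + 1) * Real.exp (X ^ 2 / 2) ≤ Real.exp s ^ 2 / (2 * (α + 1)) := by
    rw [le_div_iff₀ (by positivity)]
    nlinarith
  have h5 : Real.exp (-(X ^ 2 / 2)) ≤ Real.exp (-(η ^ 2 / 2)) := by
    apply Real.exp_le_exp.2
    have : η ^ 2 ≤ X ^ 2 := by gcongr
    linarith
  have h6 : E + 1 ≤ energy α (F s η) (G s η) := by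
    refine le_trans ?_ h2
    calc E + 1 = (E + 1) * Real.exp (X ^ 2 / 2) * Real.exp (-(X ^ 2 / 2)) := by
          rw [mul_assoc, ← Real.exp_add]; simp
      _ ≤ _ := by
        gcongr
        · exact energy_nonneg hα _ _
        · exact h4.trans h3
  have h7 : |F s η| ^ α ≤ Q := hR.trans (by rw [hQ]; gcongr)
  have h8 : |F s η| ≤ Q ^ (1 / α) := by
    have := Real.rpow_le_rpow (Real.rpow_nonneg (abs_nonneg _) _) h7 (show 0 ≤ 1 / α by positivity)
    rwa [← Real.rpow_mul (abs_nonneg _), mul_one_div_cancel hα.ne', Real.rpow_one] at this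
  have h9 : F s η ^ 2 ≤ Q ^ (2 / α) := by
    have : Q ^ (2 / α) = (Q ^ (1 / α)) ^ 2 := by
      rw [← Real.rpow_mul_natCast hQ0]; congr 1; push_cast; ring
    rw [this, ← sq_abs]
    gcongr
  have h10 : energy α (F s η) (G s η) ≤ E := by
    rw [energy, hg, potential_eq hα]
    calc (0 : ℝ) ^ 2 / 2 + F s η ^ 2 / (2 * α) + |F s η| ^ α * F s η ^ 2 / (α + 2)
        ≤ F s η ^ 2 / (2 * α) + Q * F s η ^ 2 / (α + 2) := by
          have : |F s η| ^ α * F s η ^ 2 / (α + 2) ≤ Q * F s η ^ 2 / (α + 2) := by gcongr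
          linarith
      _ = (1 / (2 * α) + Q / (α + 2)) * F s η ^ 2 := by ring
      _ ≤ E := by rw [hE]; gcongr
  linarith

/-- After its last zero a profile has a critical point. -/
theorem exists_critical (H : IsShootingFamily α θ₀ F G) {s : ℝ} {n : ℕ} (hn : 1 ≤ n)
    (hs : s ∈ passing α θ₀ F G n) : ∃ η, 0 < η ∧ angle α 1 θ₀ (F s) (G s) η = level n + Real.pi / 2 := by
  have hα := H.alpha_pos
  have hpi := Real.pi_pos
  obtain ⟨x₀, hx₀, h0⟩ := hs
  by_contra hcon
  push Not at hcon
  -- Without the critical point the angle would remain between level n and level n + π/2 for x > x₀.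
  -- There f f' > 0, so f² would increase strictly, although f tends to 0.
  have hlt : ∀ x, x₀ < x → angle α 1 θ₀ (F s) (G s) x < level n + Real.pi / 2 := by
    intro x hx
    by_contra hc
    push Not at hc
    obtain ⟨y, hy, -, hye⟩ := (H.member s).exists_angle_eq one_pos
      (by linarith [IsParityProfile.level_pos hn]) (hx₀.trans hx).le hc
    exact hcon y hy hye
  have hgt : ∀ x, x₀ < x → level n < angle α 1 θ₀ (F s) (G s) x := fun x hx =>
    (H.member s).lt_angle one_pos (Or.inr (cos_level n)) hx h0.le
  have hfg : ∀ x, x₀ < x → 0 < F s x * G s x := by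
    intro x hx
    set θ := angle α 1 θ₀ (F s) (G s) x with hθ
    have h1 : Real.sin (2 * θ) < 0 := by
      rw [← Real.sin_sub_nat_mul_two_pi (2 * θ) n]
      have a := hlt x hx
      have b := hgt x hx
      unfold level at a b
      exact Real.sin_neg_of_neg_of_neg_pi_lt (by linarith) (by linarith)
    rw [Real.sin_two_mul] at h1
    have h2 := (H.member s).profile.mul_sin_angle_add hα (H.member s).data_ne one_pos
      ((H.member s).data_angle 1) x
    rw [← hθ, one_mul] at h2
    have hc : Real.cos θ ≠ 0 := by intro hc; rw [hc] at h1; simp at h1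
    have hf : F s x ≠ 0 := by
      rwa [Ne, (H.member s).fst_eq_zero_iff one_pos x, ← hθ]
    have h3 : F s x * G s x * Real.cos θ ^ 2 = F s x ^ 2 * (-(Real.sin θ * Real.cos θ)) := by
      linear_combination F s x * Real.cos θ * h2
    have h4 : 0 < F s x * G s x * Real.cos θ ^ 2 := by
      rw [h3]
      have : 0 < F s x ^ 2 := by positivity
      exact mul_pos this (by linarith)
    exact pos_of_mul_pos_left h4 (sq_nonneg _)
  have hmono : StrictMonoOn (fun x => F s x ^ 2) (Ici x₀) := by
    refine strictMonoOn_of_deriv_pos (convex_Ici _)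
      (((H.member s).profile.continuous_fst.pow 2).continuousOn) fun x hx => ?_
    rw [interior_Ici, mem_Ioi] at hx
    have := (((H.member s).profile.hasDerivAt_fst x).pow 2).deriv
    have e : deriv (fun x => F s x ^ 2) x = 2 * (F s x * G s x) := by
      refine Eq.trans this ?_
      norm_num
      ring
    rw [e]
    linarith [hfg x hx]
  have ht : Tendsto (fun x => F s x ^ 2) atTop (𝓝 0) := by
    have := ((H.member s).profile.tendsto_zero hα zero_le_one le_rfl).pow 2
    simpa using this
  have h5 : F s (x₀ + 1) ^ 2 ≤ 0 := by
    refine ge_of_tendsto ht ?_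
    filter_upwards [eventually_ge_atTop (x₀ + 1)] with x hx
    exact hmono.monotoneOn (by simp) (by simp; linarith) hx
  have h6 : F s x₀ ^ 2 < F s (x₀ + 1) ^ 2 := hmono (by simp) (by simp) (by linarith)
  nlinarith [sq_nonneg (F s x₀)]

/-- Every large number of positive zeros is realized by two profiles whose tails have the
prescribed size. -/
theorem exists_two (H : IsShootingFamily α θ₀ F G) {m : ℝ} (hm : 0 < m) :
    ∃ n₀ : ℕ, ∀ n, n₀ ≤ n → ∃ s₁ s₂, s₁ < s₂ ∧ ∀ s, s = s₁ ∨ s = s₂ →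
      |tailLimit (2 / α) (F s)| = m ∧ {x : ℝ | 0 < x ∧ F s x = 0}.encard = n := by
  have hα := H.alpha_pos
  have hpi := Real.pi_pos
  -- The bound is taken at m + 1 in order to exceed m strictly in the intermediate value argument.
  obtain ⟨X, hXc, hX⟩ := exists_abs_tailLimit_ge hα (m + 1)
  obtain ⟨S, hS⟩ := H.exists_critical_ge X
  obtain ⟨n₀, hn₀⟩ := H.exists_not_passing S
  refine ⟨max n₀ 1, fun n hn => ?_⟩
  have hn1 : 1 ≤ n := (le_max_right _ _).trans hn
  set L : ℝ → ℝ := fun s => tailLimit (2 / α) (F s) with hL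
  have hLc : Continuous L := H.continuous_tailLimit
  set U := passing α θ₀ F G with hU
  set Θ : ℝ → ℝ → ℝ := fun s x => angle α 1 θ₀ (F s) (G s) x with hΘ
  -- the last parameter with fewer than `n` zeros
  obtain ⟨S₁, hS₁⟩ := H.exists_passing n
  have hbdd : BddAbove (U n)ᶜ := ⟨S₁, fun s hs => by
    by_contra hcon
    push Not at hcon
    exact hs (hS₁ s hcon.le)⟩
  -- For n ≥ n₀ the parameter S itself misses level n. Hence b ≥ S, so for every parameter used
  -- below an overdamped critical point lies beyond X.
  have hSn : S ∈ (U n)ᶜ := hn₀ n ((le_max_left _ _).trans hn)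
  set b := sSup (U n)ᶜ with hb
  have hbU : b ∉ U n := (H.isOpen_passing n).isClosed_compl.csSup_mem ⟨S, hSn⟩ hbdd
  have hSb : S ≤ b := le_csSup hbdd hSn
  have hgt : ∀ s, b < s → s ∈ U n := fun s hs => by
    by_contra hcon
    exact absurd (le_csSup hbdd hcon) (not_le.2 hs)
  -- Immediately to the right of b level n is passed, while at b it is not: a zero has entered from
  -- infinity.
  have hLb : L b = 0 := by
    by_contra hne
    have h1 := (H.eventually_not_passing hbU hne).filter_mono (nhdsWithin_le_nhds (s := Ioi b))
    obtain ⟨s, hs1, hs2⟩ := (h1.and self_mem_nhdsWithin).exists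
    exact hs1 (hgt s hs2)
  -- the first parameter after `b` where another zero appears
  set V := {s | b < s ∧ s ∈ U (n + 1)} with hV
  obtain ⟨S₂, hS₂⟩ := H.exists_passing (n + 1)
  have hVne : V.Nonempty :=
    ⟨max S₂ (b + 1), by simp, hS₂ _ (le_max_left _ _)⟩
  have hVb : BddBelow V := ⟨b, fun s hs => hs.1.le⟩
  set c := sInf V with hc
  -- Only one zero can enter at b, so level n + 1 is still not passed just after b.
  have hbc : b < c := by
    obtain ⟨l, u, ⟨hl, hu⟩, hlu⟩ := mem_nhds_iff_exists_Ioo_subset.1 (H.eventually_not_passing_succ hbU)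
    refine lt_of_lt_of_le hu (le_csInf hVne fun s hs => ?_)
    by_contra hcon
    push Not at hcon
    exact hlu ⟨hl.trans hs.1, hcon⟩ hs.2
  have hcU : c ∉ U (n + 1) := by
    intro hcon
    obtain ⟨l, u, ⟨hl, hu⟩, hlu⟩ := mem_nhds_iff_exists_Ioo_subset.1
      ((H.isOpen_passing (n + 1)).mem_nhds hcon)
    obtain ⟨s, hs1, hs2⟩ := exists_between (max_lt hl hbc)
    have : s ∈ V := ⟨(le_max_right _ _).trans_lt hs1,
      hlu ⟨(le_max_left _ _).trans_lt hs1, hs2.trans hu⟩⟩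
    exact absurd (csInf_le hVb this) (not_le.2 hs2)
  -- Parameters passing level n + 1 accumulate at c from the right, but c does not pass it.
  have hLcz : L c = 0 := by
    by_contra hne
    obtain ⟨l, u, ⟨hl, hu⟩, hlu⟩ := mem_nhds_iff_exists_Ioo_subset.1 (H.eventually_not_passing hcU hne)
    obtain ⟨s, hs, hsu⟩ := exists_lt_of_csInf_lt hVne hu
    exact hlu ⟨hl.trans_le (csInf_le hVb hs), hsu⟩ hs.2
  have hnot : ∀ s ∈ Ioc b c, s ∉ U (n + 1) := by
    intro s hs hsU
    rcases hs.2.eq_or_lt with rfl | hlt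
    · exact hcU hsU
    · exact absurd (csInf_le hVb ⟨hs.1, hsU⟩) (not_le.2 hlt)
  have hcount : ∀ s ∈ Ioc b c, {x : ℝ | 0 < x ∧ F s x = 0}.encard = n := by
    intro s hs
    refine (H.member s).encard_zeros (Or.inr ?_) fun x hx => H.angle_lt_level (hnot s hs) hx
    obtain ⟨x, hx, h⟩ := hgt s hs.1
    exact ⟨x, hx, h.le⟩
  -- the first critical point after the last zero
  have hex : ∀ s, ∃ η, s ∈ Ioc b c → 0 < η ∧ Θ s η = level n + Real.pi / 2 := by
    intro s
    by_cases hs : s ∈ Ioc b c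
    · obtain ⟨η, h⟩ := H.exists_critical hn1 (hgt s hs.1)
      exact ⟨η, fun _ => h⟩
    · exact ⟨0, fun h => absurd h hs⟩
  choose η hη using hex
  have hcross : ∀ s x y, x < y → level n + Real.pi / 2 ≤ Θ s x → level n + Real.pi / 2 < Θ s y :=
    fun s x y hxy h => (H.member s).lt_angle one_pos (Or.inl (sin_level_add n)) hxy h
  have hΘc : ∀ x, Continuous fun s => Θ s x := fun x =>
    H.continuous_angle.comp (by fun_prop : Continuous fun s : ℝ => (s, x))
  -- The angle meets the critical level exactly once, from below to above, so the sign of the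
  -- difference at a fixed y tells on which side of y the critical point lies, and this sign is
  -- stable in s.
  have hηc : ContinuousOn η (Ioc b c) := by
    intro s hs
    rw [ContinuousWithinAt, tendsto_order]
    constructor
    · intro y hy
      have h1 : Θ s y < level n + Real.pi / 2 := by
        by_contra hcon
        push Not at hcon
        exact absurd (hη s hs).2 (hcross s y _ hy hcon).ne'
      filter_upwards [nhdsWithin_le_nhds ((hΘc y).continuousAt.eventually (gt_mem_nhds h1)),
        self_mem_nhdsWithin] with t ht htI
      by_contra hcon
      push Not at hcon
      rcases hcon.eq_or_lt with he | hlt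
      · have := (hη t htI).2
        rw [he] at this
        exact absurd this ht.ne
      · exact absurd ht (not_lt.2 (hcross t _ _ hlt (hη t htI).2.ge).le)
    · intro y hy
      have h1 : level n + Real.pi / 2 < Θ s y := hcross s _ _ hy (hη s hs).2.ge
      filter_upwards [nhdsWithin_le_nhds ((hΘc y).continuousAt.eventually (lt_mem_nhds h1)),
        self_mem_nhdsWithin] with t ht htI
      by_contra hcon
      push Not at hcon
      rcases hcon.eq_or_lt with he | hlt
      · have := (hη t htI).2
        rw [← he] at this
        exact absurd this ht.ne'
      · exact absurd (hη t htI).2 (hcross t _ _ hlt ht.le).ne'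
  have hg : ∀ s ∈ Ioc b c, G s (η s) = 0 := fun s hs =>
    ((H.member s).snd_eq_zero_iff one_pos _).2 (by
      rw [show angle α 1 θ₀ (F s) (G s) (η s) = _ from (hη s hs).2, sin_level_add])
  have hf : ∀ s ∈ Ioc b c, F s (η s) ≠ 0 := fun s hs =>
    ((H.member s).profile.ne_zero_of_data hα (H.member s).data_ne _).resolve_right
      (not_not.2 (hg s hs))
  -- R ≤ 0 is the overdamped region. R(c) > 0 since an overdamped profile has L ≠ 0, and R < 0 near
  -- b since η escapes to infinity there.
  set R : ℝ → ℝ := fun s => |F s (η s)| ^ α - creepRatio α * η s ^ 2 with hR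
  have hRc : ContinuousOn R (Ioc b c) := by
    have h1 : ContinuousOn (fun s => F s (η s)) (Ioc b c) :=
      H.continuous_pair.fst.comp_continuousOn (continuousOn_id.prodMk hηc)
    exact (h1.abs.rpow_const fun s _ => Or.inr hα.le).sub ((hηc.pow 2).const_mul _)
  have hcI : c ∈ Ioc b c := ⟨hbc, le_rfl⟩
  have hRcpos : 0 < R c := by
    by_contra hcon
    push Not at hcon
    have h1 : |F c (η c)| ^ α ≤ creepRatio α * η c ^ 2 := by simp only [hR] at hcon; linarith
    have h2 := hS c (hSb.trans hbc.le) (η c) (hη c hcI).1.le (hg c hcI) h1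
    exact ((H.member c).profile.ne_zero_of_overdamped hα (hXc.trans h2) (hg c hcI) (hf c hcI) h1).2 hLcz
  obtain ⟨d, hd, hdR⟩ : ∃ d ∈ Ioo b c, R d < 0 := by
    obtain ⟨B, hB0, hB⟩ := H.exists_bound c
    obtain ⟨Y, hY, hBY⟩ := exists_abscissa hα B
    have hY0 : 0 < Y := by linarith [one_le_creepStart hα]
    -- At b the angle has not reached level n at Y, hence neither has it for s slightly above b; the
    -- critical point then lies beyond Y.
    have h1 : Θ b Y < level n := H.angle_lt_level hbU hY0
    have h2 := ((hΘc Y).continuousAt.eventually (gt_mem_nhds h1)).filter_mono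
      (nhdsWithin_le_nhds (s := Ioi b))
    obtain ⟨d, hd1, hd2⟩ := (h2.and (Ioo_mem_nhdsGT hbc)).exists
    refine ⟨d, hd2, ?_⟩
    have hdI : d ∈ Ioc b c := ⟨hd2.1, hd2.2.le⟩
    have hYη : Y < η d := by
      by_contra hcon
      push Not at hcon
      have h3 := (hη d hdI).2
      rcases hcon.eq_or_lt with he | hlt
      · rw [he] at h3; linarith
      · linarith [hcross d _ _ hlt h3.ge]
    have h4 : |F d (η d)| ^ α ≤ B ^ α :=
      Real.rpow_le_rpow (abs_nonneg _) (hB d hd2.2.le _).1 hα.le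
    have hr := creepRatio_pos hα
    have h5 : creepRatio α * Y ^ 2 ≤ creepRatio α * η d ^ 2 := by gcongr
    simp only [hR]
    linarith
  obtain ⟨e, he, heR⟩ := intermediate_value_Ioo hd.2.le
    (hRc.mono fun s hs => ⟨hd.1.trans_le hs.1, hs.2⟩) (show (0 : ℝ) ∈ Ioo _ _ from ⟨hdR, hRcpos⟩)
  have heI : e ∈ Ioc b c := ⟨hd.1.trans he.1, he.2.le⟩
  have heR' : |F e (η e)| ^ α = creepRatio α * η e ^ 2 := by simp only [hR] at heR; linarith
  have hLe : m + 1 ≤ |L e| := hX _ _ (η e) (H.member e).profile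
    (hS e (hSb.trans heI.1.le) (η e) (hη e heI).1.le (hg e heI) heR'.le) (hg e heI) (hf e heI) heR'
  -- |L| vanishes at b and c and is at least m + 1 at e, so it equals m once on each side of e.
  obtain ⟨s₁, hs₁, h₁⟩ := intermediate_value_Ioo heI.1.le hLc.abs.continuousOn
    (show m ∈ Ioo _ _ from ⟨by rw [hLb, abs_zero]; exact hm, by linarith⟩)
  obtain ⟨s₂, hs₂, h₂⟩ := intermediate_value_Ioo' he.2.le hLc.abs.continuousOn
    (show m ∈ Ioo _ _ from ⟨by rw [hLcz, abs_zero]; exact hm, by linarith⟩)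
  refine ⟨s₁, s₂, hs₁.2.trans hs₂.1, fun s hs => ?_⟩
  rcases hs with rfl | rfl
  · exact ⟨h₁, hcount _ ⟨hs₁.1, (hs₁.2.trans he.2).le⟩⟩
  · exact ⟨h₂, hcount _ ⟨heI.1.trans hs₂.1, hs₂.2.le⟩⟩

end IsShootingFamily
end Shooting
end
end NLHE
namespace NLHE
noncomputable section

/-! ### Polynomial weights and decay classes. -/

section Weight

/-- The polynomial weight `(1 + |x|)^(-γ)`. -/
def weight (γ x : ℝ) : ℝ := (1 + |x|) ^ (-γ)

theorem weight_pos (γ x : ℝ) : 0 < weight γ x :=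
  Real.rpow_pos_of_pos (by linarith [abs_nonneg x]) _

theorem weight_le_one {γ : ℝ} (hγ : 0 ≤ γ) (x : ℝ) : weight γ x ≤ 1 :=
  Real.rpow_le_one_of_one_le_of_nonpos (by linarith [abs_nonneg x]) (by linarith)

theorem continuous_weight (γ : ℝ) : Continuous (weight γ) := by
  unfold weight
  exact (continuous_const.add continuous_abs).rpow_const fun x =>
    Or.inl (add_pos_of_pos_of_nonneg one_pos (abs_nonneg x)).ne'

theorem memLp_weight {γ : ℝ} (hγ : 0 < γ) {r : ℝ≥0∞} (hr : ENNReal.ofReal (1 / γ) < r) :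
    MemLp (weight γ) r volume := by
  have hm : AEStronglyMeasurable (weight γ) volume := (continuous_weight γ).aestronglyMeasurable
  rcases eq_or_ne r ∞ with rfl | hrt
  · refine memLp_top_of_bound hm 1 (Eventually.of_forall fun x => ?_)
    rw [Real.norm_of_nonneg (weight_pos γ x).le]
    exact weight_le_one hγ.le x
  · have hr0 : r ≠ 0 := by rintro rfl; simp at hr
    rw [← integrable_norm_rpow_iff hm hr0 hrt]
    have h1 : 1 / γ < r.toReal := (ENNReal.ofReal_lt_iff_lt_toReal (by positivity) hrt).1 hr
    have h2 : (Module.finrank ℝ ℝ : ℝ) < γ * r.toReal := by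
      rw [Module.finrank_self, Nat.cast_one]
      rwa [div_lt_iff₀ hγ, mul_comm] at h1
    refine (integrable_one_add_norm (μ := volume) h2).congr (Eventually.of_forall fun x => ?_)
    simp only [Real.norm_of_nonneg (weight_pos γ x).le]
    simp only [weight]
    rw [Real.norm_eq_abs, ← Real.rpow_mul (by positivity)]
    congr 1
    ring

/-- For t in a compact subset of (0,∞) parabolic rescaling changes the weight only by a bounded
factor, so self-similar curves are measured with one fixed weight. -/
theorem weight_div_sqrt_le {γ : ℝ} (hγ : 0 ≤ γ) {a b t : ℝ} (ha : 0 < a) (ht : t ∈ Icc a b) (x : ℝ) :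
    weight γ (x / √t) ≤ (max 1 √b) ^ γ * weight γ x := by
  have ht0 : 0 < t := ha.trans_le ht.1
  have hs : 0 < √t := Real.sqrt_pos.2 ht0
  have hb : √t ≤ √b := Real.sqrt_le_sqrt ht.2
  have hm : 0 < max 1 √b := by positivity
  have hx : 0 < 1 + |x| := by positivity
  have hx' : 0 < 1 + |x / √t| := by positivity
  have h1 : 1 + |x| ≤ max 1 √b * (1 + |x / √t|) := by
    rw [abs_div, abs_of_pos hs, mul_add, mul_one]
    have : |x| ≤ max 1 √b * (|x| / √t) := by
      calc |x| = √t * (|x| / √t) := by field_simp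
        _ ≤ _ := by gcongr; exact hb.trans (le_max_right _ _)
    linarith [le_max_left 1 √b]
  unfold weight
  rw [Real.rpow_neg hx.le, Real.rpow_neg hx'.le, ← div_eq_mul_inv,
    inv_le_comm₀ (Real.rpow_pos_of_pos hx' _) (by positivity), inv_div,
    div_le_iff₀ (by positivity), mul_comm, ← Real.mul_rpow hm.le hx'.le]
  gcongr

/-- `F` is bounded by a multiple of the weight. -/
def HasDecay (γ : ℝ) (F : ℝ → ℝ) : Prop := ∃ C, 0 ≤ C ∧ ∀ x, |F x| ≤ C * weight γ x

namespace HasDecay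

variable {γ : ℝ} {F G : ℝ → ℝ}

theorem add (hF : HasDecay γ F) (hG : HasDecay γ G) : HasDecay γ fun x => F x + G x := by
  obtain ⟨C, hC, h⟩ := hF
  obtain ⟨D, hD, h'⟩ := hG
  refine ⟨C + D, by positivity, fun x => (abs_add_le _ _).trans ?_⟩
  rw [add_mul]
  exact add_le_add (h x) (h' x)

theorem const_mul (hF : HasDecay γ F) (c : ℝ) : HasDecay γ fun x => c * F x := by
  obtain ⟨C, hC, h⟩ := hF
  refine ⟨|c| * C, by positivity, fun x => ?_⟩
  rw [abs_mul, mul_assoc]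
  exact mul_le_mul_of_nonneg_left (h x) (abs_nonneg c)

theorem bdd_mul (hF : HasDecay γ F) {B : ℝ} (hG : ∀ x, |G x| ≤ B) : HasDecay γ fun x => G x * F x := by
  obtain ⟨C, hC, h⟩ := hF
  have hB : 0 ≤ B := (abs_nonneg _).trans (hG 0)
  refine ⟨B * C, by positivity, fun x => ?_⟩
  rw [abs_mul, mul_assoc]
  exact mul_le_mul (hG x) (h x) (abs_nonneg _) hB

theorem bounded (hγ : 0 ≤ γ) (hF : HasDecay γ F) : ∃ B, 0 ≤ B ∧ ∀ x, |F x| ≤ B := by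
  obtain ⟨C, hC, h⟩ := hF
  exact ⟨C, hC, fun x => (h x).trans (mul_le_of_le_one_right hC (weight_le_one hγ x))⟩

theorem of_abs_eq (hF : HasDecay γ F) (h : ∀ x, |G x| = |F x|) : HasDecay γ G := by
  obtain ⟨C, hC, h'⟩ := hF
  exact ⟨C, hC, fun x => (h x).trans_le (h' x)⟩

theorem congr (hF : HasDecay γ F) (h : ∀ x, G x = F x) : HasDecay γ G :=
  hF.of_abs_eq fun x => by rw [h x]

end HasDecay

theorem rpow_neg_le_weight {γ : ℝ} (hγ : 0 ≤ γ) {a x : ℝ} (ha : 0 < a) (hx : a ≤ |x|) :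
    |x| ^ (-γ) ≤ (1 + 1 / a) ^ γ * weight γ x := by
  have hx0 : 0 < |x| := ha.trans_le hx
  have h1 : 1 + |x| ≤ (1 + 1 / a) * |x| := by
    have : 1 ≤ 1 / a * |x| := by rw [one_div, ← div_eq_inv_mul, le_div_iff₀ ha]; linarith
    linarith
  have h2 : 0 < 1 + |x| := by positivity
  unfold weight
  rw [Real.rpow_neg hx0.le, Real.rpow_neg h2.le, ← div_eq_mul_inv,
    inv_le_comm₀ (by positivity) (by positivity), inv_div, div_le_iff₀ (by positivity), mul_comm,
    ← Real.mul_rpow (by positivity) hx0.le]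
  gcongr

theorem hasDecay_of_tail {γ : ℝ} (hγ : 0 ≤ γ) {F : ℝ → ℝ} (hF : Continuous F) {a C : ℝ} (ha : 0 < a)
    (hC : 0 ≤ C) (h : ∀ x, a ≤ x → |F x| ≤ C * x ^ (-γ)) (h' : ∀ x, a ≤ x → |F (-x)| ≤ C * x ^ (-γ)) :
    HasDecay γ F := by
  obtain ⟨B, hB⟩ := (isCompact_Icc (a := -a) (b := a)).exists_bound_of_continuousOn hF.continuousOn
  have hB0 : 0 ≤ B := (norm_nonneg _).trans (hB 0 ⟨by linarith, ha.le⟩)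
  refine ⟨B * (1 + a) ^ γ + C * (1 + 1 / a) ^ γ, by positivity, fun x => ?_⟩
  have hw := weight_pos γ x
  rw [add_mul]
  rcases le_total |x| a with hx | hx
  · have h1 : |F x| ≤ B := hB x (abs_le.1 hx)
    have h2 : 1 ≤ (1 + a) ^ γ * weight γ x := by
      have h3 : 0 < 1 + |x| := by positivity
      unfold weight
      rw [Real.rpow_neg h3.le, ← div_eq_mul_inv, le_div_iff₀ (by positivity), one_mul]
      gcongr
    have h4 : 0 ≤ C * (1 + 1 / a) ^ γ * weight γ x := by positivity
    rw [mul_assoc]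
    nlinarith
  · have h1 : |F x| ≤ C * |x| ^ (-γ) := by
      rcases le_total 0 x with h0 | h0
      · rw [abs_of_nonneg h0] at hx ⊢; exact h x hx
      · rw [abs_of_nonpos h0] at hx ⊢
        have := h' (-x) hx
        rwa [neg_neg] at this
    have h2 := rpow_neg_le_weight hγ ha hx
    have h4 : 0 ≤ B * (1 + a) ^ γ * weight γ x := by positivity
    have h5 : C * |x| ^ (-γ) ≤ C * ((1 + 1 / a) ^ γ * weight γ x) := by gcongr
    rw [← mul_assoc] at h5
    linarith

end Weight

/-! ### From weighted pointwise bounds to curves in L^r. -/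

section LpCurve

/-- A curve of functions which is locally Lipschitz in time with respect to a weight. -/
structure IsWeightedLipschitz (w : ℝ → ℝ) (v : ℝ → ℝ → ℝ) : Prop where
  cont : ∀ t, 0 < t → Continuous (v t)
  bound : ∀ t, 0 < t → ∃ C, 0 ≤ C ∧ ∀ x, |v t x| ≤ C * w x
  lip : ∀ a b, 0 < a → a ≤ b → ∃ C, 0 ≤ C ∧ ∀ s ∈ Icc a b, ∀ t ∈ Icc a b, ∀ x,
    |v t x - v s x| ≤ C * |t - s| * w x

/-- The curve in `L^r` defined by a curve of functions. -/
def toLpCurve (r : ℝ≥0∞) (v : ℝ → ℝ → ℝ) (t : ℝ) : Lp ℝ r (volume : Measure ℝ) :=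
  open Classical in if h : MemLp (v t) r volume then h.toLp (v t) else 0

theorem coeFn_toLpCurve {r : ℝ≥0∞} {v : ℝ → ℝ → ℝ} {t : ℝ} (h : MemLp (v t) r volume) :
    toLpCurve r v t =ᵐ[volume] v t := by
  rw [toLpCurve, dif_pos h]
  exact h.coeFn_toLp

namespace IsWeightedLipschitz

variable {w : ℝ → ℝ} {v v' : ℝ → ℝ → ℝ}

theorem sub (h : IsWeightedLipschitz w v) (h' : IsWeightedLipschitz w v') :
    IsWeightedLipschitz w fun t x => v t x - v' t x where
  cont t ht := (h.cont t ht).sub (h'.cont t ht)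
  bound t ht := by
    obtain ⟨C, hC, h1⟩ := h.bound t ht
    obtain ⟨D, hD, h2⟩ := h'.bound t ht
    refine ⟨C + D, by positivity, fun x => (abs_sub _ _).trans ?_⟩
    rw [add_mul]
    exact add_le_add (h1 x) (h2 x)
  lip a b ha hab := by
    obtain ⟨C, hC, h1⟩ := h.lip a b ha hab
    obtain ⟨D, hD, h2⟩ := h'.lip a b ha hab
    refine ⟨C + D, by positivity, fun s hs t ht x => ?_⟩
    have e : v t x - v' t x - (v s x - v' s x) = (v t x - v s x) - (v' t x - v' s x) := by ring
    rw [e, add_mul, add_mul]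
    exact (abs_sub _ _).trans (add_le_add (h1 s hs t ht x) (h2 s hs t ht x))

theorem congr (h : IsWeightedLipschitz w v) (hv : ∀ t, 0 < t → ∀ x, v' t x = v t x) :
    IsWeightedLipschitz w v' where
  cont t ht := by rw [funext (hv t ht)]; exact h.cont t ht
  bound t ht := by rw [funext (hv t ht)]; exact h.bound t ht
  lip a b ha hab := by
    obtain ⟨C, hC, h1⟩ := h.lip a b ha hab
    refine ⟨C, hC, fun s hs t ht x => ?_⟩
    rw [hv s (ha.trans_le hs.1), hv t (ha.trans_le ht.1)]
    exact h1 s hs t ht x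

variable {r : ℝ≥0∞}

theorem memLp (h : IsWeightedLipschitz w v) (hw : MemLp w r volume) {t : ℝ} (ht : 0 < t) :
    MemLp (v t) r volume := by
  obtain ⟨C, hC, h1⟩ := h.bound t ht
  refine hw.of_le_mul (h.cont t ht).aestronglyMeasurable (c := C) (Eventually.of_forall fun x => ?_)
  rw [Real.norm_eq_abs]
  exact (h1 x).trans (mul_le_mul_of_nonneg_left (le_abs_self _) hC)

theorem norm_sub_le [Fact (1 ≤ r)] (h : IsWeightedLipschitz w v) (hw : MemLp w r volume)
    {a b : ℝ} (ha : 0 < a) (hab : a ≤ b) :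
    ∃ C, 0 ≤ C ∧ ∀ s ∈ Icc a b, ∀ t ∈ Icc a b, ‖toLpCurve r v t - toLpCurve r v s‖ ≤ C * |t - s| := by
  obtain ⟨C, hC, h1⟩ := h.lip a b ha hab
  refine ⟨C * ‖hw.toLp w‖, by positivity, fun s hs t ht => ?_⟩
  have e : C * ‖hw.toLp w‖ * |t - s| = C * |t - s| * ‖hw.toLp w‖ := by ring
  rw [e]
  refine Lp.norm_le_mul_norm_of_ae_le_mul ?_
  filter_upwards [Lp.coeFn_sub (toLpCurve r v t) (toLpCurve r v s),
    coeFn_toLpCurve (h.memLp hw (ha.trans_le ht.1)), coeFn_toLpCurve (h.memLp hw (ha.trans_le hs.1)),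
    hw.coeFn_toLp] with x e1 e2 e3 e4
  rw [e1, Pi.sub_apply, e2, e3, e4, Real.norm_eq_abs]
  exact (h1 s hs t ht x).trans (mul_le_mul_of_nonneg_left (le_abs_self _) (by positivity))

theorem continuousOn_toLpCurve [Fact (1 ≤ r)] (h : IsWeightedLipschitz w v) (hw : MemLp w r volume) :
    ContinuousOn (toLpCurve r v) (Ioi 0) := by
  intro s hs
  have hs0 : 0 < s := hs
  obtain ⟨C, hC, h1⟩ := h.norm_sub_le hw (a := s / 2) (b := 2 * s) (by linarith) (by linarith)
  refine ContinuousAt.continuousWithinAt ?_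
  rw [ContinuousAt, tendsto_iff_norm_sub_tendsto_zero]
  have h2 : Tendsto (fun t => C * |t - s|) (𝓝 s) (𝓝 0) := by
    have : Continuous fun t => C * |t - s| := by fun_prop
    simpa using this.tendsto s
  refine squeeze_zero' (Eventually.of_forall fun _ => norm_nonneg _) ?_ h2
  filter_upwards [Icc_mem_nhds (show s / 2 < s by linarith) (show s < 2 * s by linarith)] with t ht
  exact h1 s ⟨by linarith, by linarith⟩ t ht

theorem continuousInLp [Fact (1 ≤ r)] (h : IsWeightedLipschitz w v) (hw : MemLp w r volume) :
    ContinuousInLp r v :=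
  ⟨toLpCurve r v, h.continuousOn_toLpCurve hw, fun _ ht => coeFn_toLpCurve (h.memLp hw ht)⟩

/-- As the time derivative is itself Lipschitz relative to the weight, the first order Taylor
remainder is at most C|t-s|² w pointwise, hence O(|t-s|²) in L^r. -/
theorem hasDerivAt_toLpCurve [Fact (1 ≤ r)] (h : IsWeightedLipschitz w v)
    (h' : IsWeightedLipschitz w v') (hw : MemLp w r volume) (hw0 : ∀ x, 0 ≤ w x)
    (hd : ∀ t, 0 < t → ∀ x, HasDerivAt (fun s => v s x) (v' t x) t) {s : ℝ} (hs0 : 0 < s) :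
    HasDerivAt (toLpCurve r v) (toLpCurve r v' s) s := by
  obtain ⟨C, hC, h1⟩ := h'.lip (s / 2) (2 * s) (by linarith) (by linarith)
  have key : ∀ t ∈ Icc (s / 2) (2 * s),
      ‖toLpCurve r v t - toLpCurve r v s - (t - s) • toLpCurve r v' s‖
        ≤ C * ‖hw.toLp w‖ * |t - s| ^ 2 := by
    intro t ht
    have ht0 : 0 < t := by linarith [ht.1]
    have e : C * ‖hw.toLp w‖ * |t - s| ^ 2 = C * |t - s| ^ 2 * ‖hw.toLp w‖ := by ring
    rw [e]
    refine Lp.norm_le_mul_norm_of_ae_le_mul ?_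
    filter_upwards [Lp.coeFn_sub (toLpCurve r v t - toLpCurve r v s) ((t - s) • toLpCurve r v' s),
      Lp.coeFn_sub (toLpCurve r v t) (toLpCurve r v s),
      Lp.coeFn_smul (t - s) (toLpCurve r v' s),
      coeFn_toLpCurve (h.memLp hw ht0), coeFn_toLpCurve (h.memLp hw hs0),
      coeFn_toLpCurve (h'.memLp hw hs0), hw.coeFn_toLp] with x e0 e1 e2 e3 e4 e5 e6
    rw [e0, Pi.sub_apply, e1, Pi.sub_apply, e2, Pi.smul_apply, e3, e4, e5, e6, smul_eq_mul]
    have hsub : uIcc s t ⊆ Icc (s / 2) (2 * s) :=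
      uIcc_subset_Icc ⟨by linarith, by linarith⟩ ht
    -- Subtracting τ v'(s) makes the function flat at s, so the mean value inequality gives the
    -- remainder with its second factor |t - s|.
    have hmv := Convex.norm_image_sub_le_of_norm_hasDerivWithin_le
      (f := fun τ => v τ x - τ * v' s x) (f' := fun τ => v' τ x - v' s x) (s := uIcc s t)
      (C := C * |t - s| * w x) (x := s) (y := t)
      (fun τ hτ => by
        have hτ0 : 0 < τ := by linarith [(hsub hτ).1]
        have := (hd τ hτ0 x).sub ((hasDerivAt_id τ).mul_const (v' s x))
        rw [one_mul] at this
        exact this.hasDerivWithinAt)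
      (fun τ hτ => by
        rw [Real.norm_eq_abs]
        refine (h1 s ⟨by linarith, by linarith⟩ τ (hsub hτ) x).trans ?_
        have : |τ - s| ≤ |t - s| := abs_sub_left_of_mem_uIcc hτ
        have := hw0 x
        gcongr)
      (convex_uIcc s t) left_mem_uIcc right_mem_uIcc
    have e7 : v t x - v s x - (t - s) * v' s x = v t x - t * v' s x - (v s x - s * v' s x) := by ring
    rw [e7]
    refine hmv.trans ?_
    rw [Real.norm_eq_abs, Real.norm_eq_abs, abs_of_nonneg (hw0 x)]
    apply le_of_eq
    ring
  rw [hasDerivAt_iff_isLittleO, Asymptotics.isLittleO_iff]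
  intro c hc
  set D := C * ‖hw.toLp w‖ with hD
  have hD0 : 0 ≤ D := by positivity
  have hsmall : ∀ᶠ t in 𝓝 s, D * |t - s| < c := by
    have : Continuous fun t => D * |t - s| := by fun_prop
    exact this.continuousAt.eventually (gt_mem_nhds (by simpa using hc))
  filter_upwards [Icc_mem_nhds (show s / 2 < s by linarith) (show s < 2 * s by linarith), hsmall]
    with t ht htc
  refine (key t ht).trans ?_
  rw [Real.norm_eq_abs, pow_two, ← mul_assoc]
  gcongr

theorem contDiffInLp [Fact (1 ≤ r)] (h : IsWeightedLipschitz w v)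
    (h' : IsWeightedLipschitz w v') (hw : MemLp w r volume) (hw0 : ∀ x, 0 ≤ w x)
    (hd : ∀ t, 0 < t → ∀ x, HasDerivAt (fun s => v s x) (v' t x) t) : ContDiffInLp r v := by
  refine ⟨toLpCurve r v, ?_, fun t ht => coeFn_toLpCurve (h.memLp hw ht)⟩
  have hder : ∀ t ∈ Ioi (0 : ℝ), HasDerivAt (toLpCurve r v) (toLpCurve r v' t) t := fun t ht =>
    h.hasDerivAt_toLpCurve h' hw hw0 hd ht
  rw [contDiffOn_one_iff_derivWithin (uniqueDiffOn_Ioi 0)]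
  refine ⟨fun t ht => (hder t ht).differentiableAt.differentiableWithinAt, ?_⟩
  refine (h'.continuousOn_toLpCurve hw).congr fun t ht => ?_
  exact (hder t ht).hasDerivWithinAt.derivWithin (uniqueDiffOn_Ioi 0 t ht)

end IsWeightedLipschitz

end LpCurve

/-! ### Self-similar functions and their derivatives. -/

section Scaled

/-- The self-similar function `t^c F(x/√t)`. -/
def scaled (c : ℝ) (F : ℝ → ℝ) (t x : ℝ) : ℝ := t ^ c * F (x / √t)

theorem hasDerivAt_div_sqrt {t : ℝ} (ht : 0 < t) (x : ℝ) :
    HasDerivAt (fun s => x / √s) (-(x / √t) / (2 * t)) t := by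
  have hs : 0 < √t := Real.sqrt_pos.2 ht
  refine ((hasDerivAt_const t x).div (Real.hasDerivAt_sqrt ht.ne') hs.ne').congr_deriv ?_
  have : √t ^ 2 = t := Real.sq_sqrt ht.le
  rw [this]
  field_simp
  ring

theorem hasDerivAt_scaled_time {c t x : ℝ} (ht : 0 < t) {F F' : ℝ → ℝ}
    (hF : ∀ ξ, HasDerivAt F (F' ξ) ξ) :
    HasDerivAt (fun s => scaled c F s x) (scaled (c - 1) (fun ξ => c * F ξ - ξ / 2 * F' ξ) t x) t := by
  have d1 := Real.hasDerivAt_rpow_const (p := c) (Or.inl ht.ne')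
  have d2 := (hF (x / √t)).comp t (hasDerivAt_div_sqrt ht x)
  refine (d1.mul d2).congr_deriv ?_
  have : t ^ c = t ^ (c - 1) * t := by rw [← Real.rpow_add_one ht.ne']; simp
  rw [scaled, this, Function.comp_apply]
  field_simp
  ring

theorem hasDerivAt_scaled_space {c t : ℝ} (ht : 0 < t) {F F' : ℝ → ℝ}
    (hF : ∀ ξ, HasDerivAt F (F' ξ) ξ) (x : ℝ) :
    HasDerivAt (scaled c F t) (scaled (c - 1 / 2) F' t x) x := by
  have d := ((hF (x / √t)).comp x ((hasDerivAt_id x).div_const √t)).const_mul (t ^ c)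
  refine d.congr_deriv ?_
  rw [scaled, Real.rpow_sub ht, ← Real.sqrt_eq_rpow]
  field_simp

/-- The time derivative is again self-similar, with profile cF - ξF'/2; this is where decay of ξF',
not merely of F', is needed. -/
theorem isWeightedLipschitz_scaled {γ : ℝ} (hγ : 0 ≤ γ) (c : ℝ) {F F' : ℝ → ℝ}
    (hF : ∀ ξ, HasDerivAt F (F' ξ) ξ) (h : HasDecay γ F) (h' : HasDecay γ fun ξ => ξ * F' ξ) :
    IsWeightedLipschitz (weight γ) (scaled c F) where
  cont t ht := by
    have : Continuous F := continuous_iff_continuousAt.2 fun ξ => (hF ξ).continuousAt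
    unfold scaled
    fun_prop
  bound t ht := by
    obtain ⟨C, hC, h⟩ := h
    refine ⟨t ^ c * (C * (max 1 √t) ^ γ), by positivity, fun x => ?_⟩
    rw [scaled, abs_mul, abs_of_pos (Real.rpow_pos_of_pos ht c), mul_assoc, mul_assoc]
    gcongr
    exact (h _).trans (mul_le_mul_of_nonneg_left (weight_div_sqrt_le hγ ht ⟨le_rfl, le_rfl⟩ x) hC)
  lip a b ha hab := by
    have h2 : HasDecay γ fun ξ => c * F ξ - ξ / 2 * F' ξ :=
      ((h.const_mul c).add (h'.const_mul (-1 / 2))).congr fun ξ => by ring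
    obtain ⟨C, hC, h2⟩ := h2
    obtain ⟨B, hB⟩ := (isCompact_Icc (a := a) (b := b)).exists_bound_of_continuousOn
      (f := fun t : ℝ => t ^ (c - 1)) (fun t ht =>
        (Real.continuousAt_rpow_const _ _ (Or.inl (ha.trans_le ht.1).ne')).continuousWithinAt)
    have hB0 : 0 ≤ B := (norm_nonneg _).trans (hB a ⟨le_rfl, hab⟩)
    refine ⟨B * (C * (max 1 √b) ^ γ), by positivity, fun s hs t ht x => ?_⟩
    have hmv := Convex.norm_image_sub_le_of_norm_hasDerivWithin_le
      (f := fun τ => scaled c F τ x) (s := Icc a b)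
      (C := B * (C * (max 1 √b) ^ γ) * weight γ x) (x := s) (y := t)
      (fun τ hτ => (hasDerivAt_scaled_time (ha.trans_le hτ.1) hF).hasDerivWithinAt)
      (fun τ hτ => by
        rw [scaled, norm_mul, mul_assoc, mul_assoc]
        refine mul_le_mul (hB τ hτ) ?_ (norm_nonneg _) hB0
        rw [Real.norm_eq_abs]
        exact (h2 _).trans (mul_le_mul_of_nonneg_left (weight_div_sqrt_le hγ ha hτ x) hC))
      (convex_Icc a b) hs ht
    rw [Real.norm_eq_abs, Real.norm_eq_abs] at hmv
    refine hmv.trans (le_of_eq ?_)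
    ring

end Scaled
end
end NLHE
namespace NLHE
noncomputable section

/-! ### Decay of profiles and of differences of profiles. -/

section ProfileDecay

variable {α κ : ℝ} {f g : ℝ → ℝ}

theorem abs_le_mul_rpow_neg {β x Y M : ℝ} (hx : 0 < x) (h : |x ^ β * Y| ≤ M) : |Y| ≤ M * x ^ (-β) := by
  have hp := Real.rpow_pos_of_pos hx β
  rw [abs_mul, abs_of_pos hp] at h
  rw [Real.rpow_neg hx.le, ← div_eq_mul_inv, le_div_iff₀ hp, mul_comm]
  exact h

theorem div_sq_le_self (hα : 0 < α) {K x : ℝ} (hK : 0 ≤ K) (hx : tailStart α ≤ x) : K / x ^ 2 ≤ K := by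
  have h1 := tailStart_pos hα
  have h2 := sixteen_le_tailStart_sq hα
  have h3 : tailStart α ^ 2 ≤ x ^ 2 := by gcongr
  rw [div_le_iff₀ (by linarith)]
  nlinarith

/-- The second derivative of a profile, as prescribed by the equation. -/
def profileRhs (α κ : ℝ) (f g : ℝ → ℝ) (x : ℝ) : ℝ := -(x / 2) * g x - f x / α - κ * nonlin α (f x)

/-- For the second derivative, x^β x² f'' equals -(x²/2) q - κ|z|^α z, which is bounded exactly
because q = O(x^(-2)). -/
theorem IsProfile.exists_tail_decay (hα : 0 < α) (hκ : 0 ≤ κ) (hκ1 : κ ≤ 1) (h : IsProfile α κ f g) :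
    ∃ M, 0 ≤ M ∧ ∀ x, tailStart α ≤ x → |f x| ≤ M * x ^ (-(2 / α)) ∧
      |x * g x| ≤ M * x ^ (-(2 / α)) ∧ |x ^ 2 * profileRhs α κ f g x| ≤ M * x ^ (-(2 / α)) := by
  obtain ⟨K, hK, hb⟩ := h.exists_tailLimit_bound hα hκ hκ1
  obtain ⟨A, hA⟩ : ∃ A, A = |tailLimit (2 / α) f| + K := ⟨_, rfl⟩
  have hA0 : 0 ≤ A := by rw [hA]; positivity
  obtain ⟨M, hM⟩ : ∃ M, M = A + (K + 2 / α * A) + (K / 2 + A ^ (α + 1)) := ⟨_, rfl⟩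
  have hAp : 0 ≤ A ^ (α + 1) := by positivity
  have hq : 0 ≤ 2 / α * A := by positivity
  refine ⟨M, by rw [hM]; positivity, fun x hx => ?_⟩
  have hx0 : 0 < x := (tailStart_pos hα).trans_le hx
  obtain ⟨hz, hs⟩ := hb x hx
  have hKx := div_sq_le_self hα hK.le hx
  have hz' : |tailVal (2 / α) f x| ≤ A := by
    have := abs_sub_abs_le_abs_sub (tailVal (2 / α) f x) (tailLimit (2 / α) f)
    rw [hA]; linarith
  refine ⟨abs_le_mul_rpow_neg hx0 (hz'.trans (by rw [hM]; linarith)), abs_le_mul_rpow_neg hx0 ?_,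
    abs_le_mul_rpow_neg hx0 ?_⟩
  · have e : x ^ (2 / α) * (x * g x) = tailSlope (2 / α) f g x - 2 / α * tailVal (2 / α) f x := by
      rw [tailSlope, tailVal, Real.rpow_add_one hx0.ne']; ring
    have h2 : |2 / α * tailVal (2 / α) f x| ≤ 2 / α * A := by
      rw [abs_mul, abs_of_pos (by positivity)]; gcongr
    rw [e, hM]
    linarith [abs_sub (tailSlope (2 / α) f g x) (2 / α * tailVal (2 / α) f x)]
  · have e : x ^ (2 / α) * (x ^ 2 * profileRhs α κ f g x)
        = -(x ^ 2 / 2 * tailSlope (2 / α) f g x) - κ * nonlin α (tailVal (2 / α) f x) := by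
      rw [tailSlope, tailVal, ← sq_mul_rpow_mul_nonlin hα hx0, profileRhs,
        Real.rpow_add_one hx0.ne']
      field_simp
      ring
    have h2 : |x ^ 2 / 2 * tailSlope (2 / α) f g x| ≤ K / 2 := by
      rw [abs_mul, abs_of_pos (by positivity)]
      calc x ^ 2 / 2 * _ ≤ x ^ 2 / 2 * (K / x ^ 2) := by gcongr
        _ = K / 2 := by field_simp
    have h3 : |κ * nonlin α (tailVal (2 / α) f x)| ≤ A ^ (α + 1) := by
      rw [abs_mul, abs_nonlin α _ hα, abs_of_nonneg hκ]
      have : |tailVal (2 / α) f x| ^ (α + 1) ≤ A ^ (α + 1) := by gcongr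
      have h0 : 0 ≤ |tailVal (2 / α) f x| ^ (α + 1) := by positivity
      nlinarith
    rw [e, hM]
    have := abs_sub (-(x ^ 2 / 2 * tailSlope (2 / α) f g x)) (κ * nonlin α (tailVal (2 / α) f x))
    rw [abs_neg] at this
    linarith

theorem IsProfile.continuous_profileRhs (hα : 0 < α) (h : IsProfile α κ f g) :
    Continuous (profileRhs α κ f g) := by
  have h1 := h.continuous_fst
  have h2 := h.continuous_snd
  have h3 := (continuous_nonlin hα).comp h1
  simp only [Function.comp_def] at h3
  unfold profileRhs
  fun_prop

theorem IsProfile.hasDecay (hα : 0 < α) (hκ : 0 ≤ κ) (hκ1 : κ ≤ 1) (h : IsProfile α κ f g) :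
    HasDecay (2 / α) f ∧ HasDecay (2 / α) (fun x => x * g x) ∧
      HasDecay (2 / α) (fun x => x ^ 2 * profileRhs α κ f g x) := by
  obtain ⟨M, hM, hb⟩ := h.exists_tail_decay hα hκ hκ1
  obtain ⟨M', hM', hb'⟩ := h.reflect.exists_tail_decay hα hκ hκ1
  have hβ : 0 ≤ 2 / α := by positivity
  have hT := tailStart_pos hα
  have c1 := h.continuous_fst
  have c2 := h.continuous_snd
  have c3 := h.continuous_profileRhs hα
  have key : ∀ F : ℝ → ℝ, Continuous F → (∀ x, tailStart α ≤ x → |F x| ≤ M * x ^ (-(2 / α))) →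
      (∀ x, tailStart α ≤ x → |F (-x)| ≤ M' * x ^ (-(2 / α))) → HasDecay (2 / α) F := by
    intro F hF h1 h2
    refine hasDecay_of_tail hβ hF hT (C := M + M') (by positivity) (fun x hx => ?_) (fun x hx => ?_)
    · have hp := Real.rpow_pos_of_pos (hT.trans_le hx) (-(2 / α))
      have := h1 x hx
      nlinarith
    · have hp := Real.rpow_pos_of_pos (hT.trans_le hx) (-(2 / α))
      have := h2 x hx
      nlinarith
  refine ⟨key f c1 (fun x hx => (hb x hx).1) (fun x hx => (hb' x hx).1),
    key _ (by fun_prop) (fun x hx => (hb x hx).2.1) (fun x hx => ?_),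
    key _ (by fun_prop) (fun x hx => (hb x hx).2.2) (fun x hx => ?_)⟩
  · have := (hb' x hx).2.1
    rwa [mul_neg, ← neg_mul] at this
  · have e : (-x) ^ 2 * profileRhs α κ f g (-x)
        = x ^ 2 * profileRhs α κ (fun x => f (-x)) (fun x => -g (-x)) x := by
      simp only [profileRhs]; ring
    rw [e]
    exact (hb' x hx).2.2

/-- Equal limits cancel and leave the error K/x² in z, a gain of two powers. The two values of κ may
differ: a nonlinear profile will be compared with that of the heat flow. -/
theorem IsProfile.exists_tail_decay_sub {κ' : ℝ} {φ ψ : ℝ → ℝ} (hα : 0 < α) (hκ : 0 ≤ κ)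
    (hκ1 : κ ≤ 1) (hκ' : 0 ≤ κ') (hκ1' : κ' ≤ 1) (h : IsProfile α κ f g) (h' : IsProfile α κ' φ ψ)
    (hL : tailLimit (2 / α) f = tailLimit (2 / α) φ) :
    ∃ M, 0 ≤ M ∧ ∀ x, tailStart α ≤ x → |f x - φ x| ≤ M * x ^ (-(2 / α + 2)) ∧
      |x * (g x - ψ x)| ≤ M * x ^ (-(2 / α + 2)) := by
  obtain ⟨K, hK, hb⟩ := h.exists_tailLimit_bound hα hκ hκ1
  obtain ⟨K', hK', hb'⟩ := h'.exists_tailLimit_bound hα hκ' hκ1'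
  obtain ⟨M, hM⟩ : ∃ M, M = (K + K') + 2 / α * (K + K') := ⟨_, rfl⟩
  refine ⟨M, by rw [hM]; positivity, fun x hx => ?_⟩
  have hx0 : 0 < x := (tailStart_pos hα).trans_le hx
  obtain ⟨hz, hs⟩ := hb x hx
  obtain ⟨hz', hs'⟩ := hb' x hx
  rw [← hL] at hz'
  have e0 : M * x ^ (-(2 / α + 2)) = M / x ^ 2 * x ^ (-(2 / α)) := by
    rw [show -(2 / α + 2) = -(2 / α) - (2 : ℕ) by push_cast; ring, Real.rpow_sub_natCast hx0.ne']
    ring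
  have e1 : M / x ^ 2 = (K / x ^ 2 + K' / x ^ 2) + 2 / α * (K / x ^ 2 + K' / x ^ 2) := by
    rw [hM]; ring
  have hd : |tailVal (2 / α) f x - tailVal (2 / α) φ x| ≤ K / x ^ 2 + K' / x ^ 2 := by
    have e : tailVal (2 / α) f x - tailVal (2 / α) φ x
      = (tailVal (2 / α) f x - tailLimit (2 / α) f) - (tailVal (2 / α) φ x - tailLimit (2 / α) f) := by
      ring
    rw [e]
    exact (abs_sub _ _).trans (add_le_add hz hz')
  have h0 : 0 ≤ 2 / α * (K / x ^ 2 + K' / x ^ 2) := by positivity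
  rw [e0, e1]
  refine ⟨abs_le_mul_rpow_neg hx0 ?_, abs_le_mul_rpow_neg hx0 ?_⟩
  · have e : x ^ (2 / α) * (f x - φ x) = tailVal (2 / α) f x - tailVal (2 / α) φ x := by
      simp only [tailVal]; ring
    rw [e]; linarith
  · have e : x ^ (2 / α) * (x * (g x - ψ x)) = (tailSlope (2 / α) f g x - tailSlope (2 / α) φ ψ x)
        - 2 / α * (tailVal (2 / α) f x - tailVal (2 / α) φ x) := by
      simp only [tailSlope, tailVal, Real.rpow_add_one hx0.ne']; ring
    have h2 : |2 / α * (tailVal (2 / α) f x - tailVal (2 / α) φ x)|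
        ≤ 2 / α * (K / x ^ 2 + K' / x ^ 2) := by
      rw [abs_mul, abs_of_pos (by positivity)]; gcongr
    rw [e]
    have h3 := abs_sub (tailSlope (2 / α) f g x - tailSlope (2 / α) φ ψ x)
      (2 / α * (tailVal (2 / α) f x - tailVal (2 / α) φ x))
    have h4 := abs_sub (tailSlope (2 / α) f g x) (tailSlope (2 / α) φ ψ x)
    linarith

theorem IsProfile.hasDecay_sub {κ' : ℝ} {φ ψ : ℝ → ℝ} (hα : 0 < α) (hκ : 0 ≤ κ)
    (hκ1 : κ ≤ 1) (hκ' : 0 ≤ κ') (hκ1' : κ' ≤ 1) (h : IsProfile α κ f g) (h' : IsProfile α κ' φ ψ)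
    (hL : tailLimit (2 / α) f = tailLimit (2 / α) φ)
    (hL' : tailLimit (2 / α) (fun x => f (-x)) = tailLimit (2 / α) (fun x => φ (-x))) :
    HasDecay (2 / α + 2) (fun x => f x - φ x) ∧
      HasDecay (2 / α + 2) (fun x => x * (g x - ψ x)) := by
  obtain ⟨M, hM, hb⟩ := h.exists_tail_decay_sub hα hκ hκ1 hκ' hκ1' h' hL
  obtain ⟨M', hM', hb'⟩ := h.reflect.exists_tail_decay_sub hα hκ hκ1 hκ' hκ1' h'.reflect hL'
  have hβ : 0 ≤ 2 / α + 2 := by positivity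
  have hT := tailStart_pos hα
  have c1 := h.continuous_fst
  have c2 := h.continuous_snd
  have c3 := h'.continuous_fst
  have c4 := h'.continuous_snd
  have key : ∀ F : ℝ → ℝ, Continuous F → (∀ x, tailStart α ≤ x → |F x| ≤ M * x ^ (-(2 / α + 2))) →
      (∀ x, tailStart α ≤ x → |F (-x)| ≤ M' * x ^ (-(2 / α + 2))) → HasDecay (2 / α + 2) F := by
    intro F hF h1 h2
    refine hasDecay_of_tail hβ hF hT (C := M + M') (by positivity) (fun x hx => ?_) (fun x hx => ?_)
    · have hp := Real.rpow_pos_of_pos (hT.trans_le hx) (-(2 / α + 2))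
      have := h1 x hx
      nlinarith
    · have hp := Real.rpow_pos_of_pos (hT.trans_le hx) (-(2 / α + 2))
      have := h2 x hx
      nlinarith
  refine ⟨key _ (by fun_prop) (fun x hx => (hb x hx).1) (fun x hx => (hb' x hx).1),
    key _ (by fun_prop) (fun x hx => (hb x hx).2) (fun x hx => ?_)⟩
  have := (hb' x hx).2
  have e : x * (-g (-x) - -ψ (-x)) = -x * (g (-x) - ψ (-x)) := by ring
  rwa [e] at this

end ProfileDecay

/-! ### The self-similar solution and its L^r regularity. -/

section Solution

variable {α : ℝ} {f g : ℝ → ℝ}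

theorem IsProfile.hasDerivAt_snd_rhs {κ : ℝ} (h : IsProfile α κ f g) (x : ℝ) :
    HasDerivAt g (profileRhs α κ f g x) x := h.hasDerivAt_snd x

theorem IsProfile.contDiff {κ : ℝ} (hα : 0 < α) (h : IsProfile α κ f g) : ContDiff ℝ 2 f := by
  have h1 : deriv f = g := funext fun x => (h.hasDerivAt_fst x).deriv
  have h2 : deriv g = profileRhs α κ f g := funext fun x => (h.hasDerivAt_snd_rhs x).deriv
  rw [show (2 : WithTop ℕ∞) = 1 + 1 by norm_num, contDiff_succ_iff_deriv]
  refine ⟨fun x => (h.hasDerivAt_fst x).differentiableAt, by simp, ?_⟩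
  rw [h1, contDiff_one_iff_deriv, h2]
  exact ⟨fun x => (h.hasDerivAt_snd x).differentiableAt, h.continuous_profileRhs hα⟩

theorem nonlin_scaled (hα : 0 < α) {t : ℝ} (ht : 0 < t) (f : ℝ → ℝ) (x : ℝ) :
    nonlin α (scaled (-(1 / α)) f t x) = scaled (-(1 / α) - 1) (fun ξ => nonlin α (f ξ)) t x := by
  simp only [nonlin, scaled]
  rw [abs_mul, abs_of_pos (Real.rpow_pos_of_pos ht _), Real.mul_rpow (by positivity) (abs_nonneg _),
    ← Real.rpow_mul ht.le, Real.rpow_sub ht, Real.rpow_one,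
    show -(1 / α) * α = -1 by field_simp, Real.rpow_neg_one]
  field_simp

theorem iteratedDeriv_scaled {κ : ℝ} (h : IsProfile α κ f g) {c t : ℝ} (ht : 0 < t) (x : ℝ) :
    iteratedDeriv 2 (scaled c f t) x = scaled (c - 1) (profileRhs α κ f g) t x := by
  have h1 : deriv (scaled c f t) = scaled (c - 1 / 2) g t :=
    funext fun x => (hasDerivAt_scaled_space ht h.hasDerivAt_fst x).deriv
  rw [iteratedDeriv_succ, iteratedDeriv_one, h1,
    (hasDerivAt_scaled_space ht h.hasDerivAt_snd_rhs x).deriv]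
  congr 1
  ring

theorem IsProfile.isClassicalSolution (hα : 0 < α) (h : IsProfile α 1 f g) :
    IsClassicalSolution α (scaled (-(1 / α)) f) := by
  refine ⟨fun z hz => ContDiffAt.contDiffWithinAt ?_, fun t ht x => ?_⟩
  · have hz0 : (0 : ℝ) < z.1 := hz.1
    have h1 : ContDiffAt ℝ 2 (fun z : ℝ × ℝ => z.1 ^ (-(1 / α))) z :=
      contDiffAt_fst.rpow_const_of_ne hz0.ne'
    have h2 : ContDiffAt ℝ 2 (fun z : ℝ × ℝ => z.2 / √z.1) z :=
      contDiffAt_snd.div (contDiffAt_fst.sqrt hz0.ne') (Real.sqrt_pos.2 hz0).ne'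
    exact h1.mul ((h.contDiff hα).contDiffAt.comp z h2)
  · rw [(hasDerivAt_scaled_time ht h.hasDerivAt_fst).deriv, iteratedDeriv_scaled h ht,
      nonlin_scaled hα ht]
    simp only [scaled, profileRhs]
    ring

theorem IsProfile.isRegularSelfSimilar (hα : 0 < α) (h : IsProfile α 1 f g) :
    IsRegularSelfSimilar α (scaled (-(1 / α)) f) f where
  profile_regular := h.contDiff hα
  self_similar _ _ _ := rfl
  solution := h.isClassicalSolution hα

theorem IsProfile.isWeightedLipschitz {κ : ℝ} (hα : 0 < α) (hκ : 0 ≤ κ) (hκ1 : κ ≤ 1)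
    (h : IsProfile α κ f g) : IsWeightedLipschitz (weight (2 / α)) (scaled (-(1 / α)) f) :=
  isWeightedLipschitz_scaled (by positivity) _ h.hasDerivAt_fst (h.hasDecay hα hκ hκ1).1
    (h.hasDecay hα hκ hκ1).2.1

theorem memLp_weight_two_div (hα : 0 < α) {r : ℝ≥0∞} (hr : ENNReal.ofReal (α / 2) < r) :
    MemLp (weight (2 / α)) r volume := by
  refine memLp_weight (by positivity) ?_
  rwa [one_div_div]

theorem IsProfile.hasLpRegularity (hα : 0 < α) (h : IsProfile α 1 f g) :
    HasLpRegularity α (scaled (-(1 / α)) f) := by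
  intro r _ hr
  have hw := memLp_weight_two_div hα hr
  have hβ : 0 ≤ 2 / α := by positivity
  obtain ⟨d0, d1, d2⟩ := h.hasDecay hα zero_le_one le_rfl
  have hu := h.isWeightedLipschitz hα zero_le_one le_rfl
  have ht : IsWeightedLipschitz (weight (2 / α))
      (scaled (-(1 / α) - 1) fun ξ => -(1 / α) * f ξ - ξ / 2 * g ξ) := by
    refine isWeightedLipschitz_scaled hβ _
      (F' := fun ξ => -(1 / α) * g ξ - (1 / 2 * g ξ + ξ / 2 * profileRhs α 1 f g ξ))
      (fun ξ => ((h.hasDerivAt_fst ξ).const_mul _).sub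
        (((hasDerivAt_id ξ).div_const 2).mul (h.hasDerivAt_snd_rhs ξ))) ?_ ?_
    · exact ((d0.const_mul (-(1 / α))).add (d1.const_mul (-1 / 2))).congr fun ξ => by ring
    · exact ((d1.const_mul (-(1 / α) - 1 / 2)).add (d2.const_mul (-1 / 2))).congr fun ξ => by ring
  have hn : IsWeightedLipschitz (weight (2 / α))
      (scaled (-(1 / α) - 1) fun ξ => nonlin α (f ξ)) := by
    obtain ⟨B, hB, hf⟩ := d0.bounded hβ
    have hb : ∀ ξ, |(|f ξ| ^ α)| ≤ B ^ α := fun ξ => by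
      rw [abs_of_nonneg (by positivity)]
      exact Real.rpow_le_rpow (abs_nonneg _) (hf ξ) hα.le
    refine isWeightedLipschitz_scaled hβ _ (F' := fun ξ => (α + 1) * |f ξ| ^ α * g ξ)
      (fun ξ => (hasDerivAt_nonlin hα (f ξ)).comp ξ (h.hasDerivAt_fst ξ)) ?_ ?_
    · exact d0.bdd_mul hb
    · exact ((d1.bdd_mul hb).const_mul (α + 1)).congr fun ξ => by ring
  refine ⟨hu.contDiffInLp ht hw (fun x => (weight_pos _ x).le)
    fun t ht x => hasDerivAt_scaled_time ht h.hasDerivAt_fst, ?_, ?_⟩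
  -- Writing u_xx as u_t minus the nonlinearity avoids a third derivative of the profile.
  · refine ((ht.sub hn).congr fun t ht x => ?_).continuousInLp hw
    rw [iteratedDeriv_scaled h ht]
    simp only [scaled, profileRhs]
    ring
  · exact (hn.congr fun t ht x => nonlin_scaled hα ht f x).continuousInLp hw

end Solution
end
end NLHE
namespace NLHE
noncomputable section

/-! ### Convergence to the initial value from bounds singular at the origin. -/

section SingularBound

theorem measurable_abs_rpow (a : ℝ) : Measurable fun x : ℝ => |x| ^ a :=
  measurable_abs.pow_const a

theorem measurableSet_lt_abs (ε : ℝ) : MeasurableSet {x : ℝ | ε < |x|} :=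
  measurableSet_lt measurable_const measurable_abs

theorem ae_ne_zero (s : Set ℝ) : ∀ᵐ x : ℝ ∂(volume.restrict s), x ≠ 0 :=
  ae_restrict_of_ae (by simp [ae_iff])

theorem integrableOn_abs_rpow_neg {a : ℝ} (ha : a < 1) (R : ℝ) :
    IntegrableOn (fun x : ℝ => |x| ^ (-a)) (Metric.ball 0 R) volume := by
  refine integrableOn_ball_of_norm_le_rpow (α := a) (C := 1) (by simp) (by simpa using ha)
    (Eventually.of_forall fun x => ?_) (measurable_abs_rpow _).aestronglyMeasurable
  rw [Real.norm_of_nonneg (by positivity), Real.norm_eq_abs, one_mul]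

theorem memLp_abs_rpow_neg {a : ℝ} {p : ℝ≥0∞} (hp0 : p ≠ 0) (hpt : p ≠ ∞) (ha : a * p.toReal < 1) :
    MemLp (fun x : ℝ => |x| ^ (-a)) p (volume.restrict {x : ℝ | 1 < |x|}ᶜ) := by
  rw [← integrable_norm_rpow_iff (measurable_abs_rpow _).aestronglyMeasurable hp0 hpt]
  have h := (integrableOn_abs_rpow_neg ha 2).mono_set
    (show {x : ℝ | 1 < |x|}ᶜ ⊆ Metric.ball 0 2 by
      intro x hx
      simp only [mem_compl_iff, mem_ofPred_eq, not_lt] at hx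
      simp only [Metric.mem_ball, dist_zero_right, Real.norm_eq_abs]
      linarith)
  refine h.congr (Eventually.of_forall fun x => ?_)
  simp only
  rw [Real.norm_of_nonneg (by positivity), ← Real.rpow_mul (abs_nonneg x)]
  congr 1
  ring

theorem memLp_abs_rpow_neg_far {γ : ℝ} (hγ : 0 < γ) {q : ℝ≥0∞} (hq : ENNReal.ofReal (1 / γ) < q)
    {ε : ℝ} (hε : 0 < ε) :
    MemLp (fun x : ℝ => |x| ^ (-γ)) q (volume.restrict {x : ℝ | ε < |x|}) := by
  refine ((memLp_weight hγ hq).mono_measure Measure.restrict_le_self).of_le_mul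
    (c := (1 + 1 / ε) ^ γ) (measurable_abs_rpow _).aestronglyMeasurable ?_
  filter_upwards [ae_restrict_mem (measurableSet_lt_abs ε)] with x hx
  rw [Real.norm_of_nonneg (by positivity), Real.norm_of_nonneg (weight_pos γ x).le]
  exact rpow_neg_le_weight hγ.le hε (le_of_lt hx)

/-- A curve which is small, for small times, away from the origin, with a controlled singularity at
the origin. -/
def HasSingularBound (β : ℝ) (w : ℝ → ℝ → ℝ) : Prop :=
  ∃ C, 0 ≤ C ∧ ∀ δ ∈ Icc (0 : ℝ) 1, ∀ t, 0 < t → ∀ x, x ≠ 0 →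
    |w t x| ≤ C * t ^ δ * |x| ^ (-(β + 2 * δ))

variable {β : ℝ} {w : ℝ → ℝ → ℝ}

theorem HasSingularBound.sub {w' : ℝ → ℝ → ℝ} (h : HasSingularBound β w)
    (h' : HasSingularBound β w') : HasSingularBound β fun t x => w t x - w' t x := by
  obtain ⟨C, hC, h⟩ := h
  obtain ⟨C', hC', h'⟩ := h'
  refine ⟨C + C', by positivity, fun δ hδ t ht x hx => (abs_sub _ _).trans ?_⟩
  rw [add_mul, add_mul]
  exact add_le_add (h δ hδ t ht x hx) (h' δ hδ t ht x hx)

theorem HasSingularBound.tendsto_eLpNorm (h : HasSingularBound β w) {δ : ℝ} (hδ : 0 < δ)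
    (hδ1 : δ ≤ 1) {q : ℝ≥0∞} {s : Set ℝ}
    (hq : MemLp (fun x : ℝ => |x| ^ (-(β + 2 * δ))) q (volume.restrict s)) :
    Tendsto (fun t => eLpNorm (w t) q (volume.restrict s)) (𝓝[>] 0) (𝓝 0) := by
  obtain ⟨C, hC, h⟩ := h
  set N := eLpNorm (fun x : ℝ => |x| ^ (-(β + 2 * δ))) q (volume.restrict s) with hN
  have h1 : Tendsto (fun t : ℝ => ENNReal.ofReal (C * t ^ δ) * N) (𝓝[>] 0) (𝓝 0) := by
    have h2 : Tendsto (fun t : ℝ => C * t ^ δ) (𝓝[>] 0) (𝓝 0) := by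
      have : ContinuousAt (fun t : ℝ => C * t ^ δ) 0 :=
        continuousAt_const.mul (Real.continuousAt_rpow_const _ _ (Or.inr hδ.le))
      have h3 := this.tendsto
      rw [Real.zero_rpow hδ.ne', mul_zero] at h3
      exact h3.mono_left nhdsWithin_le_nhds
    have h4 := ENNReal.Tendsto.mul_const (ENNReal.tendsto_ofReal h2) (b := N) (Or.inr hq.2.ne)
    rwa [ENNReal.ofReal_zero, zero_mul] at h4
  refine tendsto_of_tendsto_of_tendsto_of_le_of_le' tendsto_const_nhds h1
    (Eventually.of_forall fun _ => zero_le) ?_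
  filter_upwards [self_mem_nhdsWithin] with t ht
  refine eLpNorm_le_mul_eLpNorm_of_ae_le_mul ?_ q
  filter_upwards [ae_ne_zero s] with x hx
  rw [Real.norm_eq_abs, Real.norm_of_nonneg (by positivity)]
  exact h δ ⟨hδ.le, hδ1⟩ t ht x hx

/-- Away from the origin δ = 1 is best: the power β + 2 has the strongest decay at infinity. -/
theorem HasSingularBound.tendsto_eLpNorm_far (h : HasSingularBound β w) (hβ : 0 < β)
    {q : ℝ≥0∞} (hq : ENNReal.ofReal (1 / (β + 2)) < q) {ε : ℝ} (hε : 0 < ε) :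
    Tendsto (fun t => eLpNorm (w t) q (volume.restrict {x : ℝ | ε < |x|})) (𝓝[>] 0) (𝓝 0) := by
  refine h.tendsto_eLpNorm one_pos le_rfl ?_
  rw [mul_one]
  exact memLp_abs_rpow_neg_far (by positivity) hq hε

theorem HasSingularBound.tendsto_eLpNorm_near (h : HasSingularBound β w) (hβ : 0 < β)
    {p : ℝ≥0∞} (hp0 : p ≠ 0) (hp : p < ENNReal.ofReal (1 / β)) :
    Tendsto (fun t => eLpNorm (w t) p (volume.restrict {x : ℝ | 1 < |x|}ᶜ)) (𝓝[>] 0) (𝓝 0) := by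
  have hpt : p ≠ ∞ := hp.ne_top
  have h1 : 0 < p.toReal := ENNReal.toReal_pos hp0 hpt
  have h2 : β * p.toReal < 1 := by
    have := (ENNReal.lt_ofReal_iff_toReal_lt hpt).1 hp
    rw [lt_div_iff₀ hβ] at this
    linarith
  -- Near the origin δ must be small: this choice gives (β + 2δ)p ≤ (1 + βp)/2 < 1, so the
  -- singularity remains p-integrable while a positive power of t is left.
  obtain ⟨δ, hδ⟩ : ∃ δ, δ = min 1 ((1 - β * p.toReal) / (4 * p.toReal)) := ⟨_, rfl⟩
  have hδ0 : 0 < δ := by rw [hδ]; exact lt_min one_pos (by apply div_pos <;> linarith)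
  refine h.tendsto_eLpNorm hδ0 (hδ ▸ min_le_left _ _) (memLp_abs_rpow_neg hp0 hpt ?_)
  have h3 : δ ≤ (1 - β * p.toReal) / (4 * p.toReal) := hδ ▸ min_le_right _ _
  rw [le_div_iff₀ (by positivity)] at h3
  linarith

theorem eLpNorm_le_near_add_far {r : ℝ≥0∞} (hr : 1 ≤ r) {v : ℝ → ℝ}
    (hv : AEStronglyMeasurable v volume) :
    eLpNorm v r volume ≤ eLpNorm v r (volume.restrict {x : ℝ | 1 < |x|}ᶜ)
      + eLpNorm v r (volume.restrict {x : ℝ | 1 < |x|}) := by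
  have hm := measurableSet_lt_abs 1
  rw [← eLpNorm_indicator_eq_eLpNorm_restrict hm.compl, ← eLpNorm_indicator_eq_eLpNorm_restrict hm]
  refine le_trans (le_of_eq ?_) (eLpNorm_add_le (hv.indicator hm.compl) (hv.indicator hm) hr)
  rw [indicator_compl_add_self]

theorem HasSingularBound.tendsto_eLpNorm_volume (h : HasSingularBound β w) (hβ : 0 < β)
    (hw : ∀ t, 0 < t → AEStronglyMeasurable (w t) volume)
    {r : ℝ≥0∞} (hr : 1 ≤ r) (hr1 : ENNReal.ofReal (1 / (β + 2)) < r)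
    (hr2 : r < ENNReal.ofReal (1 / β)) :
    Tendsto (fun t => eLpNorm (w t) r volume) (𝓝[>] 0) (𝓝 0) := by
  have h1 := (h.tendsto_eLpNorm_near hβ (one_pos.trans_le hr).ne' hr2).add
    (h.tendsto_eLpNorm_far hβ hr1 one_pos)
  rw [add_zero] at h1
  refine tendsto_of_tendsto_of_tendsto_of_le_of_le' tendsto_const_nhds h1
    (Eventually.of_forall fun _ => zero_le) ?_
  filter_upwards [self_mem_nhdsWithin] with t ht
  exact eLpNorm_le_near_add_far hr (hw t ht)

theorem sumNorm_le {p q : ℝ≥0∞} {v : ℝ → ℝ}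
    (hp : MemLp v p (volume.restrict {x : ℝ | 1 < |x|}ᶜ))
    (hq : MemLp v q (volume.restrict {x : ℝ | 1 < |x|})) :
    sumNorm p q v ≤ eLpNorm v p (volume.restrict {x : ℝ | 1 < |x|}ᶜ)
      + eLpNorm v q (volume.restrict {x : ℝ | 1 < |x|}) := by
  have hm := measurableSet_lt_abs 1
  rw [← eLpNorm_indicator_eq_eLpNorm_restrict hm.compl, ← eLpNorm_indicator_eq_eLpNorm_restrict hm]
  refine iInf₂_le_of_le _ _ (iInf₂_le_of_le ((memLp_indicator_iff_restrict hm.compl).2 hp)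
    ((memLp_indicator_iff_restrict hm).2 hq) (iInf_le_of_le ?_ le_rfl))
  refine Eventually.of_forall fun x => ?_
  exact (congrFun (indicator_compl_add_self {x : ℝ | 1 < |x|} v) x).symm

theorem sumNorm_lt_top_of_memLp {p q : ℝ≥0∞} {v : ℝ → ℝ} (hq : MemLp v q volume) :
    sumNorm p q v < ∞ := by
  refine lt_of_le_of_lt (iInf₂_le_of_le 0 v (iInf₂_le_of_le MemLp.zero hq
    (iInf_le_of_le (Eventually.of_forall fun x => ?_) le_rfl))) ?_
  · simp
  · simpa using hq.2

end SingularBound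

/-! ### Homogeneous initial data and attainment of the initial value. -/

section InitialDatum

/-- A homogeneous function of degree `-β` with parity `ε`, equal to `μ x^(-β)` on the half-line. -/
structure IsInitialDatum (β μ ε : ℝ) (u₀ : ℝ → ℝ) : Prop where
  measurable : Measurable u₀
  sign : |ε| = 1
  zero : u₀ 0 = 0
  pos : ∀ x, 0 < x → u₀ x = μ * x ^ (-β)
  neg : ∀ x, u₀ (-x) = ε * u₀ x

theorem IsInitialDatum.abs_eq {β μ ε : ℝ} {u₀ : ℝ → ℝ} (h : IsInitialDatum β μ ε u₀) {x : ℝ}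
    (hx : x ≠ 0) : |u₀ x| = |μ| * |x| ^ (-β) := by
  have key : ∀ y, 0 < y → |u₀ y| = |μ| * |y| ^ (-β) := fun y hy => by
    rw [h.pos y hy, abs_mul, abs_of_pos hy, abs_of_pos (Real.rpow_pos_of_pos hy _)]
  rcases hx.lt_or_gt with hx | hx
  · have := key (-x) (by linarith)
    rwa [h.neg, abs_mul, h.sign, one_mul, abs_neg] at this
  · exact key x hx

theorem isInitialDatum_even {β : ℝ} (hβ : β ≠ 0) (μ : ℝ) : IsInitialDatum β μ 1 fun x => μ * |x| ^ (-β) where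
  measurable := (measurable_abs_rpow _).const_mul μ
  sign := abs_one
  zero := by rw [abs_zero, Real.zero_rpow (neg_ne_zero.2 hβ), mul_zero]
  pos x hx := by rw [abs_of_pos hx]
  neg x := by rw [abs_neg, one_mul]

theorem isInitialDatum_odd (β μ : ℝ) : IsInitialDatum β μ (-1) fun x => μ * |x| ^ (-β - 1) * x where
  measurable := ((measurable_abs_rpow _).const_mul μ).mul measurable_id
  sign := by simp
  zero := mul_zero _
  pos x hx := by rw [abs_of_pos hx, mul_assoc, ← Real.rpow_add_one hx.ne']; simp
  neg x := by rw [abs_neg]; ring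

variable {α κ μ ε : ℝ} {f g u₀ : ℝ → ℝ}

/-- |z - L| is bounded for small x and O(x^(-2)) for large x; up to a constant, min(1, x^(-2)) is
below x^(-2δ) for every δ in [0, 1]. -/
theorem IsProfile.exists_min_bound (hα : 0 < α) (hκ : 0 ≤ κ) (hκ1 : κ ≤ 1) (h : IsProfile α κ f g) :
    ∃ C, 0 ≤ C ∧ ∀ x, 0 < x → ∀ δ ∈ Icc (0 : ℝ) 1,
      |x ^ (2 / α) * f x - tailLimit (2 / α) f| ≤ C * x ^ (-(2 * δ)) := by
  obtain ⟨K, hK, hb⟩ := h.exists_tailLimit_bound hα hκ hκ1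
  obtain ⟨B, hB, hf⟩ := (h.hasDecay hα hκ hκ1).1.bounded (by positivity)
  obtain ⟨T, hT⟩ : ∃ T, T = tailStart α := ⟨_, rfl⟩
  obtain ⟨L, hL⟩ : ∃ L, L = tailLimit (2 / α) f := ⟨_, rfl⟩
  have hT0 : 0 < T := hT ▸ tailStart_pos hα
  have hT1 : 1 ≤ T := by
    have := sixteen_le_tailStart_sq hα
    rw [← hT] at this
    nlinarith
  obtain ⟨A, hA⟩ : ∃ A, A = T ^ (2 / α) * B + |L| := ⟨_, rfl⟩
  have hA0 : 0 ≤ A := by rw [hA]; positivity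
  refine ⟨K + A * T ^ 2, by positivity, fun x hx δ hδ => ?_⟩
  rw [← hL]
  have hp : 0 < x ^ (-(2 * δ)) := Real.rpow_pos_of_pos hx _
  rcases le_total T x with hTx | hTx
  · have h1 := (hb x (hT ▸ hTx)).1
    rw [tailVal, ← hL] at h1
    have h2 : (x ^ 2)⁻¹ ≤ x ^ (-(2 * δ)) := by
      rw [← Real.rpow_natCast x 2, ← Real.rpow_neg hx.le]
      exact Real.rpow_le_rpow_of_exponent_le (hT1.trans hTx) (by push_cast; linarith [hδ.2])
    calc _ ≤ K / x ^ 2 := h1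
      _ = K * (x ^ 2)⁻¹ := by ring
      _ ≤ K * x ^ (-(2 * δ)) := by gcongr
      _ ≤ _ := by gcongr; nlinarith [sq_nonneg T]
  · have h1 : |x ^ (2 / α) * f x - L| ≤ A := by
      refine (abs_sub _ _).trans ?_
      rw [hA, abs_mul, abs_of_pos (Real.rpow_pos_of_pos hx _)]
      have := hf x
      gcongr
    have h2 : 1 ≤ T ^ 2 * x ^ (-(2 * δ)) := by
      have h3 : T ^ (-(2 * δ)) ≤ x ^ (-(2 * δ)) :=
        Real.rpow_le_rpow_of_nonpos hx hTx (by linarith [hδ.1])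
      have h4 : (T ^ 2)⁻¹ ≤ T ^ (-(2 * δ)) := by
        rw [← Real.rpow_natCast T 2, ← Real.rpow_neg hT0.le]
        exact Real.rpow_le_rpow_of_exponent_le hT1 (by push_cast; linarith [hδ.2])
      calc (1 : ℝ) = T ^ 2 * (T ^ 2)⁻¹ := by field_simp
        _ ≤ _ := by gcongr; exact h4.trans h3
    calc _ ≤ A := h1
      _ ≤ A * (T ^ 2 * x ^ (-(2 * δ))) := le_mul_of_one_le_right hA0 h2
      _ ≤ _ := by rw [← mul_assoc]; gcongr; linarith

/-- Evaluated at x/√t and multiplied by x^(-β), the bound of `exists_min_bound` becomes the claim,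
since (x/√t)^(-2δ) = t^δ x^(-2δ). Negative x follow by parity. -/
theorem IsProfile.hasSingularBound (hα : 0 < α) (hκ : 0 ≤ κ) (hκ1 : κ ≤ 1) (h : IsProfile α κ f g)
    (h₀ : IsInitialDatum (2 / α) μ ε u₀) (hL : tailLimit (2 / α) f = μ)
    (hf : ∀ x, f (-x) = ε * f x) :
    HasSingularBound (2 / α) fun t x => scaled (-(1 / α)) f t x - u₀ x := by
  obtain ⟨C, hC, hb⟩ := h.exists_min_bound hα hκ hκ1
  have key : ∀ δ ∈ Icc (0 : ℝ) 1, ∀ t, 0 < t → ∀ x, 0 < x →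
      |scaled (-(1 / α)) f t x - u₀ x| ≤ C * t ^ δ * |x| ^ (-(2 / α + 2 * δ)) := by
    intro δ hδ t ht x hx
    have hs : 0 < √t := Real.sqrt_pos.2 ht
    have h1 := hb (x / √t) (by positivity) δ hδ
    rw [hL] at h1
    have hst : ∀ a : ℝ, √t ^ a = t ^ (a / 2) := fun a => by
      rw [Real.sqrt_eq_rpow, ← Real.rpow_mul ht.le]; congr 1; ring
    have e1 : scaled (-(1 / α)) f t x - u₀ x
        = x ^ (-(2 / α)) * ((x / √t) ^ (2 / α) * f (x / √t) - μ) := by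
      rw [h₀.pos x hx, scaled, Real.div_rpow hx.le hs.le, hst, show 2 / α / 2 = 1 / α by ring,
        Real.rpow_neg ht.le, Real.rpow_neg hx.le]
      have := Real.rpow_pos_of_pos hx (2 / α)
      have := Real.rpow_pos_of_pos ht (1 / α)
      field_simp
    have e2 : C * t ^ δ * |x| ^ (-(2 / α + 2 * δ)) = x ^ (-(2 / α)) * (C * (x / √t) ^ (-(2 * δ))) := by
      rw [abs_of_pos hx, Real.div_rpow hx.le hs.le, hst, show -(2 / α + 2 * δ) = -(2 / α) + -(2 * δ) by ring,
        Real.rpow_add hx, show -(2 * δ) / 2 = -δ by ring, Real.rpow_neg ht.le]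
      have := Real.rpow_pos_of_pos ht δ
      field_simp
    rw [e1, e2, abs_mul, abs_of_pos (Real.rpow_pos_of_pos hx _)]
    gcongr
  refine ⟨C, hC, fun δ hδ t ht x hx => ?_⟩
  rcases hx.lt_or_gt with hx | hx
  · have h1 := key δ hδ t ht (-x) (by linarith)
    rw [abs_neg, h₀.neg, scaled, neg_div, hf] at h1
    have e : t ^ (-(1 / α)) * (ε * f (x / √t)) - ε * u₀ x
        = ε * (scaled (-(1 / α)) f t x - u₀ x) := by rw [scaled]; ring
    rwa [e, abs_mul, h₀.sign, one_mul] at h1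
  · exact key δ hδ t ht x hx

theorem ofReal_one_div_add_two_lt {q : ℝ≥0∞} (hα : 0 < α) (hq : ENNReal.ofReal (α / 2) < q) :
    ENNReal.ofReal (1 / (2 / α + 2)) < q := by
  refine lt_of_le_of_lt (ENNReal.ofReal_le_ofReal ?_) hq
  rw [← one_div_div 2 α]
  exact one_div_le_one_div_of_le (by positivity) (by linarith)

theorem IsProfile.hasInitialValue (hα : 0 < α) (h : IsProfile α 1 f g)
    (h₀ : IsInitialDatum (2 / α) μ ε u₀) (hL : tailLimit (2 / α) f = μ)
    (hf : ∀ x, f (-x) = ε * f x) : HasInitialValue α (scaled (-(1 / α)) f) u₀ := by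
  have hβ : 0 < 2 / α := by positivity
  have hs := h.hasSingularBound hα zero_le_one le_rfl h₀ hL hf
  have hu := h.isWeightedLipschitz hα zero_le_one le_rfl
  have hmem : ∀ q, ENNReal.ofReal (α / 2) < q → ∀ t, 0 < t →
      MemLp (scaled (-(1 / α)) f t) q volume := fun q hq t ht =>
    hu.memLp (memLp_weight_two_div hα hq) ht
  have hle : ∀ s : Set ℝ, ∀ᵐ x ∂(volume.restrict s), ‖u₀ x‖ ≤ |μ| * ‖|x| ^ (-(2 / α))‖ := fun s => by
    filter_upwards [ae_ne_zero s] with x hx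
    rw [Real.norm_eq_abs, h₀.abs_eq hx, Real.norm_of_nonneg (by positivity)]
  have hfar : ∀ q, ENNReal.ofReal (α / 2) < q → ∀ ε : ℝ, 0 < ε →
      MemLp u₀ q (volume.restrict {x : ℝ | ε < |x|}) := fun q hq ε hε =>
    (memLp_abs_rpow_neg_far hβ (by rwa [one_div_div]) hε).of_le_mul
      h₀.measurable.aestronglyMeasurable (hle _)
  refine ⟨fun ε hε q _ hq => ⟨hfar q hq ε hε,
    fun t ht => (hmem q hq t ht).mono_measure Measure.restrict_le_self,
    hs.tendsto_eLpNorm_far hβ (ofReal_one_div_add_two_lt hα hq) hε⟩, fun _ p q hp hpα hq => ?_⟩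
  have hp0 : p ≠ 0 := (one_pos.trans_le hp).ne'
  have hpβ : p < ENNReal.ofReal (1 / (2 / α)) := by rwa [one_div_div]
  have hnear : MemLp u₀ p (volume.restrict {x : ℝ | 1 < |x|}ᶜ) := by
    refine (memLp_abs_rpow_neg hp0 hpα.ne_top ?_).of_le_mul
      h₀.measurable.aestronglyMeasurable (hle _)
    have := (ENNReal.lt_ofReal_iff_toReal_lt hpα.ne_top).1 hpβ
    rw [lt_div_iff₀ hβ] at this
    linarith
  have hle' : ∀ v, MemLp v p (volume.restrict {x : ℝ | 1 < |x|}ᶜ) →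
      MemLp v q (volume.restrict {x : ℝ | 1 < |x|}) → sumNorm p q v < ∞ := fun v h1 h2 =>
    (sumNorm_le h1 h2).trans_lt (ENNReal.add_lt_top.2 ⟨h1.2, h2.2⟩)
  refine ⟨hle' _ hnear (hfar q hq 1 one_pos), fun t ht => sumNorm_lt_top_of_memLp (hmem q hq t ht), ?_⟩
  have h1 := (hs.tendsto_eLpNorm_near hβ hp0 hpβ).add
    (hs.tendsto_eLpNorm_far hβ (ofReal_one_div_add_two_lt hα hq) one_pos)
  rw [add_zero] at h1
  refine tendsto_of_tendsto_of_tendsto_of_le_of_le' tendsto_const_nhds h1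
    (Eventually.of_forall fun _ => zero_le) ?_
  filter_upwards [self_mem_nhdsWithin] with t ht
  refine sumNorm_le (MemLp.sub ?_ hnear)
    (((hmem q hq t ht).mono_measure Measure.restrict_le_self).sub (hfar q hq 1 one_pos))
  have hc : Continuous (scaled (-(1 / α)) f t) := hu.cont t ht
  obtain ⟨C, hC, hb⟩ := hu.bound t ht
  have hfin : IsFiniteMeasure (volume.restrict {x : ℝ | 1 < |x|}ᶜ) := by
    refine ⟨?_⟩
    rw [Measure.restrict_apply_univ]
    refine lt_of_le_of_lt (measure_mono (t := Icc (-1) 1) fun x hx => ?_) (by simp)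
    simp only [mem_compl_iff, mem_ofPred_eq, not_lt] at hx
    exact abs_le.1 hx
  refine MemLp.of_bound hc.aestronglyMeasurable C (Eventually.of_forall fun x => ?_)
  exact (hb x).trans (mul_le_of_le_one_right hC (weight_le_one hβ.le x))

end InitialDatum
end
end NLHE
namespace NLHE
noncomputable section

/-! ### Convolution with kernels of Gaussian size. -/

section GaussianMajorant

theorem integrable_exp_neg_mul_sub_sq {c : ℝ} (hc : 0 < c) (x : ℝ) :
    Integrable fun y : ℝ => Real.exp (-c * (x - y) ^ 2) :=
  (integrable_exp_neg_mul_sq hc).comp_sub_left x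

theorem integrable_exp_mul_abs_rpow_neg {c b : ℝ} (hc : 0 < c) (hb : 0 ≤ b) (hb1 : b < 1) (x : ℝ) :
    Integrable fun y : ℝ => Real.exp (-c * (x - y) ^ 2) * |y| ^ (-b) := by
  have h1 : Integrable ((Metric.ball (0 : ℝ) 1).indicator fun y : ℝ => |y| ^ (-b)) :=
    (integrable_indicator_iff Metric.isOpen_ball.measurableSet).2 (integrableOn_abs_rpow_neg hb1 1)
  have h2 := h1.add (integrable_exp_neg_mul_sub_sq hc x)
  have hm : Measurable fun y : ℝ => Real.exp (-c * (x - y) ^ 2) := by fun_prop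
  refine h2.mono' (hm.mul (measurable_abs_rpow _)).aestronglyMeasurable
    (Eventually.of_forall fun y => ?_)
  have he : Real.exp (-c * (x - y) ^ 2) ≤ 1 := Real.exp_le_one_iff.2 (by nlinarith [sq_nonneg (x - y)])
  have he0 := Real.exp_pos (-c * (x - y) ^ 2)
  have hy : 0 ≤ |y| ^ (-b) := by positivity
  rw [Real.norm_of_nonneg (by positivity), Pi.add_apply]
  by_cases h : y ∈ Metric.ball (0 : ℝ) 1
  · rw [indicator_of_mem h]
    nlinarith
  · rw [indicator_of_notMem h, zero_add]
    have : 1 ≤ |y| := by simpa using h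
    have := Real.rpow_le_one_of_one_le_of_nonpos this (neg_nonpos.2 hb)
    nlinarith

/-- Functions which can be integrated against every Gaussian. -/
def GaussianIntegrable (v : ℝ → ℝ) : Prop :=
  Measurable v ∧ ∀ c : ℝ, 0 < c → ∀ x : ℝ, Integrable fun y => Real.exp (-c * (x - y) ^ 2) * |v y|

theorem GaussianIntegrable.integrable_mul {v : ℝ → ℝ} (hv : GaussianIntegrable v) {k : ℝ → ℝ}
    (hk : Measurable k) {A c : ℝ} (hc : 0 < c) (hb : ∀ z, |k z| ≤ A * Real.exp (-c * z ^ 2)) (x : ℝ) :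
    Integrable fun y => k (x - y) * v y := by
  refine ((hv.2 c hc x).const_mul A).mono'
    ((hk.comp (measurable_const.sub measurable_id)).mul hv.1).aestronglyMeasurable
    (Eventually.of_forall fun y => ?_)
  rw [norm_mul, Real.norm_eq_abs, Real.norm_eq_abs, ← mul_assoc]
  exact mul_le_mul_of_nonneg_right (hb _) (abs_nonneg _)

/-- Halving the rate gives one majorant for all centres within distance 1, which is what
differentiation under the integral requires. -/
theorem exp_neg_sq_le_of_abs_sub_le {c x x' y : ℝ} (hc : 0 < c) (h : |x' - x| ≤ 1) :
    Real.exp (-c * (x' - y) ^ 2) ≤ Real.exp c * Real.exp (-(c / 2) * (x - y) ^ 2) := by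
  rw [← Real.exp_add, Real.exp_le_exp]
  have h1 : (x' - x) ^ 2 ≤ 1 := by rw [sq_le_one_iff_abs_le_one]; exact h
  have h2 : (x - y) ^ 2 ≤ 2 * (x' - y) ^ 2 + 2 := by nlinarith [sq_nonneg (x' - y + (x' - x))]
  nlinarith

theorem GaussianIntegrable.hasDerivAt_integral {v : ℝ → ℝ} (hv : GaussianIntegrable v)
    {k k' : ℝ → ℝ} (hk : ∀ z, HasDerivAt k (k' z) z) (hk'm : Measurable k') {A c : ℝ} (hc : 0 < c)
    (hb : ∀ z, |k z| ≤ A * Real.exp (-c * z ^ 2)) (hb' : ∀ z, |k' z| ≤ A * Real.exp (-c * z ^ 2))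
    (x : ℝ) :
    HasDerivAt (fun x => ∫ y, k (x - y) * v y) (∫ y, k' (x - y) * v y) x := by
  have hkm : Measurable k :=
    (continuous_iff_continuousAt.2 fun z => (hk z).continuousAt).measurable
  refine (hasDerivAt_integral_of_dominated_loc_of_deriv_le (μ := volume) (s := Metric.ball x 1)
    (F := fun x y => k (x - y) * v y) (F' := fun x y => k' (x - y) * v y)
    (bound := fun y => A * Real.exp c * (Real.exp (-(c / 2) * (x - y) ^ 2) * |v y|))
    (Metric.ball_mem_nhds x one_pos)
    (Eventually.of_forall fun x => (hv.integrable_mul hkm hc hb x).aestronglyMeasurable)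
    (hv.integrable_mul hkm hc hb x) (hv.integrable_mul hk'm hc hb' x).aestronglyMeasurable
    (Eventually.of_forall fun y x' hx' => ?_) ((hv.2 (c / 2) (by positivity) x).const_mul _)
    (Eventually.of_forall fun y x' _ => ?_)).2
  · have hA : 0 ≤ A := by
      have h1 := (abs_nonneg _).trans (hb 0)
      have h2 := Real.exp_pos (-c * (0 : ℝ) ^ 2)
      by_contra! h
      nlinarith
    have h1 := exp_neg_sq_le_of_abs_sub_le (y := y) hc (x := x) (x' := x')
      (by simpa [Real.dist_eq] using (Metric.mem_ball.1 hx').le)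
    rw [norm_mul, Real.norm_eq_abs, Real.norm_eq_abs]
    calc |k' (x' - y)| * |v y| ≤ (A * Real.exp (-c * (x' - y) ^ 2)) * |v y| := by gcongr; exact hb' _
      _ ≤ (A * (Real.exp c * Real.exp (-(c / 2) * (x - y) ^ 2))) * |v y| := by gcongr
      _ = _ := by ring
  · have := (hk (x' - y)).comp_sub_const x' y
    exact this.mul_const (v y)

theorem gaussianIntegrable_of_abs_le {v : ℝ → ℝ} (hv : Measurable v) {B b : ℝ} (hb : 0 ≤ b)
    (hb1 : b < 1) (h : ∀ x, x ≠ 0 → |v x| ≤ B * |x| ^ (-b)) : GaussianIntegrable v := by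
  refine ⟨hv, fun c hc x => ?_⟩
  have hm : Measurable fun y : ℝ => Real.exp (-c * (x - y) ^ 2) := by fun_prop
  refine ((integrable_exp_mul_abs_rpow_neg hc hb hb1 x).const_mul B).mono'
    (hm.mul (measurable_abs.comp hv)).aestronglyMeasurable ?_
  have := ae_ne_zero univ
  rw [Measure.restrict_univ] at this
  filter_upwards [this] with y hy
  rw [norm_mul, Real.norm_of_nonneg (Real.exp_pos _).le, Real.norm_eq_abs, abs_abs]
  calc _ ≤ Real.exp (-c * (x - y) ^ 2) * (B * |y| ^ (-b)) := by gcongr; exact h y hy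
    _ = _ := by ring

end GaussianMajorant

/-! ### The Gauss kernel: derivatives, bounds, approximate identity. -/

section HeatKernel

/-- The common value of the time derivative and of the second space derivative of the Gauss
kernel. -/
def heatKernelDeriv (t x : ℝ) : ℝ := (x ^ 2 / (4 * t ^ 2) - 1 / (2 * t)) * heatKernel t x

theorem heatKernel_nonneg (t x : ℝ) : 0 ≤ heatKernel t x := by unfold heatKernel; positivity

theorem heatKernel_neg (t x : ℝ) : heatKernel t (-x) = heatKernel t x := by
  unfold heatKernel; rw [neg_sq]

theorem hasDerivAt_heatKernel_space {t : ℝ} (ht : 0 < t) (x : ℝ) :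
    HasDerivAt (heatKernel t) (-(x / (2 * t)) * heatKernel t x) x := by
  have d : HasDerivAt (fun x : ℝ => -(x ^ 2) / (4 * t)) (-(x / (2 * t))) x := by
    refine (((hasDerivAt_pow 2 x).neg).div_const (4 * t)).congr_deriv ?_
    field_simp
    ring
  refine (d.exp.const_mul (√(4 * Real.pi * t))⁻¹).congr_deriv ?_
  rw [heatKernel]; ring

theorem hasDerivAt_heatKernel_space_snd {t : ℝ} (ht : 0 < t) (x : ℝ) :
    HasDerivAt (fun x => -(x / (2 * t)) * heatKernel t x) (heatKernelDeriv t x) x := by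
  refine ((((hasDerivAt_id x).div_const (2 * t)).neg).mul
    (hasDerivAt_heatKernel_space ht x)).congr_deriv ?_
  simp only [heatKernelDeriv, id_eq, Pi.neg_apply]
  field_simp
  ring

theorem hasDerivAt_heatKernel_time {t : ℝ} (ht : 0 < t) (x : ℝ) :
    HasDerivAt (fun t => heatKernel t x) (heatKernelDeriv t x) t := by
  have hp : 0 < 4 * Real.pi * t := by positivity
  have hs : 0 < √(4 * Real.pi * t) := Real.sqrt_pos.2 hp
  have d0 : HasDerivAt (fun t : ℝ => 4 * Real.pi * t) (4 * Real.pi) t := by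
    simpa using (hasDerivAt_id t).const_mul (4 * Real.pi)
  have d1 : HasDerivAt (fun t => (√(4 * Real.pi * t))⁻¹) (-(1 / (2 * t)) * (√(4 * Real.pi * t))⁻¹) t := by
    refine ((d0.sqrt hp.ne').inv hs.ne').congr_deriv ?_
    rw [Real.sq_sqrt hp.le]
    field_simp
  have d2 : HasDerivAt (fun t : ℝ => -(x ^ 2) / (4 * t)) (x ^ 2 / (4 * t ^ 2)) t := by
    refine ((hasDerivAt_const t (-(x ^ 2))).div ((hasDerivAt_id t).const_mul 4)
      (by simp [ht.ne'])).congr_deriv ?_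
    simp only [id_eq]
    field_simp
    ring
  refine (d1.mul d2.exp).congr_deriv ?_
  rw [heatKernelDeriv, heatKernel]
  ring

theorem continuous_heatKernel {t : ℝ} (ht : 0 < t) : Continuous (heatKernel t) :=
  continuous_iff_continuousAt.2 fun x => (hasDerivAt_heatKernel_space ht x).continuousAt

theorem continuous_heatKernelDeriv {t : ℝ} (ht : 0 < t) : Continuous (heatKernelDeriv t) := by
  have := continuous_heatKernel ht
  unfold heatKernelDeriv
  fun_prop

theorem heatKernel_le {t b : ℝ} (ht : 0 < t) (htb : t ≤ b) (x : ℝ) :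
    heatKernel t x ≤ (√(4 * Real.pi * t))⁻¹ * Real.exp (-(1 / (4 * b)) * x ^ 2) := by
  unfold heatKernel
  gcongr
  have h : 1 / (4 * b) ≤ 1 / (4 * t) := by
    apply one_div_le_one_div_of_le <;> linarith
  have e : -x ^ 2 / (4 * t) = -(1 / (4 * t) * x ^ 2) := by ring
  rw [e]
  nlinarith [sq_nonneg x]

theorem exists_heatKernel_bounds {a b : ℝ} (ha : 0 < a) (hab : a ≤ b) :
    ∃ A, 0 ≤ A ∧ ∀ t ∈ Icc a b, ∀ x, |heatKernel t x| ≤ A * Real.exp (-(1 / (8 * b)) * x ^ 2) ∧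
      |-(x / (2 * t)) * heatKernel t x| ≤ A * Real.exp (-(1 / (8 * b)) * x ^ 2) ∧
      |heatKernelDeriv t x| ≤ A * Real.exp (-(1 / (8 * b)) * x ^ 2) := by
  have hb : 0 < b := ha.trans_le hab
  obtain ⟨s, hs⟩ : ∃ s, s = (√(4 * Real.pi * a))⁻¹ := ⟨_, rfl⟩
  have hs0 : 0 ≤ s := by rw [hs]; positivity
  obtain ⟨m, hm⟩ : ∃ m, m = 1 + (1 + 8 * b) / (2 * a) + (8 * b / (4 * a ^ 2) + 1 / (2 * a)) := ⟨_, rfl⟩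
  have p1 : 0 ≤ (1 + 8 * b) / (2 * a) := by positivity
  have p2 : 0 ≤ 8 * b / (4 * a ^ 2) := by positivity
  have p3 : 0 ≤ 1 / (2 * a) := by positivity
  refine ⟨s * m, by rw [hm]; positivity, fun t ht x => ?_⟩
  have ht0 : 0 < t := ha.trans_le ht.1
  -- The Gaussian factor of the kernel is at most P². One factor P absorbs the polynomials, through
  -- x² P ≤ 8b, and the other remains in the bound.
  obtain ⟨P, hP⟩ : ∃ P, P = Real.exp (-(1 / (8 * b)) * x ^ 2) := ⟨_, rfl⟩
  have hP0 : 0 < P := hP ▸ Real.exp_pos _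
  have hP1 : P ≤ 1 := by
    rw [hP, Real.exp_le_one_iff]
    have : 0 ≤ 1 / (8 * b) := by positivity
    nlinarith [sq_nonneg x]
  have hPx : x ^ 2 * P ≤ 8 * b := by
    have h1 := Real.add_one_le_exp (1 / (8 * b) * x ^ 2)
    have h2 : P * Real.exp (1 / (8 * b) * x ^ 2) = 1 := by
      rw [hP, ← Real.exp_add]; simp
    have h3 : P * (1 / (8 * b) * x ^ 2) ≤ 1 := by nlinarith
    have e : x ^ 2 * P = 8 * b * (P * (1 / (8 * b) * x ^ 2)) := by field_simp
    rw [e]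
    nlinarith
  have hPx1 : |x| * P ≤ 1 + 8 * b := by
    have : |x| ≤ 1 + x ^ 2 := by nlinarith [sq_abs x, sq_nonneg (|x| - 1)]
    nlinarith
  have hK : heatKernel t x ≤ s * (P * P) := by
    refine (heatKernel_le ht0 ht.2 x).trans ?_
    have e : Real.exp (-(1 / (4 * b)) * x ^ 2) = P * P := by
      rw [hP, ← Real.exp_add]; congr 1; field_simp; ring
    rw [e, hs]
    gcongr
    exact ht.1
  have hK0 := heatKernel_nonneg t x
  rw [← hP]
  have q1 : (1 + 8 * b) / (2 * t) ≤ (1 + 8 * b) / (2 * a) := by have := ht.1; gcongr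
  have q2 : 8 * b / (4 * t ^ 2) ≤ 8 * b / (4 * a ^ 2) := by have := ht.1; gcongr
  have q3 : 1 / (2 * t) ≤ 1 / (2 * a) := by have := ht.1; gcongr
  have key : ∀ w v : ℝ, |w| * P ≤ v → v ≤ m → |w * heatKernel t x| ≤ s * m * P := by
    intro w v hw hv
    rw [abs_mul, abs_of_nonneg hK0]
    calc |w| * heatKernel t x ≤ |w| * (s * (P * P)) := by gcongr
      _ = s * (|w| * P) * P := by ring
      _ ≤ s * m * P := by gcongr; exact hw.trans hv
  refine ⟨?_, ?_, ?_⟩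
  · have := key 1 1 (by rw [abs_one, one_mul]; exact hP1) (by rw [hm]; linarith)
    rwa [one_mul] at this
  · refine key _ ((1 + 8 * b) / (2 * t)) ?_ (by rw [hm]; linarith)
    rw [abs_neg, abs_div, abs_of_pos (show 0 < 2 * t by positivity), div_mul_eq_mul_div]
    gcongr
  · refine key _ (8 * b / (4 * t ^ 2) + 1 / (2 * t)) ?_ (by rw [hm]; linarith)
    refine (mul_le_mul_of_nonneg_right (abs_sub _ _) hP0.le).trans ?_
    rw [abs_of_nonneg (show 0 ≤ x ^ 2 / (4 * t ^ 2) by positivity),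
      abs_of_nonneg (show 0 ≤ 1 / (2 * t) by positivity), add_mul, div_mul_eq_mul_div]
    have : 0 ≤ 1 / (2 * t) := by positivity
    gcongr
    nlinarith

theorem integral_heatKernel {t : ℝ} (ht : 0 < t) : ∫ x, heatKernel t x = 1 := by
  have e : (fun x => heatKernel t x)
      = fun x => (√(4 * Real.pi * t))⁻¹ * Real.exp (-(1 / (4 * t)) * x ^ 2) := by
    funext x; rw [heatKernel]; congr 2; ring
  rw [e, integral_const_mul, integral_gaussian,
    show Real.pi / (1 / (4 * t)) = 4 * Real.pi * t by field_simp]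
  have : 0 < √(4 * Real.pi * t) := Real.sqrt_pos.2 (by positivity)
  field_simp

theorem heatKernel_sqrt_mul {t : ℝ} (ht : 0 < t) (x : ℝ) :
    heatKernel t (√t * x) = (√t)⁻¹ * heatKernel 1 x := by
  unfold heatKernel
  rw [mul_pow, Real.sq_sqrt ht.le, mul_one, Real.sqrt_mul (by positivity) t, mul_inv]
  have : -(t * x ^ 2) / (4 * t) = -x ^ 2 / (4 * 1) := by field_simp
  rw [this]
  ring

theorem heat_eq_integral_heatKernel_one {t : ℝ} (ht : 0 < t) (v : ℝ → ℝ) (x : ℝ) :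
    heat t v x = ∫ z, heatKernel 1 z * v (x - √t * z) := by
  have hs : 0 < √t := Real.sqrt_pos.2 ht
  have h1 : heat t v x = ∫ y, heatKernel t y * v (x - y) := by
    rw [heat, ← integral_sub_left_eq_self (fun y => heatKernel t (x - y) * v y) volume x]
    simp only [sub_sub_cancel]
  have h2 := Measure.integral_comp_mul_left (fun y => heatKernel t y * v (x - y)) √t
  rw [abs_of_pos (inv_pos.2 hs), smul_eq_mul, ← h1] at h2
  have h3 : heat t v x = √t * ((√t)⁻¹ * heat t v x) := by field_simp
  rw [h3, ← h2, ← integral_const_mul]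
  congr 1
  funext z
  rw [heatKernel_sqrt_mul ht]
  field_simp

theorem integrable_heatKernel {t : ℝ} (ht : 0 < t) : Integrable (heatKernel t) := by
  by_contra h
  have := integral_heatKernel ht
  -- A nonintegrable function has integral 0 by convention, which contradicts the value 1.
  rw [integral_undef h] at this
  norm_num at this

/-- The Gauss kernel is an approximate identity. -/
theorem tendsto_heat_of_bounded {ι : Type*} {l : Filter ι} [l.IsCountablyGenerated] {τ : ι → ℝ}
    {v : ι → ℝ → ℝ} {B a x : ℝ} (hτ : ∀ᶠ i in l, 0 < τ i) (hm : ∀ᶠ i in l, Measurable (v i))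
    (hB : ∀ᶠ i in l, ∀ y, |v i y| ≤ B)
    (hv : ∀ z, Tendsto (fun i => v i (x - √(τ i) * z)) l (𝓝 a)) :
    Tendsto (fun i => heat (τ i) (v i) x) l (𝓝 a) := by
  have h1 : Tendsto (fun i => ∫ z, heatKernel 1 z * v i (x - √(τ i) * z)) l
      (𝓝 (∫ z, heatKernel 1 z * a)) := by
    refine tendsto_integral_filter_of_dominated_convergence (fun z => heatKernel 1 z * B) ?_ ?_
      ((integrable_heatKernel one_pos).mul_const B) ?_
    · filter_upwards [hm] with i hi
      exact ((continuous_heatKernel one_pos).measurable.mul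
        (hi.comp (by fun_prop))).aestronglyMeasurable
    · filter_upwards [hB] with i hi
      refine Eventually.of_forall fun z => ?_
      rw [norm_mul, Real.norm_of_nonneg (heatKernel_nonneg _ _)]
      exact mul_le_mul_of_nonneg_left (hi _) (heatKernel_nonneg _ _)
    · exact Eventually.of_forall fun z => (hv z).const_mul _
  rw [integral_mul_const, integral_heatKernel one_pos, one_mul] at h1
  refine h1.congr' ?_
  filter_upwards [hτ] with i hi
  exact (heat_eq_integral_heatKernel_one hi _ _).symm

end HeatKernel
end
end NLHE
namespace NLHE
noncomputable section

/-! ### Derivatives of the heat flow. -/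

section HeatFlow

/-- The space derivative of the heat flow. -/
def heatGrad (t : ℝ) (v : ℝ → ℝ) (x : ℝ) : ℝ :=
  ∫ y, (-((x - y) / (2 * t)) * heatKernel t (x - y)) * v y

/-- The time derivative of the heat flow. -/
def heatLaplacian (t : ℝ) (v : ℝ → ℝ) (x : ℝ) : ℝ := ∫ y, heatKernelDeriv t (x - y) * v y

variable {v : ℝ → ℝ}

theorem GaussianIntegrable.integrable_heat (hv : GaussianIntegrable v) {t : ℝ} (ht : 0 < t) (x : ℝ) :
    Integrable fun y => heatKernel t (x - y) * v y := by
  obtain ⟨A, hA, hb⟩ := exists_heatKernel_bounds ht le_rfl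
  exact hv.integrable_mul (continuous_heatKernel ht).measurable (by positivity)
    (fun z => (hb t ⟨le_rfl, le_rfl⟩ z).1) x

theorem GaussianIntegrable.hasDerivAt_heat_space (hv : GaussianIntegrable v) {t : ℝ} (ht : 0 < t)
    (x : ℝ) : HasDerivAt (heat t v) (heatGrad t v x) x := by
  obtain ⟨A, hA, hb⟩ := exists_heatKernel_bounds ht le_rfl
  have hc := continuous_heatKernel ht
  exact hv.hasDerivAt_integral (k := heatKernel t)
    (k' := fun z => -(z / (2 * t)) * heatKernel t z) (hasDerivAt_heatKernel_space ht)
    (Continuous.measurable (by fun_prop)) (show 0 < 1 / (8 * t) by positivity)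
    (fun z => (hb t ⟨le_rfl, le_rfl⟩ z).1) (fun z => (hb t ⟨le_rfl, le_rfl⟩ z).2.1) x

theorem GaussianIntegrable.hasDerivAt_heatGrad (hv : GaussianIntegrable v) {t : ℝ} (ht : 0 < t)
    (x : ℝ) : HasDerivAt (heatGrad t v) (heatLaplacian t v x) x := by
  obtain ⟨A, hA, hb⟩ := exists_heatKernel_bounds ht le_rfl
  exact hv.hasDerivAt_integral (k := fun z => -(z / (2 * t)) * heatKernel t z)
    (hasDerivAt_heatKernel_space_snd ht)
    (continuous_heatKernelDeriv ht).measurable (show 0 < 1 / (8 * t) by positivity)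
    (fun z => (hb t ⟨le_rfl, le_rfl⟩ z).2.1) (fun z => (hb t ⟨le_rfl, le_rfl⟩ z).2.2) x

theorem GaussianIntegrable.hasDerivAt_heat_time (hv : GaussianIntegrable v) {t : ℝ} (ht : 0 < t)
    (x : ℝ) : HasDerivAt (fun t => heat t v x) (heatLaplacian t v x) t := by
  obtain ⟨A, hA, hb⟩ := exists_heatKernel_bounds (a := t / 2) (b := 2 * t) (by positivity)
    (by linarith)
  have hn : Icc (t / 2) (2 * t) ∈ 𝓝 t := Icc_mem_nhds (by linarith) (by linarith)
  have hc : 0 < 1 / (8 * (2 * t)) := by positivity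
  refine (hasDerivAt_integral_of_dominated_loc_of_deriv_le (μ := volume) (s := Icc (t / 2) (2 * t))
    (F := fun t y => heatKernel t (x - y) * v y) (F' := fun t y => heatKernelDeriv t (x - y) * v y)
    (bound := fun y => A * (Real.exp (-(1 / (8 * (2 * t))) * (x - y) ^ 2) * |v y|)) hn
    ?_ (hv.integrable_heat ht x)
    (hv.integrable_mul (continuous_heatKernelDeriv ht).measurable hc
      (fun z => (hb t ⟨by linarith, by linarith⟩ z).2.2) x).aestronglyMeasurable
    (Eventually.of_forall fun y s hs => ?_) ((hv.2 _ hc x).const_mul A)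
    (Eventually.of_forall fun y s hs => ?_)).2
  · filter_upwards [lt_mem_nhds ht] with s hs
    exact (hv.integrable_heat hs x).aestronglyMeasurable
  · rw [norm_mul, Real.norm_eq_abs, Real.norm_eq_abs, ← mul_assoc]
    exact mul_le_mul_of_nonneg_right (hb s hs _).2.2 (abs_nonneg _)
  · exact (hasDerivAt_heatKernel_time (by linarith [hs.1]) (x - y)).mul_const (v y)

end HeatFlow

/-! ### The heat flow of a homogeneous datum as a linear profile. -/

section HeatDatum

variable {β μ ε : ℝ} {u₀ : ℝ → ℝ}

theorem IsInitialDatum.gaussianIntegrable (h₀ : IsInitialDatum β μ ε u₀) (hβ : 0 < β)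
    (hβ1 : β < 1) : GaussianIntegrable u₀ :=
  gaussianIntegrable_of_abs_le h₀.measurable hβ.le hβ1 fun _ hx => (h₀.abs_eq hx).le

theorem IsInitialDatum.mul_left (h₀ : IsInitialDatum β μ ε u₀) {c : ℝ} (hc : 0 < c) (x : ℝ) :
    u₀ (c * x) = c ^ (-β) * u₀ x := by
  have key : ∀ y, 0 < y → u₀ (c * y) = c ^ (-β) * u₀ y := fun y hy => by
    rw [h₀.pos _ (by positivity), h₀.pos y hy, Real.mul_rpow hc.le hy.le]; ring
  rcases lt_trichotomy x 0 with hx | rfl | hx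
  · have h1 := key (-x) (by linarith)
    rw [mul_neg, h₀.neg, h₀.neg] at h1
    have he : ε ≠ 0 := by intro h; have := h₀.sign; simp [h] at this
    apply mul_left_cancel₀ he
    linarith
  · rw [mul_zero, h₀.zero, mul_zero]
  · exact key x hx

theorem IsInitialDatum.heat_eq_scaled (h₀ : IsInitialDatum β μ ε u₀) {t : ℝ} (ht : 0 < t) (x : ℝ) :
    heat t u₀ x = scaled (-(β / 2)) (heat 1 u₀) t x := by
  have hs : 0 < √t := Real.sqrt_pos.2 ht
  rw [scaled, heat_eq_integral_heatKernel_one ht, heat_eq_integral_heatKernel_one one_pos,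
    ← integral_const_mul]
  congr 1
  funext z
  have e : x - √t * z = √t * (x / √t - √1 * z) := by rw [Real.sqrt_one]; field_simp
  rw [e, h₀.mul_left hs, Real.sqrt_eq_rpow t, ← Real.rpow_mul ht.le]
  rw [show 1 / 2 * -β = -(β / 2) by ring]
  ring

theorem IsInitialDatum.heat_neg (h₀ : IsInitialDatum β μ ε u₀) (t x : ℝ) :
    heat t u₀ (-x) = ε * heat t u₀ x := by
  rw [heat, heat, ← integral_const_mul, ← integral_neg_eq_self]
  congr 1
  funext y
  rw [h₀.neg, show -x - -y = -(x - y) by ring, heatKernel_neg]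
  ring

/-- The time derivative at t = 1 is computed twice: from the kernel it is the second space
derivative, and from self-similarity it is -(β/2)Φ - (x/2)Φ', where Φ = e^{Δ}u₀. The condition α > 2
makes u₀ locally integrable. -/
theorem IsInitialDatum.isProfile_heat {α : ℝ} (h₀ : IsInitialDatum (2 / α) μ ε u₀) (hα : 2 < α) :
    IsProfile α 0 (heat 1 u₀) (heatGrad 1 u₀) := by
  have hα0 : 0 < α := by linarith
  have hg := h₀.gaussianIntegrable (by positivity) ((div_lt_one hα0).2 hα)
  have hs : ∀ x, HasDerivAt (heat 1 u₀) (heatGrad 1 u₀ x) x := hg.hasDerivAt_heat_space one_pos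
  refine ⟨hs, fun x => (hg.hasDerivAt_heatGrad one_pos x).congr_deriv ?_⟩
  have h1 := hg.hasDerivAt_heat_time one_pos x
  have h2 := hasDerivAt_scaled_time (c := -(2 / α / 2)) (x := x) one_pos hs
  have h3 : (fun t => heat t u₀ x) =ᶠ[𝓝 1] fun t => scaled (-(2 / α / 2)) (heat 1 u₀) t x := by
    filter_upwards [lt_mem_nhds one_pos] with t ht
    exact h₀.heat_eq_scaled ht x
  rw [h1.unique (h2.congr_of_eventuallyEq h3), scaled, Real.one_rpow, Real.sqrt_one]
  field_simp
  ring

theorem heatKernel_le_sqrt {t z : ℝ} (ht : 0 < t) (hz : 1 / 2 ≤ |z|) : heatKernel t z ≤ 16 * √t := by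
  have hz2 : 1 / 4 ≤ z ^ 2 := by rw [← sq_abs]; nlinarith
  have hs : 0 < √t := Real.sqrt_pos.2 ht
  have h1 : (√(4 * Real.pi * t))⁻¹ ≤ (√t)⁻¹ := by
    gcongr
    nlinarith [Real.pi_gt_three]
  have h2 : Real.exp (-(z ^ 2) / (4 * t)) ≤ 16 * t := by
    have h3 : -(z ^ 2) / (4 * t) ≤ -(1 / (16 * t)) := by
      rw [neg_div, neg_le_neg_iff, div_le_div_iff₀ (by positivity) (by positivity)]
      nlinarith
    refine (Real.exp_le_exp.2 h3).trans ?_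
    rw [Real.exp_neg, inv_le_comm₀ (Real.exp_pos _) (by positivity), ← one_div]
    linarith [Real.add_one_le_exp (1 / (16 * t))]
  calc heatKernel t z ≤ (√t)⁻¹ * (16 * t) := by unfold heatKernel; gcongr
    _ = (√t)⁻¹ * (16 * (√t * √t)) := by rw [Real.mul_self_sqrt ht.le]
    _ = _ := by field_simp

/-- The datum is cut at |x| = 1/2. The outer part is bounded and continuous at 1, so the approximate
identity applies; the inner part is integrable and seen from 1 through a kernel of size O(√t). -/
theorem IsInitialDatum.tendsto_heat_one (h₀ : IsInitialDatum β μ ε u₀) (hβ : 0 < β) (hβ1 : β < 1) :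
    Tendsto (fun t => heat t u₀ 1) (𝓝[>] 0) (𝓝 μ) := by
  have hg := h₀.gaussianIntegrable hβ hβ1
  have hS := measurableSet_lt_abs (1 / 2)
  obtain ⟨S, hSd⟩ : ∃ S, S = {x : ℝ | 1 / 2 < |x|} := ⟨_, rfl⟩
  rw [← hSd] at hS
  have hmem : ∀ x, x ∈ S ↔ 1 / 2 < |x| := fun x => by rw [hSd]; rfl
  have h1 : Tendsto (fun t => heat t (S.indicator u₀) 1) (𝓝[>] 0) (𝓝 μ) := by
    refine tendsto_heat_of_bounded (τ := fun t => t) (v := fun _ => S.indicator u₀)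
      (B := |μ| * (1 / 2 : ℝ) ^ (-β)) self_mem_nhdsWithin
      (Eventually.of_forall fun _ => h₀.measurable.indicator hS)
      (Eventually.of_forall fun _ y => ?_) fun z => ?_
    · by_cases hy : y ∈ S
      · rw [indicator_of_mem hy]
        rw [hmem] at hy
        rw [h₀.abs_eq (abs_pos.1 (by linarith))]
        gcongr ?_ * ?_
        exact Real.rpow_le_rpow_of_nonpos (by norm_num) hy.le (by linarith)
      · rw [indicator_of_notMem hy, abs_zero]; positivity
    · have hx : Tendsto (fun t : ℝ => 1 - √t * z) (𝓝[>] 0) (𝓝 1) := by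
        have : Continuous fun t : ℝ => 1 - √t * z := by fun_prop
        have := this.tendsto 0
        simp only [Real.sqrt_zero, zero_mul, sub_zero] at this
        exact this.mono_left nhdsWithin_le_nhds
      have hc : Tendsto (S.indicator u₀) (𝓝 1) (𝓝 μ) := by
        have h2 : Tendsto (fun x : ℝ => μ * x ^ (-β)) (𝓝 1) (𝓝 μ) := by
          have := ((Real.continuousAt_rpow_const 1 (-β) (Or.inl one_ne_zero)).const_mul μ).tendsto
          simpa using this
        refine h2.congr' ?_
        filter_upwards [lt_mem_nhds (show (1 / 2 : ℝ) < 1 by norm_num)] with x hx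
        rw [indicator_of_mem ((hmem x).2 (hx.trans_le (le_abs_self x))), h₀.pos x (by linarith)]
      exact hc.comp hx
  have hi : Integrable (Sᶜ.indicator u₀) := by
    rw [integrable_indicator_iff hS.compl]
    have h2 := (integrableOn_abs_rpow_neg hβ1 1).mono_set (s := Sᶜ) (fun x hx => by
      rw [mem_compl_iff, hmem, not_lt] at hx
      rw [mem_ball_zero_iff, Real.norm_eq_abs]
      linarith)
    refine (h2.const_mul |μ|).mono' h₀.measurable.aestronglyMeasurable ?_
    filter_upwards [ae_ne_zero Sᶜ] with x hx
    rw [Real.norm_eq_abs, h₀.abs_eq hx]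
  have h2 : Tendsto (fun t => heat t (Sᶜ.indicator u₀) 1) (𝓝[>] 0) (𝓝 0) := by
    have h3 : Tendsto (fun t : ℝ => 16 * √t * ∫ y, ‖Sᶜ.indicator u₀ y‖) (𝓝[>] 0) (𝓝 0) := by
      have : Continuous fun t : ℝ => 16 * √t * ∫ y, ‖Sᶜ.indicator u₀ y‖ := by fun_prop
      have := this.tendsto 0
      simp only [Real.sqrt_zero, zero_mul, mul_zero] at this
      exact this.mono_left nhdsWithin_le_nhds
    refine squeeze_zero_norm' ?_ h3
    filter_upwards [self_mem_nhdsWithin] with t ht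
    rw [heat, ← integral_const_mul]
    refine norm_integral_le_of_norm_le (hi.norm.const_mul _) (Eventually.of_forall fun y => ?_)
    rw [norm_mul, Real.norm_of_nonneg (heatKernel_nonneg _ _)]
    by_cases hy : y ∈ S
    · rw [indicator_of_notMem (by simpa using hy), norm_zero, mul_zero, mul_zero]
    · refine mul_le_mul_of_nonneg_right (heatKernel_le_sqrt ht ?_) (norm_nonneg _)
      rw [hmem, not_lt] at hy
      have := abs_sub_abs_le_abs_sub 1 y
      rw [abs_one] at this
      linarith
  have h3 := h1.add h2
  rw [add_zero] at h3
  refine h3.congr' ?_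
  filter_upwards [self_mem_nhdsWithin] with t ht
  have hsub : ∀ T : Set ℝ, MeasurableSet T → GaussianIntegrable (T.indicator u₀) := fun T hT =>
    gaussianIntegrable_of_abs_le (h₀.measurable.indicator hT) hβ.le hβ1 (B := |μ|) fun x hx => by
      by_cases hxT : x ∈ T
      · rw [indicator_of_mem hxT, h₀.abs_eq hx]
      · rw [indicator_of_notMem hxT, abs_zero]; positivity
  rw [heat, heat, heat, ← integral_add ((hsub S hS).integrable_heat ht 1)
    ((hsub _ hS.compl).integrable_heat ht 1)]
  congr 1
  funext y
  rw [← mul_add]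
  congr 1
  exact congrFun (indicator_self_add_compl S u₀) y

/-- By self-similarity x^β (e^{Δ}u₀)(x) is the heat flow at the point 1 and time x^(-2), so x → ∞
becomes t ↓ 0. -/
theorem IsInitialDatum.tailLimit_heat (h₀ : IsInitialDatum β μ ε u₀) (hβ : 0 < β) (hβ1 : β < 1) :
    tailLimit β (heat 1 u₀) = μ := by
  have h1 : Tendsto (fun x : ℝ => (x ^ 2)⁻¹) atTop (𝓝[>] 0) := by
    refine tendsto_inv_atTop_nhdsGT_zero.comp (tendsto_pow_atTop two_ne_zero)
  refine Tendsto.limUnder_eq (((h₀.tendsto_heat_one hβ hβ1).comp h1).congr' ?_)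
  filter_upwards [eventually_gt_atTop 0] with x hx
  rw [Function.comp_apply, h₀.heat_eq_scaled (by positivity), scaled, tailVal, Real.sqrt_inv,
    Real.sqrt_sq hx.le, one_div, inv_inv, Real.inv_rpow (by positivity), ← Real.rpow_neg (by positivity),
    neg_neg, ← Real.rpow_natCast, ← Real.rpow_mul hx.le]
  congr 2
  push_cast
  ring

end HeatDatum
end
end NLHE
namespace NLHE
noncomputable section

/-! ### Bounds on self-similar functions, jointly in time and space. -/

section ScaledBounds

variable {F : ℝ → ℝ}

/-- The parameter θ trades singularity in t against singularity in x, by (1 + ξ)^(-γ) ≤ ξ^(-θ). -/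
theorem HasDecay.exists_abs_scaled_le {γ : ℝ} (h : HasDecay γ F) :
    ∃ C, 0 ≤ C ∧ ∀ θ ∈ Icc 0 γ, ∀ t, 0 < t → ∀ x, x ≠ 0 →
      |scaled (-(γ / 2)) F t x| ≤ C * t ^ (-((γ - θ) / 2)) * |x| ^ (-θ) := by
  obtain ⟨C, hC, h⟩ := h
  refine ⟨C, hC, fun θ hθ t ht x hx => ?_⟩
  have hs : 0 < √t := Real.sqrt_pos.2 ht
  have hx0 : 0 < |x| := abs_pos.2 hx
  have hξ : 0 < |x| / √t := by positivity
  have h1 : weight γ (x / √t) ≤ (|x| / √t) ^ (-θ) := by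
    unfold weight
    rw [abs_div, abs_of_pos hs]
    calc _ ≤ (1 + |x| / √t) ^ (-θ) :=
          Real.rpow_le_rpow_of_exponent_le (by linarith) (by linarith [hθ.2])
      _ ≤ _ := Real.rpow_le_rpow_of_nonpos hξ (by linarith) (by linarith [hθ.1])
  have h2 : (|x| / √t) ^ (-θ) = t ^ (θ / 2) * |x| ^ (-θ) := by
    rw [Real.div_rpow hx0.le hs.le, Real.sqrt_eq_rpow, ← Real.rpow_mul ht.le,
      show 1 / 2 * -θ = -(θ / 2) by ring, Real.rpow_neg ht.le]
    have := Real.rpow_pos_of_pos ht (θ / 2)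
    field_simp
  rw [scaled, abs_mul, abs_of_pos (Real.rpow_pos_of_pos ht _)]
  calc t ^ (-(γ / 2)) * |F (x / √t)| ≤ t ^ (-(γ / 2)) * (C * (t ^ (θ / 2) * |x| ^ (-θ))) := by
        rw [← h2]
        gcongr
        exact (h _).trans (mul_le_mul_of_nonneg_left h1 hC)
    _ = C * (t ^ (-(γ / 2)) * t ^ (θ / 2)) * |x| ^ (-θ) := by ring
    _ = _ := by
        rw [← Real.rpow_add ht]
        congr 3
        ring

theorem abs_scaled_le {B c a t x : ℝ} (hB : ∀ ξ, |F ξ| ≤ B) (hc : c ≤ 0) (ha : 0 < a) (hat : a ≤ t) :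
    |scaled c F t x| ≤ a ^ c * B := by
  have ht : 0 < t := ha.trans_le hat
  rw [scaled, abs_mul, abs_of_pos (Real.rpow_pos_of_pos ht c)]
  have h1 := Real.rpow_le_rpow_of_nonpos ha hat hc
  exact mul_le_mul h1 (hB _) (abs_nonneg _) (Real.rpow_nonneg ha.le _)

theorem measurable_scaled (hF : Measurable F) (c : ℝ) :
    Measurable fun z : ℝ × ℝ => scaled c F z.1 z.2 := by
  unfold scaled
  exact (measurable_fst.pow_const c).mul (hF.comp (measurable_snd.div measurable_fst.sqrt))

theorem measurable_scaled_time (hF : Measurable F) (c t : ℝ) : Measurable (scaled c F t) :=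
  (measurable_scaled hF c).comp measurable_prodMk_left

theorem exists_bound_of_mul_bounded (hF : Continuous F) {B : ℝ} (h : ∀ x, |x * F x| ≤ B) :
    ∃ C, ∀ x, |F x| ≤ C := by
  obtain ⟨C, hC⟩ := (isCompact_Icc (a := (-1 : ℝ)) (b := 1)).exists_bound_of_continuousOn hF.continuousOn
  have hB : 0 ≤ B := (abs_nonneg _).trans (h 0)
  have hC0 : 0 ≤ C := (norm_nonneg _).trans (hC 0 ⟨by norm_num, by norm_num⟩)
  refine ⟨B + C, fun x => ?_⟩
  rcases le_total |x| 1 with hx | hx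
  · have := hC x (abs_le.1 hx)
    rw [Real.norm_eq_abs] at this
    linarith
  · have h1 := h x
    rw [abs_mul] at h1
    nlinarith [abs_nonneg (F x)]

end ScaledBounds

/-! ### The integral equation and continuity of its terms. -/

section Duhamel

variable {α μ ε : ℝ} {f g u₀ : ℝ → ℝ}

theorem IsProfile.exists_bounds {κ : ℝ} (hα : 0 < α) (hκ : 0 ≤ κ) (hκ1 : κ ≤ 1)
    (h : IsProfile α κ f g) : ∃ B, 0 ≤ B ∧ (∀ x, |f x| ≤ B) ∧ (∀ x, |g x| ≤ B) ∧
      (∀ x, |x * g x| ≤ B) ∧ ∀ x, |profileRhs α κ f g x| ≤ B := by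
  have hβ : 0 ≤ 2 / α := by positivity
  obtain ⟨d0, d1, d2⟩ := h.hasDecay hα hκ hκ1
  obtain ⟨B0, hB0, h0⟩ := d0.bounded hβ
  obtain ⟨B1, hB1, h1⟩ := d1.bounded hβ
  obtain ⟨B2, h2⟩ := exists_bound_of_mul_bounded h.continuous_snd h1
  obtain ⟨B3, hB3, h3⟩ := d2.bounded hβ
  obtain ⟨B4, h4⟩ := exists_bound_of_mul_bounded
    (F := fun x => x * profileRhs α κ f g x) (continuous_id.mul (h.continuous_profileRhs hα))
    (B := B3) (fun x => by rw [← mul_assoc, ← pow_two]; exact h3 x)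
  obtain ⟨B5, h5⟩ := exists_bound_of_mul_bounded (h.continuous_profileRhs hα) h4
  have hB2 : 0 ≤ B2 := (abs_nonneg _).trans (h2 0)
  have hB5 : 0 ≤ B5 := (abs_nonneg _).trans (h5 0)
  refine ⟨B0 + B1 + B2 + B5, by positivity, fun x => (h0 x).trans (by linarith),
    fun x => (h2 x).trans (by linarith), fun x => (h1 x).trans (by linarith),
    fun x => (h5 x).trans (by linarith)⟩

theorem IsProfile.hasDecay_nonlin (hα : 0 < α) (h : IsProfile α 1 f g) :
    HasDecay (2 / α + 2) fun ξ => nonlin α (f ξ) := by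
  obtain ⟨C, hC, hf⟩ := (h.hasDecay hα zero_le_one le_rfl).1
  refine ⟨C ^ (α + 1), by positivity, fun x => ?_⟩
  have e : weight (2 / α + 2) x = weight (2 / α) x ^ (α + 1) := by
    unfold weight
    rw [← Real.rpow_mul (by positivity)]
    congr 1
    field_simp
    ring
  rw [abs_nonlin α _ hα, e, ← Real.mul_rpow hC (weight_pos _ _).le]
  exact Real.rpow_le_rpow (abs_nonneg _) (hf x) (by positivity)

theorem integrableOn_duhamel_weight {t κ : ℝ} (ht : 0 < t) (hκ : 0 ≤ κ) (hκ1 : κ < 1) :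
    IntegrableOn (fun s : ℝ => (√(4 * Real.pi * (t - s)))⁻¹ * s ^ (-κ)) (Ioo 0 t) := by
  have i1 : IntegrableOn (fun s : ℝ => s ^ (-κ)) (Ioo 0 t) := by
    rw [intervalIntegral.integrableOn_Ioo_rpow_iff ht]; linarith
  have i2 : IntegrableOn (fun s : ℝ => (t - s) ^ (-(1 / 2) : ℝ)) (Ioo 0 t) := by
    rw [← intervalIntegrable_iff_integrableOn_Ioo_of_le ht.le]
    have := (intervalIntegral.intervalIntegrable_rpow' (a := 0) (b := t) (r := -(1 / 2))
      (by norm_num)).comp_sub_left t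
    simpa using this.symm
  have hm : Measurable fun s : ℝ => (√(4 * Real.pi * (t - s)))⁻¹ * s ^ (-κ) :=
    (Measurable.inv (by fun_prop)).mul (measurable_id.pow_const _)
  refine ((i1.const_mul ((t / 2) ^ (-(1 / 2) : ℝ))).add (i2.const_mul ((t / 2) ^ (-κ)))).mono'
    hm.aestronglyMeasurable ?_
  filter_upwards [ae_restrict_mem measurableSet_Ioo] with s hs
  have hs0 : 0 < s := hs.1
  have hts : 0 < t - s := sub_pos.2 hs.2
  have hk : (√(4 * Real.pi * (t - s)))⁻¹ ≤ (t - s) ^ (-(1 / 2) : ℝ) := by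
    rw [Real.rpow_neg hts.le, ← Real.sqrt_eq_rpow]
    have : 0 < √(t - s) := Real.sqrt_pos.2 hts
    gcongr
    nlinarith [Real.pi_gt_three]
  have p1 := Real.rpow_pos_of_pos hs0 (-κ)
  have p2 := Real.rpow_pos_of_pos hts (-(1 / 2))
  have p3 := Real.rpow_pos_of_pos (half_pos ht) (-κ)
  have p4 := Real.rpow_pos_of_pos (half_pos ht) (-(1 / 2))
  rw [Real.norm_of_nonneg (by positivity), Pi.add_apply]
  refine (mul_le_mul_of_nonneg_right hk p1.le).trans ?_
  -- On each half of (0, t) only one of the two factors is singular; the other is bounded by its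
  -- value at t/2.
  rcases le_total s (t / 2) with h | h
  · have := Real.rpow_le_rpow_of_nonpos (half_pos ht) (show t / 2 ≤ t - s by linarith)
      (show (-(1 / 2) : ℝ) ≤ 0 by norm_num)
    have h1 := mul_le_mul_of_nonneg_right this p1.le
    have h2 := mul_pos p3 p2
    linarith
  · have := Real.rpow_le_rpow_of_nonpos (half_pos ht) h (show -κ ≤ 0 by linarith)
    have h1 := mul_le_mul_of_nonneg_right this p2.le
    have h2 := mul_pos p4 p1
    linarith [mul_comm (s ^ (-κ)) ((t - s) ^ (-(1 / 2) : ℝ))]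

theorem IsProfile.integrableOn_duhamel (hα : 2 < α) (h : IsProfile α 1 f g) {t : ℝ} (ht : 0 < t)
    (x : ℝ) :
    IntegrableOn (fun z : ℝ × ℝ => heatKernel (t - z.1) (x - z.2) *
      nonlin α (scaled (-(1 / α)) f z.1 z.2)) (Ioo 0 t ×ˢ univ) volume := by
  have hα0 : 0 < α := by linarith
  obtain ⟨β, hβ⟩ : ∃ β, β = 2 / α := ⟨_, rfl⟩
  have hβ0 : 0 < β := by rw [hβ]; positivity
  have hβ1 : β < 1 := by rw [hβ, div_lt_one hα0]; exact hα
  obtain ⟨C, hC, hb⟩ := (h.hasDecay_nonlin hα0).exists_abs_scaled_le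
  rw [← hβ] at hb
  -- The nonlinear term has decay exponent β + 2. Giving (β+1)/2 of it to the space singularity
  -- leaves (β+3)/4 for time, and both are below 1 because β < 1.
  have hw := integrableOn_duhamel_weight (κ := (β + 3) / 4) ht (by positivity) (by linarith)
  have he := integrable_exp_mul_abs_rpow_neg (c := 1 / (4 * t)) (b := (β + 1) / 2) (by positivity)
    (by positivity) (by linarith) x
  have hp := (hw.mul_prod he).const_mul C
  rw [Measure.volume_eq_prod, IntegrableOn, ← Measure.prod_restrict, Measure.restrict_univ]
  have hf := h.continuous_fst.measurable
  have hn : Measurable (nonlin α) := (continuous_nonlin hα0).measurable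
  have hm1 : Measurable fun z : ℝ × ℝ => nonlin α (scaled (-(1 / α)) f z.1 z.2) :=
    hn.comp (measurable_scaled hf _)
  have hm2 : Measurable fun z : ℝ × ℝ => heatKernel (t - z.1) (x - z.2) := by
    unfold heatKernel
    fun_prop
  refine hp.mono' (hm2.mul hm1).aestronglyMeasurable ?_
  have hae : ∀ᵐ z : ℝ × ℝ ∂((volume.restrict (Ioo 0 t)).prod volume), z.1 ∈ Ioo 0 t :=
    Measure.quasiMeasurePreserving_fst.ae (ae_restrict_mem measurableSet_Ioo)
  have hae' : ∀ᵐ z : ℝ × ℝ ∂((volume.restrict (Ioo 0 t)).prod volume), z.2 ≠ 0 :=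
    Measure.quasiMeasurePreserving_snd.ae (by simpa using ae_ne_zero univ)
  filter_upwards [hae, hae'] with z hz hz'
  have hts : 0 < t - z.1 := sub_pos.2 hz.2
  rw [nonlin_scaled hα0 hz.1, norm_mul, Real.norm_of_nonneg (heatKernel_nonneg _ _), Real.norm_eq_abs]
  have h1 := heatKernel_le hts (show t - z.1 ≤ t by linarith [hz.1]) (x - z.2)
  have h2 := hb ((β + 1) / 2) ⟨by positivity, by linarith⟩ z.1 hz.1 z.2 hz'
  rw [show -((β + 2) / 2) = -(1 / α) - 1 by rw [hβ]; ring,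
    show -((β + 2 - (β + 1) / 2) / 2) = -((β + 3) / 4) by ring] at h2
  refine (mul_le_mul h1 h2 (abs_nonneg _) (by positivity)).trans (le_of_eq ?_)
  ring

/-- Green's formula on the line for the Gauss kernel against a function with two bounded
derivatives. -/
theorem integral_heatKernel_mul_sub_eq_zero {τ x B : ℝ} (hτ : 0 < τ) {v v' v'' : ℝ → ℝ}
    (hv : ∀ y, HasDerivAt v (v' y) y) (hv' : ∀ y, HasDerivAt v' (v'' y) y) (hm : Measurable v'')
    (hB : ∀ y, |v y| ≤ B) (hB' : ∀ y, |v' y| ≤ B) (hB'' : ∀ y, |v'' y| ≤ B) :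
    ∫ y, (heatKernel τ (x - y) * v'' y - heatKernelDeriv τ (x - y) * v y) = 0 := by
  obtain ⟨A, hA, hb⟩ := exists_heatKernel_bounds hτ le_rfl
  have hc : 0 < 1 / (8 * τ) := by positivity
  have hk := (continuous_heatKernel hτ).measurable
  have hg : ∀ w : ℝ → ℝ, Measurable w → (∀ y, |w y| ≤ B) → GaussianIntegrable w := fun w hw hwB =>
    gaussianIntegrable_of_abs_le hw (B := B) le_rfl zero_lt_one fun y _ => by simpa using hwB y
  have hvm : Measurable v := (continuous_iff_continuousAt.2 fun y => (hv y).continuousAt).measurable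
  have hvm' : Measurable v' := (continuous_iff_continuousAt.2 fun y => (hv' y).continuousAt).measurable
  refine integral_eq_zero_of_hasDerivAt_of_integrable
    (f := fun y => heatKernel τ (x - y) * v' y + (-((x - y) / (2 * τ)) * heatKernel τ (x - y)) * v y)
    (fun y => ?_) ?_ ?_
  · have d1 := ((hasDerivAt_heatKernel_space hτ (x - y)).comp_const_sub x y).mul (hv' y)
    have d2 := ((hasDerivAt_heatKernel_space_snd hτ (x - y)).comp_const_sub x y).mul (hv y)
    refine (d1.add d2).congr_deriv ?_
    ring
  · exact ((hg v'' hm hB'').integrable_mul hk hc (fun z => (hb τ ⟨le_rfl, le_rfl⟩ z).1) x).sub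
      ((hg v hvm hB).integrable_mul (continuous_heatKernelDeriv hτ).measurable hc
        (fun z => (hb τ ⟨le_rfl, le_rfl⟩ z).2.2) x)
  · exact ((hg v' hvm' hB').integrable_mul hk hc (fun z => (hb τ ⟨le_rfl, le_rfl⟩ z).1) x).add
      ((hg v hvm hB).integrable_mul (k := fun z => -(z / (2 * τ)) * heatKernel τ z)
        (Measurable.mul (by fun_prop) hk) hc (fun z => (hb τ ⟨le_rfl, le_rfl⟩ z).2.1) x)

/-- The derivative of e^{(t-s)Δ}u(s) in s is e^{(t-s)Δ}(u_s - u_xx) once the Laplacian is moved from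
the kernel onto u by Green's formula; the equation turns the bracket into the nonlinearity. -/
theorem IsProfile.hasDerivAt_heat_curve (hα : 0 < α) (h : IsProfile α 1 f g) {t s : ℝ} (hs : 0 < s)
    (hst : s < t) (x : ℝ) :
    HasDerivAt (fun s => heat (t - s) (scaled (-(1 / α)) f s) x)
      (heat (t - s) (fun y => nonlin α (scaled (-(1 / α)) f s y)) x) s := by
  obtain ⟨B, hB, b0, b1, b2, b3⟩ := h.exists_bounds hα zero_le_one le_rfl
  have hc0 : -(1 / α) ≤ 0 := by rw [neg_nonpos]; positivity
  obtain ⟨c, hc⟩ : ∃ c, c = -(1 / α) := ⟨_, rfl⟩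
  obtain ⟨F, hF⟩ : ∃ F : ℝ → ℝ, F = fun ξ => c * f ξ - ξ / 2 * g ξ := ⟨_, rfl⟩
  have hFB : ∀ ξ, |F ξ| ≤ |c| * B + B := fun ξ => by
    rw [hF]
    refine (abs_sub _ _).trans (add_le_add ?_ ?_)
    · rw [abs_mul]; exact mul_le_mul_of_nonneg_left (b0 ξ) (abs_nonneg c)
    · have e : ξ / 2 * g ξ = ξ * g ξ * (1 / 2) := by ring
      rw [e, abs_mul, abs_of_pos (show (0 : ℝ) < 1 / 2 by norm_num)]
      linarith [b2 ξ]
  have hcf := h.continuous_fst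
  have hcg := h.continuous_snd
  have hFm : Measurable F := by rw [hF]; exact Continuous.measurable (by fun_prop)
  have hfm := hcf.measurable
  rw [← hc] at hc0 ⊢
  obtain ⟨D, hD⟩ : ∃ D, D = (s / 2) ^ c * B + (s / 2) ^ (c - 1) * (|c| * B + B) := ⟨_, rfl⟩
  have hs2 : 0 < s / 2 := by positivity
  have hD1 : 0 ≤ (s / 2) ^ c * B := by positivity
  have hD2 : 0 ≤ (s / 2) ^ (c - 1) * (|c| * B + B) := by positivity
  have hu : ∀ σ, s / 2 ≤ σ → ∀ y, |scaled c f σ y| ≤ (s / 2) ^ c * B := fun σ hσ y =>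
    abs_scaled_le b0 hc0 hs2 hσ
  have hut : ∀ σ, s / 2 ≤ σ → ∀ y, |scaled (c - 1) F σ y| ≤ (s / 2) ^ (c - 1) * (|c| * B + B) :=
    fun σ hσ y => abs_scaled_le hFB (by linarith) hs2 hσ
  have hg : ∀ w : ℝ → ℝ, Measurable w → ∀ E, (∀ y, |w y| ≤ E) → GaussianIntegrable w := fun w hw E hwE =>
    gaussianIntegrable_of_abs_le hw (B := E) le_rfl zero_lt_one fun y _ => by simpa using hwE y
  have hgu : ∀ σ, s / 2 ≤ σ → GaussianIntegrable (scaled c f σ) := fun σ hσ =>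
    hg _ (measurable_scaled_time hfm c σ) _ (hu σ hσ)
  have hgut : ∀ σ, s / 2 ≤ σ → GaussianIntegrable (scaled (c - 1) F σ) := fun σ hσ =>
    hg _ (measurable_scaled_time hFm _ σ) _ (hut σ hσ)
  -- The parameter will range over [s/2, (s+t)/2]: its distance to t stays at least (t-s)/2, and it
  -- stays away from 0, where u is singular.
  obtain ⟨A, hA, hb⟩ := exists_heatKernel_bounds (a := (t - s) / 2) (b := t) (by linarith) (by linarith)
  have ht : 0 < t := by linarith
  have hk8 : 0 < 1 / (8 * t) := by positivity
  have hτ : 0 < t - s := sub_pos.2 hst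
  have hmem : t - s ∈ Icc ((t - s) / 2) t := ⟨by linarith, by linarith⟩
  have hss : s / 2 ≤ s := by linarith
  have hiK : ∀ w, GaussianIntegrable w → Integrable fun y => heatKernel (t - s) (x - y) * w y := fun w hw =>
    hw.integrable_heat hτ x
  have hiK' : ∀ w, GaussianIntegrable w → Integrable fun y => heatKernelDeriv (t - s) (x - y) * w y :=
    fun w hw => hw.integrable_mul (continuous_heatKernelDeriv hτ).measurable hk8
      (fun z => (hb _ hmem z).2.2) x
  have hder := (hasDerivAt_integral_of_dominated_loc_of_deriv_le (μ := volume) (x₀ := s)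
    (s := Icc (s / 2) ((s + t) / 2))
    (F := fun σ y => heatKernel (t - σ) (x - y) * scaled c f σ y)
    (F' := fun σ y => -heatKernelDeriv (t - σ) (x - y) * scaled c f σ y
      + heatKernel (t - σ) (x - y) * scaled (c - 1) F σ y)
    (bound := fun y => A * D * Real.exp (-(1 / (8 * t)) * (x - y) ^ 2))
    (Icc_mem_nhds (by linarith) (by linarith)) ?_ (hiK _ (hgu s hss)) ?_ ?_
    ((integrable_exp_neg_mul_sub_sq hk8 x).const_mul _) ?_).2
  · refine hder.congr_deriv ?_
    have hz : ∫ y, (heatKernel (t - s) (x - y) * scaled (c - 1) (profileRhs α 1 f g) s y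
        - heatKernelDeriv (t - s) (x - y) * scaled c f s y) = 0 :=
      integral_heatKernel_mul_sub_eq_zero (B := (s / 2) ^ c * B + (s / 2) ^ (c - 1 / 2) * B
        + (s / 2) ^ (c - 1) * B) hτ (v' := scaled (c - 1 / 2) g s)
        (hasDerivAt_scaled_space hs h.hasDerivAt_fst)
        (fun y => (hasDerivAt_scaled_space hs h.hasDerivAt_snd_rhs y).congr_deriv (by
          rw [show c - 1 / 2 - 1 / 2 = c - 1 by ring]))
        (measurable_scaled_time (h.continuous_profileRhs hα).measurable _ _)
        (fun y => (abs_scaled_le b0 hc0 hs2 hss).trans (by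
          have : 0 ≤ (s / 2) ^ (c - 1 / 2) * B := by positivity
          have : 0 ≤ (s / 2) ^ (c - 1) * B := by positivity
          linarith))
        (fun y => (abs_scaled_le b1 (by linarith) hs2 hss).trans (by
          have : 0 ≤ (s / 2) ^ (c - 1) * B := by positivity
          linarith))
        (fun y => (abs_scaled_le b3 (by linarith) hs2 hss).trans (by
          have : 0 ≤ (s / 2) ^ (c - 1 / 2) * B := by positivity
          linarith))
    have hN : GaussianIntegrable fun y => nonlin α (scaled c f s y) := by
      refine hg _ ((continuous_nonlin hα).measurable.comp (measurable_scaled_time hfm c s))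
        (((s / 2) ^ c * B) ^ (α + 1)) fun y => ?_
      rw [abs_nonlin α _ hα]
      exact Real.rpow_le_rpow (abs_nonneg _) (hu s hss y) (by positivity)
    have hR : GaussianIntegrable (scaled (c - 1) (profileRhs α 1 f g) s) :=
      hg _ (measurable_scaled_time (h.continuous_profileRhs hα).measurable _ _) _
        (fun y => abs_scaled_le b3 (by linarith) hs2 hss)
    have e : ∀ y, -heatKernelDeriv (t - s) (x - y) * scaled c f s y
        + heatKernel (t - s) (x - y) * scaled (c - 1) F s y
        = (heatKernel (t - s) (x - y) * scaled (c - 1) (profileRhs α 1 f g) s y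
        - heatKernelDeriv (t - s) (x - y) * scaled c f s y)
        + heatKernel (t - s) (x - y) * nonlin α (scaled c f s y) := fun y => by
      rw [hc, nonlin_scaled hα hs, ← hc, hF]
      simp only [scaled, profileRhs]
      rw [hc]
      ring
    rw [integral_congr_ae (Eventually.of_forall e)]
    refine (integral_add ((hiK _ hR).sub (hiK' _ (hgu s hss))) (hiK _ hN)).trans ?_
    simp only [Pi.sub_apply]
    rw [hz, zero_add, heat]
  · filter_upwards [Icc_mem_nhds (show s / 2 < s by linarith) hst] with σ hσ
    have : Measurable fun y => heatKernel (t - σ) (x - y) := by unfold heatKernel; fun_prop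
    exact (this.mul (measurable_scaled_time hfm c σ)).aestronglyMeasurable
  · have i1 := (hiK' _ (hgu s hss)).neg.add (hiK _ (hgut s hss))
    refine i1.aestronglyMeasurable.congr (Eventually.of_forall fun y => ?_)
    simp only [Pi.add_apply, Pi.neg_apply]
    ring
  · refine Eventually.of_forall fun y σ hσ => ?_
    have hσ' : t - σ ∈ Icc ((t - s) / 2) t := ⟨by linarith [hσ.2], by linarith [hσ.1]⟩
    have hE := Real.exp_pos (-(1 / (8 * t)) * (x - y) ^ 2)
    have k1 := mul_le_mul (hb _ hσ' (x - y)).2.2 (hu σ hσ.1 y) (abs_nonneg _) (by positivity)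
    have k2 := mul_le_mul (hb _ hσ' (x - y)).1 (hut σ hσ.1 y) (abs_nonneg _) (by positivity)
    rw [Real.norm_eq_abs]
    refine (abs_add_le _ _).trans ?_
    rw [abs_mul, abs_mul, abs_neg, hD]
    refine (add_le_add k1 k2).trans (le_of_eq ?_)
    ring
  · refine Eventually.of_forall fun y σ hσ => ?_
    have d1 := (hasDerivAt_heatKernel_time (show 0 < t - σ by linarith [hσ.2]) (x - y)).comp_const_sub t σ
    have d2 := hasDerivAt_scaled_time (c := c) (x := y) (show 0 < σ by linarith [hσ.1]) h.hasDerivAt_fst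
    rw [← hF] at d2
    exact d1.mul d2

theorem IsProfile.tendsto_heat_curve_end (hα : 0 < α) (h : IsProfile α 1 f g) {t : ℝ} (ht : 0 < t)
    (x : ℝ) :
    Tendsto (fun s => heat (t - s) (scaled (-(1 / α)) f s) x) (𝓝[<] t)
      (𝓝 (scaled (-(1 / α)) f t x)) := by
  obtain ⟨B, hB, b0, -⟩ := h.exists_bounds hα zero_le_one le_rfl
  have hc0 : -(1 / α) ≤ 0 := by rw [neg_nonpos]; positivity
  have hcf := h.continuous_fst
  refine tendsto_heat_of_bounded (B := (t / 2) ^ (-(1 / α)) * B) ?_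
    (Eventually.of_forall fun s => measurable_scaled_time hcf.measurable _ s) ?_ fun z => ?_
  · filter_upwards [self_mem_nhdsWithin] with s hs
    exact sub_pos.2 hs
  · filter_upwards [nhdsWithin_le_nhds (lt_mem_nhds (show t / 2 < t by linarith))] with s hs y
    exact abs_scaled_le b0 hc0 (by positivity) hs.le
  · have hc : ContinuousAt (fun s => scaled (-(1 / α)) f s (x - √(t - s) * z)) t := by
      unfold scaled
      refine (Real.continuousAt_rpow_const t _ (Or.inl ht.ne')).mul
        (ContinuousAt.comp' hcf.continuousAt (ContinuousAt.div ?_ ?_ (Real.sqrt_pos.2 ht).ne'))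
      · fun_prop
      · fun_prop
    have := hc.tendsto
    simp only [sub_self, Real.sqrt_zero, zero_mul, sub_zero] at this
    exact this.mono_left nhdsWithin_le_nhds

/-- Dominated convergence: |u(s,y)| ≤ C|y|^(-β) uniformly in s, and this is integrable against a
Gaussian because β < 1. -/
theorem IsProfile.tendsto_heat_curve_start (hα : 2 < α) (h : IsProfile α 1 f g)
    (h₀ : IsInitialDatum (2 / α) μ ε u₀) (hL : tailLimit (2 / α) f = μ)
    (hf : ∀ x, f (-x) = ε * f x) {t : ℝ} (ht : 0 < t) (x : ℝ) :
    Tendsto (fun s => heat (t - s) (scaled (-(1 / α)) f s) x) (𝓝[>] 0) (𝓝 (heat t u₀ x)) := by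
  have hα0 : 0 < α := by linarith
  have hβ1 : 2 / α < 1 := (div_lt_one hα0).2 hα
  obtain ⟨C, hC, hs⟩ := h.hasSingularBound hα0 zero_le_one le_rfl h₀ hL hf
  obtain ⟨C', hC', hd⟩ := ((h.hasDecay hα0 zero_le_one le_rfl).1).exists_abs_scaled_le
  rw [show -(2 / α / 2) = -(1 / α) by ring] at hd
  obtain ⟨A, hA, hb⟩ := exists_heatKernel_bounds (a := t / 2) (b := t) (by linarith) (by linarith)
  have hne : ∀ᵐ y : ℝ, y ≠ 0 := by simpa using ae_ne_zero univ
  have hi := ((integrable_exp_mul_abs_rpow_neg (c := 1 / (8 * t)) (b := 2 / α) (by positivity)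
    (by positivity) hβ1 x).const_mul (A * C'))
  have hnear : ∀ᶠ s in 𝓝[>] (0 : ℝ), s < t / 2 :=
    nhdsWithin_le_nhds (gt_mem_nhds (by positivity))
  refine tendsto_integral_filter_of_dominated_convergence _ ?_ ?_ hi ?_
  · refine Eventually.of_forall fun s => ?_
    have : Measurable fun y => heatKernel (t - s) (x - y) := by unfold heatKernel; fun_prop
    exact (this.mul (measurable_scaled_time h.continuous_fst.measurable _ s)).aestronglyMeasurable
  · filter_upwards [hnear, self_mem_nhdsWithin] with s hs1 hs0
    filter_upwards [hne] with y hy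
    have k1 := (hb (t - s) ⟨by linarith, by linarith [show 0 < s from hs0]⟩ (x - y)).1
    have k2 := hd (2 / α) ⟨by positivity, le_rfl⟩ s hs0 y hy
    rw [sub_self, zero_div, neg_zero, Real.rpow_zero, mul_one] at k2
    rw [norm_mul, Real.norm_eq_abs, Real.norm_eq_abs]
    refine (mul_le_mul k1 k2 (abs_nonneg _) (by positivity)).trans (le_of_eq ?_)
    ring
  · filter_upwards [hne] with y hy
    have l1 : Tendsto (fun s => heatKernel (t - s) (x - y)) (𝓝[>] 0) (𝓝 (heatKernel t (x - y))) := by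
      have h1 := (hasDerivAt_heatKernel_time ht (x - y)).continuousAt.tendsto
      have h2 : Tendsto (fun s : ℝ => t - s) (𝓝[>] 0) (𝓝 t) := by
        have : Continuous fun s : ℝ => t - s := by fun_prop
        have := this.tendsto 0
        rw [sub_zero] at this
        exact this.mono_left nhdsWithin_le_nhds
      exact h1.comp h2
    have l2 : Tendsto (fun s => scaled (-(1 / α)) f s y) (𝓝[>] 0) (𝓝 (u₀ y)) := by
      rw [tendsto_iff_norm_sub_tendsto_zero]
      have h3 : Tendsto (fun s : ℝ => C * s ^ (1 : ℝ) * |y| ^ (-(2 / α + 2 * 1))) (𝓝[>] 0) (𝓝 0) := by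
        have : Continuous fun s : ℝ => C * s * |y| ^ (-(2 / α + 2 * 1)) := by fun_prop
        have := this.tendsto 0
        simp only [mul_zero, zero_mul] at this
        simp only [Real.rpow_one]
        exact this.mono_left nhdsWithin_le_nhds
      refine squeeze_zero' (Eventually.of_forall fun _ => norm_nonneg _) ?_ h3
      filter_upwards [self_mem_nhdsWithin] with s hs0
      exact hs 1 ⟨zero_le_one, le_rfl⟩ s hs0 y hy
    exact l1.mul l2

theorem IsProfile.solvesIntegralEquation (hα : 2 < α) (h : IsProfile α 1 f g)
    (h₀ : IsInitialDatum (2 / α) μ ε u₀) (hL : tailLimit (2 / α) f = μ)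
    (hf : ∀ x, f (-x) = ε * f x) : SolvesIntegralEquation α (scaled (-(1 / α)) f) u₀ := by
  intro t ht x
  have hα0 : 0 < α := by linarith
  have hi := h.integrableOn_duhamel hα ht x
  refine ⟨(h₀.gaussianIntegrable (by positivity) ((div_lt_one hα0).2 hα)).integrable_heat ht x, hi, ?_⟩
  have hint : IntervalIntegrable
      (fun s => heat (t - s) (fun y => nonlin α (scaled (-(1 / α)) f s y)) x) volume 0 t := by
    rw [intervalIntegrable_iff_integrableOn_Ioo_of_le ht.le]
    rw [Measure.volume_eq_prod, IntegrableOn, ← Measure.prod_restrict, Measure.restrict_univ] at hi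
    exact hi.integral_prod_left
  -- The fundamental theorem is used on the open interval, with one-sided limits u(t) and e^{tΔ}u₀
  -- at its ends.
  rw [duhamel, intervalIntegral.integral_eq_sub_of_hasDerivAt_of_tendsto ht
    (fun s hs => h.hasDerivAt_heat_curve hα0 hs.1 hs.2 x) hint
    (h.tendsto_heat_curve_start hα h₀ hL hf ht x) (h.tendsto_heat_curve_end hα0 ht x)]
  ring

theorem IsProfile.hasIntegralProperties (hα : 2 < α) (h : IsProfile α 1 f g)
    (h₀ : IsInitialDatum (2 / α) μ ε u₀) (hL : tailLimit (2 / α) f = μ)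
    (hf : ∀ x, f (-x) = ε * f x) : HasIntegralProperties α (scaled (-(1 / α)) f) u₀ := by
  have hα0 : 0 < α := by linarith
  have hβ : 0 < 2 / α := by positivity
  have hβ1 : 2 / α < 1 := (div_lt_one hα0).2 hα
  have hS := h.solvesIntegralEquation hα h₀ hL hf
  have hφ := h₀.isProfile_heat hα
  have hLφ := h₀.tailLimit_heat hβ hβ1
  have hu := h.isWeightedLipschitz hα0 zero_le_one le_rfl
  have he : ∀ t, 0 < t → ∀ x, heat t u₀ x = scaled (-(1 / α)) (heat 1 u₀) t x := fun t ht x => by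
    rw [h₀.heat_eq_scaled ht, show -(2 / α / 2) = -(1 / α) by ring]
  have hh : IsWeightedLipschitz (weight (2 / α)) fun t => heat t u₀ :=
    (hφ.isWeightedLipschitz hα0 le_rfl zero_le_one).congr he
  refine ⟨hS, fun r _ hr => ?_, fun r _ hr hr' => ?_⟩
  · have hw := memLp_weight_two_div hα0 hr
    refine ⟨hu.continuousInLp hw, hh.continuousInLp hw, ?_⟩
    -- By the integral equation the Duhamel term is the difference of the other two, so it inherits
    -- their Lipschitz bounds.
    refine ((hu.sub hh).congr fun t ht x => ?_).continuousInLp hw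
    rw [(hS t ht x).2.2]
    ring
  · have hr1 : (1 : ℝ≥0∞) ≤ r := Fact.out
    have hrt : r ≠ ∞ := hr'.ne_top
    have hr2 : ENNReal.ofReal (1 / (2 / α + 2)) < r := by
      rwa [show 1 / (2 / α + 2) = α / (2 * (α + 1)) by field_simp; ring]
    have hr3 : r < ENNReal.ofReal (1 / (2 / α)) := by rwa [one_div_div]
    have hw : MemLp (weight (2 / α + 2)) r volume := memLp_weight (by positivity) hr2
    have hneg : tailLimit (2 / α) (fun x => f (-x)) = tailLimit (2 / α) fun x => heat 1 u₀ (-x) := by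
      have e1 : (fun x => f (-x)) = fun x => ε * f x := funext hf
      have e2 : (fun x => heat 1 u₀ (-x)) = fun x => ε * heat 1 u₀ x := funext (h₀.heat_neg 1)
      rw [e1, e2]
      rcases eq_or_eq_neg_of_abs_eq h₀.sign with rfl | rfl
      · simp only [one_mul]; rw [hL, hLφ]
      · simp only [neg_mul, one_mul]
        rw [h.tailLimit_neg hα0 zero_le_one le_rfl, hφ.tailLimit_neg hα0 le_rfl zero_le_one, hL, hLφ]
    obtain ⟨d0, d1⟩ := h.hasDecay_sub hα0 zero_le_one le_rfl le_rfl zero_le_one hφ (hL.trans hLφ.symm) hneg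
    have hD : IsWeightedLipschitz (weight (2 / α + 2))
        fun t x => scaled (-(1 / α)) f t x - heat t u₀ x := by
      refine (isWeightedLipschitz_scaled (by positivity) (-(1 / α))
        (F := fun ξ => f ξ - heat 1 u₀ ξ) (F' := fun ξ => g ξ - heatGrad 1 u₀ ξ)
        (fun ξ => (h.hasDerivAt_fst ξ).sub (hφ.hasDerivAt_fst ξ)) d0 d1).congr fun t ht x => ?_
      rw [he t ht, scaled, scaled, scaled]
      ring
    -- Both u and the heat flow approach u₀ with a singular bound; in the difference u₀ cancels.
    -- This gives continuity at t = 0, and `hD` gives it for t > 0.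
    have hsing : HasSingularBound (2 / α) fun t x => scaled (-(1 / α)) f t x - heat t u₀ x := by
      obtain ⟨C, hC, hb⟩ := (h.hasSingularBound hα0 zero_le_one le_rfl h₀ hL hf).sub
        (hφ.hasSingularBound hα0 le_rfl zero_le_one h₀ hLφ (h₀.heat_neg 1))
      refine ⟨C, hC, fun δ hδ t ht x hx => ?_⟩
      have := hb δ hδ t ht x hx
      simp only at this ⊢
      rwa [← he t ht, sub_sub_sub_cancel_right] at this
    have h0 := hsing.tendsto_eLpNorm_volume hβ
      (fun t ht => (hD.cont t ht).aestronglyMeasurable) hr1 hr2 hr3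
    refine ⟨fun t => if 0 < t then toLpCurve r (fun t x => scaled (-(1 / α)) f t x - heat t u₀ x) t else 0,
      ?_, if_neg (lt_irrefl 0), fun t ht => ?_⟩
    · intro t ht
      rcases (show 0 ≤ t from ht).eq_or_lt with rfl | ht0
      · rw [← Ioi_insert, continuousWithinAt_insert_self, ContinuousWithinAt, if_neg (lt_irrefl 0),
          tendsto_zero_iff_norm_tendsto_zero]
        have h1 := (ENNReal.tendsto_toReal ENNReal.zero_ne_top).comp h0
        rw [ENNReal.toReal_zero] at h1
        refine h1.congr' ?_
        filter_upwards [self_mem_nhdsWithin] with s hs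
        have hs0 : 0 < s := hs
        rw [if_pos hs0, Lp.norm_def, Function.comp_apply,
          eLpNorm_congr_ae (coeFn_toLpCurve (hD.memLp hw hs0))]
      · refine ContinuousAt.continuousWithinAt ?_
        refine ((hD.continuousOn_toLpCurve hw).continuousAt (Ioi_mem_nhds ht0)).congr ?_
        filter_upwards [lt_mem_nhds ht0] with s hs
        rw [if_pos hs]
    · simp only [if_pos ht]
      exact coeFn_toLpCurve (hD.memLp hw ht)

end Duhamel
end
end NLHE
namespace NLHE
noncomputable section

/-! ### Zeros on the whole line, choice of sign, and the theorem. -/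

section Conclusion

theorem encard_zeros_of_even_abs {f : ℝ → ℝ} (hf : ∀ x, |f (-x)| = |f x|) {n : ℕ}
    (hn : {x : ℝ | 0 < x ∧ f x = 0}.encard = n) :
    {x : ℝ | x ≠ 0 ∧ f x = 0}.encard = (2 * n : ℕ) := by
  have e : {x : ℝ | x ≠ 0 ∧ f x = 0}
      = {x : ℝ | 0 < x ∧ f x = 0} ∪ Neg.neg '' {x : ℝ | 0 < x ∧ f x = 0} := by
    ext x
    simp only [mem_ofPred_eq, mem_union, image_neg_eq_neg, Set.mem_neg]
    have h1 : f (-x) = 0 ↔ f x = 0 := by rw [← abs_eq_zero, hf, abs_eq_zero]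
    rw [h1, ← or_and_right, neg_pos, ne_iff_gt_or_lt]
  have hd : Disjoint {x : ℝ | 0 < x ∧ f x = 0} (Neg.neg '' {x : ℝ | 0 < x ∧ f x = 0}) := by
    rw [Set.disjoint_left]
    rintro x ⟨hx, -⟩ ⟨y, ⟨hy, -⟩, rfl⟩
    linarith
  rw [e, encard_union_eq hd, neg_injective.encard_image, hn]
  push_cast
  ring

variable {α μ ε θ₀ a : ℝ} {f g u₀ : ℝ → ℝ}

/-- Up to sign, a profile with the right decay at infinity provides a solution. -/
theorem IsParityProfile.exists_isProfile_tailLimit_eq (h : IsParityProfile α θ₀ a f g)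
    (hL : |tailLimit (2 / α) f| = |μ|) :
    ∃ f' g', IsProfile α 1 f' g' ∧ tailLimit (2 / α) f' = μ ∧ (f' = f ∧ g' = g ∨
      f' = (fun x => -f x) ∧ g' = fun x => -g x) := by
  rcases abs_eq_abs.1 hL with h1 | h1
  · exact ⟨f, g, h.profile, h1, Or.inl ⟨rfl, rfl⟩⟩
  · refine ⟨_, _, h.profile.neg, ?_, Or.inr ⟨rfl, rfl⟩⟩
    rw [h.profile.tailLimit_neg h.pos zero_le_one le_rfl, h1, neg_neg]

theorem IsProfile.isSolutionWithZeros (hα : 0 < α) (h : IsProfile α 1 f g)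
    (h₀ : IsInitialDatum (2 / α) μ ε u₀) (hL : tailLimit (2 / α) f = μ)
    (hf : ∀ x, f (-x) = ε * f x) {n : ℕ} (hn : {x : ℝ | f x = 0}.encard = n) :
    IsSolutionWithZeros α u₀ n (scaled (-(1 / α)) f) where
  profile := ⟨f, h.isRegularSelfSimilar hα, hn⟩
  initial_value := h.hasInitialValue hα h₀ hL hf
  regularity := h.hasLpRegularity hα
  integral_equation hα2 := h.hasIntegralProperties hα2 h₀ hL hf

theorem exists_two_solutions (hα : 0 < α) (hμ : μ ≠ 0) (hθ : IsParityAngle θ₀)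
    (h₀ : IsInitialDatum (2 / α) μ ε u₀)
    (hpar : ∀ a f g, IsParityProfile α θ₀ a f g → ∀ x, f (-x) = ε * f x) {z : ℕ → ℕ}
    (hz : ∀ a f g n, IsParityProfile α θ₀ a f g → {x : ℝ | 0 < x ∧ f x = 0}.encard = (n : ℕ) →
      {x : ℝ | f x = 0}.encard = z n) :
    ∃ m₀ : ℕ, ∀ m : ℕ, m₀ ≤ m → ∃ u₁ u₂ : ℝ → ℝ → ℝ,
      (∃ t : ℝ, 0 < t ∧ ∃ x : ℝ, u₁ t x ≠ u₂ t x) ∧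
      ∀ u : ℝ → ℝ → ℝ, u = u₁ ∨ u = u₂ →
        (∀ t x, u t (-x) = ε * u t x) ∧ IsSolutionWithZeros α u₀ (z m) u := by
  obtain ⟨F, G, H⟩ := exists_isShootingFamily hα hθ
  obtain ⟨m₀, hm₀⟩ := H.exists_two (abs_pos.2 hμ)
  refine ⟨m₀, fun m hm => ?_⟩
  obtain ⟨s₁, s₂, hs, hsol⟩ := hm₀ m hm
  obtain ⟨L₁, Z₁⟩ := hsol s₁ (Or.inl rfl)
  obtain ⟨L₂, Z₂⟩ := hsol s₂ (Or.inr rfl)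
  have main : ∀ a f g, IsParityProfile α θ₀ a f g → |tailLimit (2 / α) f| = |μ| →
      {x : ℝ | 0 < x ∧ f x = 0}.encard = m → ∃ f' g', IsProfile α 1 f' g' ∧ |f' 0| = |f 0| ∧
        |g' 0| = |g 0| ∧ (∀ t x, scaled (-(1 / α)) f' t (-x) = ε * scaled (-(1 / α)) f' t x) ∧
        IsSolutionWithZeros α u₀ (z m) (scaled (-(1 / α)) f') := by
    intro a f g h hL hZ
    obtain ⟨f', g', h', hL', hfg⟩ := h.exists_isProfile_tailLimit_eq hL
    have hf' : ∀ x, f' (-x) = ε * f' x := by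
      rcases hfg with ⟨rfl, -⟩ | ⟨rfl, -⟩
      · exact hpar _ _ _ h
      · intro x; simp only [hpar _ _ _ h x]; ring
    have habs : ∀ x, |f' x| = |f x| := by
      rcases hfg with ⟨rfl, -⟩ | ⟨rfl, -⟩ <;> simp
    have hn : {x : ℝ | f' x = 0}.encard = z m := by
      rw [← hz a f g m h hZ]
      congr 1
      ext x
      simp only [mem_ofPred_eq]
      rw [← abs_eq_zero, habs, abs_eq_zero]
    refine ⟨f', g', h', habs 0, ?_, fun t x => ?_, h'.isSolutionWithZeros hα h₀ hL' hf' hn⟩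
    · rcases hfg with ⟨-, rfl⟩ | ⟨-, rfl⟩ <;> simp
    · rw [scaled, scaled, neg_div, hf']; ring
  obtain ⟨f₁, g₁, p₁, a₁, b₁, e₁, S₁⟩ := main _ _ _ (H.member s₁) L₁ Z₁
  obtain ⟨f₂, g₂, p₂, a₂, b₂, e₂, S₂⟩ := main _ _ _ (H.member s₂) L₂ Z₂
  refine ⟨scaled (-(1 / α)) f₁, scaled (-(1 / α)) f₂, ⟨1, one_pos, ?_⟩, ?_⟩
  -- Equal solutions at t = 1 have equal profiles. As the profiles were fixed only up to sign, the
  -- data are compared through f(0)² + f'(0)² = exp(2s), which determines s.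
  · by_contra! hcon
    have hf : f₁ = f₂ := funext fun x => by simpa [scaled] using hcon x
    have hg : g₁ 0 = g₂ 0 := by
      have := p₁.hasDerivAt_fst 0
      rw [hf] at this
      exact this.unique (p₂.hasDerivAt_fst 0)
    rw [hf, a₂, (H.member s₁).fst_zero, (H.member s₂).fst_zero, ← sq_eq_sq_iff_abs_eq_abs] at a₁
    rw [hg, b₂, (H.member s₁).snd_zero, (H.member s₂).snd_zero, ← sq_eq_sq_iff_abs_eq_abs] at b₁
    have h1 : Real.exp s₁ ^ 2 = Real.exp s₂ ^ 2 := by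
      have := Real.sin_sq_add_cos_sq θ₀
      linear_combination -a₁ - b₁ + (Real.exp s₂ ^ 2 - Real.exp s₁ ^ 2) * this
    have h2 := Real.exp_lt_exp.2 hs
    have h3 := Real.exp_pos s₁
    nlinarith
  · rintro u (rfl | rfl)
    · exact ⟨e₁, S₁⟩
    · exact ⟨e₂, S₂⟩

end Conclusion
end
end NLHE

theorem theorem1p3 (α μ : ℝ) (hα : 0 < α) (hμ : μ ≠ 0) :
    (∃ m₀ : ℕ, ∀ m : ℕ, m₀ ≤ m → ∃ u₁ u₂ : ℝ → ℝ → ℝ,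
      (∃ t : ℝ, 0 < t ∧ ∃ x : ℝ, u₁ t x ≠ u₂ t x) ∧
      ∀ u : ℝ → ℝ → ℝ, u = u₁ ∨ u = u₂ →
        (∀ t : ℝ, 0 < t → Function.Even (u t)) ∧
        NLHE.IsSolutionWithZeros α (fun x => μ * |x| ^ (-(2 / α))) (2 * m) u) ∧
    (∃ m₀ : ℕ, ∀ m : ℕ, m₀ ≤ m → ∃ u₁ u₂ : ℝ → ℝ → ℝ,
      (∃ t : ℝ, 0 < t ∧ ∃ x : ℝ, u₁ t x ≠ u₂ t x) ∧
      ∀ u : ℝ → ℝ → ℝ, u = u₁ ∨ u = u₂ →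
        (∀ t : ℝ, 0 < t → Function.Odd (u t)) ∧
        NLHE.IsSolutionWithZeros α (fun x => μ * |x| ^ (-(2 / α) - 1) * x) (2 * m + 1) u) := by
  constructor
  · have hpar : ∀ a f g, NLHE.IsParityProfile α 0 a f g → ∀ x, f (-x) = 1 * f x := by
      intro a f g h x
      rw [one_mul]
      exact h.profile.even hα (by simp [h.snd_zero]) x
    obtain ⟨m₀, hm₀⟩ := NLHE.exists_two_solutions (z := fun m => 2 * m) hα hμ (Or.inl rfl)
      (NLHE.isInitialDatum_even (div_pos two_pos hα).ne' μ) hpar fun a f g n h hn => by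
        rw [← NLHE.encard_zeros_of_even_abs (fun x => by rw [hpar a f g h x, one_mul]) hn]
        congr 1
        ext x
        simp only [mem_ofPred_eq, ne_eq, iff_and_self]
        -- An even profile has f(0) = a > 0, so the origin is not among its zeros.
        rintro hx rfl
        have := h.fst_zero
        rw [hx, Real.cos_zero, mul_one] at this
        exact h.amp_pos.ne this
    refine ⟨m₀, fun m hm => ?_⟩
    obtain ⟨u₁, u₂, hne, hu⟩ := hm₀ m hm
    refine ⟨u₁, u₂, hne, fun u h => ⟨fun t _ x => ?_, (hu u h).2⟩⟩
    rw [(hu u h).1, one_mul]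
  · have hpar : ∀ a f g, NLHE.IsParityProfile α (-(Real.pi / 2)) a f g → ∀ x, f (-x) = -1 * f x := by
      intro a f g h x
      rw [neg_one_mul]
      exact h.profile.odd hα (by simp [h.fst_zero]) x
    obtain ⟨m₀, hm₀⟩ := NLHE.exists_two_solutions (z := fun m => 2 * m + 1) hα hμ (Or.inr rfl)
      (NLHE.isInitialDatum_odd (2 / α) μ) hpar fun a f g n h hn => by
        have h1 := NLHE.encard_zeros_of_even_abs
          (fun x => by rw [hpar a f g h x, neg_one_mul, abs_neg]) hn
        -- An odd profile vanishes at the origin, which accounts for the extra zero in 2m + 1.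
        have h2 : {x : ℝ | f x = 0} = insert 0 {x : ℝ | x ≠ 0 ∧ f x = 0} := by
          ext x
          simp only [mem_ofPred_eq, mem_insert_iff]
          rcases eq_or_ne x 0 with rfl | hx
          · simp [h.fst_zero]
          · simp [hx]
        rw [h2, encard_insert_of_notMem (by simp), h1]
        push_cast
        rfl
    refine ⟨m₀, fun m hm => ?_⟩
    obtain ⟨u₁, u₂, hne, hu⟩ := hm₀ m hm
    refine ⟨u₁, u₂, hne, fun u h => ⟨fun t _ x => ?_, (hu u h).2⟩⟩
    rw [(hu u h).1, neg_one_mul]
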